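/- **Setting.** Let $\mathbf c=(c_{ij})_{i,j\in I}$ be a Cartan matrix of finite type with a symmetrizer $(d_i)_{i\in I}$, $d_i\in\mathbb Z_{>0}$, $d_ic_{ij}=d_jc_{ji}$. Fix an orientation $\mathrm O\subset I\times I$: for all $i,j$ one has $c_{ij}<0$ if and only if $(i,j)\in\mathrm O$ or $(j,i)\in\mathrm O$, and never both. Set $o_{ij}=1$ if $(i,j)\in\mathrm O$, $o_{ij}=-1$ if $(j,i)\in \mathrm O$, and $o_{ij}=0$ otherwise. *Quiver varieties.* Let $\widetilde Q_f$ be the triple quiver with double framing. For finite dimensional $I$-graded complex vector spaces $V=\bigoplus_i V_i$ and $W=\bigoplus_i W_i$, its representations on $(V,W)$ are the tuples $x=(\alpha,\varepsilon,a,a^*)$ of linear maps $\alpha_{ij}:V_j\to V_i$ (for $c_{ij}<0$), $\varepsilon_i:V_i\to V_i$, $a_i:V_i\to W_i$, $a_i^*:W_i\to V_i$. They form a vector space $\widetilde{\mathrm X}(V,W)$, on which $G_V=\prod_i\mathrm{GL}(V_i)$ acts. A representation is stable if it has no non-zero subrepresentation supported on $V$, i.e. no non-zero graded subspace of $V$ which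 is stable under $\alpha,\varepsilon$ and killed by $a$. For $v\in\mathbb N^I$ and $V=\mathbb C^v$ let $\widetilde{\mathfrak M}(v,W)=\widetilde{\mathrm X}(V,W)_s/G_V$ be the space of orbits of stable representations, let $\widetilde{\mathfrak M}_0(v,W)=\operatorname{Spec}\mathbb C[\widetilde{\mathrm X}(V,W)]^{G_V}$, let $\tilde\pi:\widetilde{\mathfrak M}(v,W)\to\widetilde{\mathfrak M}_0(v,W)$ be the canonical map, and let $\widetilde{\mathfrak L}(v,W)=\tilde\pi^{-1}(0)$ be the fiber of the class of the zero representation. For $I\times\mathbb Z$-graded $V,W$, with $V=\mathbb C^v$ and $v\in\mathbb N^{(I\times\mathbb Z)}$ of finite support, the graded versions $\widetilde{\mathfrak M}^\bullet(v,W)$, $\widetilde{\mathfrak L}^\bullet(v,W)$ are defined in the same way, from the representations such that $\alpha_{ij},\varepsilon_i,a_i,a_i^*$ are homogeneous of degrees $d_ic_{ij},\,2d_i,\,-d_i,\,-d_i$, from $\mathbb Z$-graded subrepresentations, and from the group $\prod_{i,k}\mathrm{GL}(V_{i,k})$. *Potential.* Given $\gamma=(\gamma_i)$ with $\gamma_i\in\operatorname{End}(W_i)$,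 the function $$\tilde f_\gamma(x)=\sum_{i,j}o_{ij}\operatorname{Tr}\big(\varepsilon_i^{-c_{ij}}\alpha_{ij}\alpha_{ji}\big)+\sum_i\operatorname{Tr}(\varepsilon_ia_i^*a_i)-\sum_i\operatorname{Tr}(\gamma_ia_ia_i^*)$$ descends to $\widetilde{\mathfrak M}(v,W)$. Let $\tilde f_\gamma^\bullet$ be the function given by the same formula on $\widetilde{\mathfrak M}^\bullet(v,W)$. Let $\operatorname{crit}$ denote the critical locus. *Modules.* The generalized preprojective algebra $\widetilde\Pi$ is the quotient of the path algebra of the triple quiver (arrows $\alpha_{ij}:j\to i$ for $c_{ij}<0$, loops $\varepsilon_i$; trivial paths $e_i$) by the relations $$\varepsilon_i^{-c_{ij}}\alpha_{ij}=\alpha_{ij}\varepsilon_j^{-c_{ji}}\quad(c_{ij}<0),\qquad \sum_{j}\sum_{k=0}^{-c_{ij}-1}o_{ij}\,\varepsilon_i^k\alpha_{ij}\alpha_{ji}\varepsilon_i^{-c_{ij}-1-k}=0\quad(i\in I).$$ It is $\mathbb Z$-graded by $\deg\alpha_{ij}=d_ic_{ij}$, $\deg\varepsilon_i=2d_i$.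 Let $\tau$ be the anti-involution of $\widetilde\Pi$ which fixes $e_i,\varepsilon_i$ and maps $\alpha_{ij}$ to $\alpha_{ji}$. For a graded module $M$, let $M[n]_m=M_{m+n}$ and let $M^\vee$ be the graded dual, $(M^\vee)_m=(M_{-m})^\vee$, with the transposed action twisted by $\tau$. For $i\in I$, $k\in\mathbb Z$, $l\geq1$ set $K_{i,k,l}=\big(\widetilde\Pi e_i/\widetilde\Pi\varepsilon_i^l\big)^\vee[-k-ld_i]$, a finite dimensional graded $\widetilde\Pi$-module. Let $(i_r,k_r,l_r)\in I\times\mathbb Z\times\mathbb Z_{>0}$ for $r=1,\dots,s$. For each $r$ let $W_r$ be an $I\times\mathbb Z$-graded vector space concentrated at the vertex $i_r$, with one-dimensional components in the degrees $k_r-(l_r-1)d_{i_r},\,k_r-(l_r-3)d_{i_r},\dots,k_r+(l_r-1)d_{i_r}$, and let $\gamma_r$ be a regular nilpotent endomorphism of $W_r$ (a single Jordan block) which is homogeneous of degree $2d_{i_r}$. Set $W=\bigoplus_rW_r$, $\gamma=\bigoplus_r\gamma_r$, $K_\gamma=\bigoplus_rK_{i_r,k_r,l_r}$. Let $\widetilde{\mathrm{Gr}}_v(K_\gamma)$,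 for $v\in\mathbb N^I$, be the variety of $\widetilde\Pi$-submodules $U\subset K_\gamma$ with $\dim e_iU=v_i$ for all $i$. Let $\widetilde{\mathrm{Gr}}^\bullet_v(K_\gamma)$, for $v\in\mathbb N^{(I\times\mathbb Z)}$, be the variety of graded $\widetilde\Pi$-submodules $U\subset K_\gamma$ with $\dim e_iU_k=v_{i,k}$ for all $i,k$. **Proposition 5.1.** There are homeomorphisms (a) $\operatorname{crit}(\tilde f_\gamma)\cap\widetilde{\mathfrak L}(v,W)\cong\widetilde{\mathrm{Gr}}_v(K_\gamma)$ for every $v\in\mathbb N^I$; (b) $\operatorname{crit}(\tilde f^\bullet_\gamma)\cap\widetilde{\mathfrak L}^\bullet(v,W)\cong\widetilde{\mathrm{Gr}}^\bullet_v(K_\gamma)$ for every $v\in\mathbb N^{(I\times\mathbb Z)}$ of finite support. In each case there is one bijection between the sets of complex points which is a homeomorphism both for the Zariski topologies and for the classical topologies. -/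

import Mathlib

noncomputable section

namespace TripleQuiver

/-! ### Topologies on finite dimensional complex vector spaces -/

/-- The algebra of polynomial functions on a complex vector space: the algebra of functions
generated by the linear forms. -/
def polynomialFunctions (E : Type*) [AddCommGroup E] [Module ℂ E] : Subalgebra ℂ (E → ℂ) :=
  Algebra.adjoin ℂ (Set.range fun φ : Module.Dual ℂ E => (φ : E → ℂ))

/-- The two topologies carried by the points of a complex algebraic variety. -/
inductive TopKind
  | zariski
  | classical

/-- The Zariski, resp. the classical topology of a finite dimensional complex vector space. The
classical one is the coarsest topology for which all linear forms are continuous. -/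
abbrev TopKind.on (T : TopKind) (E : Type*) [AddCommGroup E] [Module ℂ E] : TopologicalSpace E :=
  match T with
  | .zariski => TopologicalSpace.generateFrom
      {U | ∃ p ∈ polynomialFunctions E, U = {x | p x ≠ 0}}
  | .classical => TopologicalSpace.induced (fun (x : E) (φ : Module.Dual ℂ E) => φ x)
      Pi.topologicalSpace

/-! ### Cartan matrices and graded vector spaces -/

/-- A Cartan matrix `c` of finite type (i.e., its symmetrization is positive definite), with a
symmetrizer `d` and an orientation `O`. -/
structure CartanDatum (I : Type*) [Fintype I] [DecidableEq I] where
  c : Matrix I I ℤ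
  d : I → ℕ
  O : I → I → Prop
  diag : ∀ i, c i i = 2
  nonpos : ∀ i j, i ≠ j → c i j ≤ 0
  d_pos : ∀ i, 0 < d i
  symm : ∀ i j, (d i : ℤ) * c i j = d j * c j i
  posDef : (Matrix.of fun i j => ((d i : ℝ) * (c i j : ℝ))).PosDef
  O_iff : ∀ i j, (O i j ∨ O j i) ↔ c i j < 0
  O_asymm : ∀ i j, O i j → ¬ O j i

/-- A finite dimensional `I × Λ`-graded complex vector space `V = ⨁ᵢ Vᵢ`, in coordinates:
`Vᵢ = ℂ ^ (Basis i)`, where the basis vector `b` of `Vᵢ` is homogeneous of degree `deg i b`.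

The degrees live in an additive group `Λ`, which contains an image of `ℤ`. It is `Λ = ℤ` for
`I × ℤ`-graded spaces; for the trivial group `Λ = PUnit` the degrees say nothing, so that one gets
the `I`-graded spaces. -/
structure GradedSpace (I : Type*) (Λ : Type) where
  Basis : I → Type
  fintype : ∀ i, Fintype (Basis i)
  decEq : ∀ i, DecidableEq (Basis i)
  deg : ∀ i, Basis i → Λ

attribute [instance] GradedSpace.fintype GradedSpace.decEq

/-- The `I`-graded space `ℂ ^ v`. -/
def GradedSpace.ofDim {I : Type*} (v : I → ℕ) : GradedSpace I PUnit where
  Basis i := Fin (v i)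
  fintype _ := inferInstance
  decEq _ := inferInstance
  deg _ _ := PUnit.unit

/-- The `I × ℤ`-graded space `ℂ ^ v`: it has `v (i, k)` basis vectors of degree `k` at `i`. -/
def GradedSpace.ofGradedDim {I : Type*} [DecidableEq I] (v : I × ℤ →₀ ℕ) : GradedSpace I ℤ where
  Basis i := Σ k : ↥((v.support.filter fun p => p.1 = i).image Prod.snd), Fin (v (i, k))
  fintype _ := inferInstance
  decEq _ := inferInstance
  deg _ b := b.1

/-- The dimension of the component of vertex `i` and degree `k`. -/
def GradedSpace.dim {I : Type*} {Λ : Type} (V : GradedSpace I Λ) (i : I) (k : Λ) : ℕ :=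
  Nat.card {b : V.Basis i // V.deg i b = k}

section

variable {I : Type*} [Fintype I] [DecidableEq I] (D : CartanDatum I)

/-- The sign `oᵢⱼ`. -/
def CartanDatum.sign (i j : I) : ℂ :=
  open Classical in if D.O i j then 1 else if D.O j i then -1 else 0

/-- The exponent `-cᵢⱼ` (used for `cᵢⱼ ≤ 0` only). -/
def CartanDatum.n (i j : I) : ℕ := (-(D.c i j)).toNat

/-! ### Triple quiver varieties with double framing -/

section Varieties

variable {Λ : Type} [AddCommGroupWithOne Λ]

/-- Tuples of matrices `(α, ε, a, a*)` with `αᵢⱼ : Vⱼ → Vᵢ`, `εᵢ : Vᵢ → Vᵢ`, `aᵢ : Vᵢ → Wᵢ`,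
`aᵢ* : Wᵢ → Vᵢ`, for all `i`, `j`. -/
abbrev Tuple (V W : GradedSpace I Λ) :=
  (∀ i j, Matrix (V.Basis i) (V.Basis j) ℂ) × (∀ i, Matrix (V.Basis i) (V.Basis i) ℂ) ×
    (∀ i, Matrix (W.Basis i) (V.Basis i) ℂ) × (∀ i, Matrix (V.Basis i) (W.Basis i) ℂ)

namespace Tuple

variable {V W : GradedSpace I Λ} (x : Tuple V W)

abbrev α (i j : I) : Matrix (V.Basis i) (V.Basis j) ℂ := x.1 i j
abbrev ε (i : I) : Matrix (V.Basis i) (V.Basis i) ℂ := x.2.1 i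
abbrev a (i : I) : Matrix (W.Basis i) (V.Basis i) ℂ := x.2.2.1 i
abbrev a' (i : I) : Matrix (V.Basis i) (W.Basis i) ℂ := x.2.2.2 i

end Tuple

/-- The representation space of the triple quiver with double framing on `(V, W)`: there is an
arrow `αᵢⱼ : j → i` when `cᵢⱼ < 0`. The arrows `αᵢⱼ`, `εᵢ`, `aᵢ`, `aᵢ*` have the degrees
`dᵢ cᵢⱼ`, `2 dᵢ`, `-dᵢ`, `-dᵢ`. So for `Λ = ℤ` this is the representation space of the graded
quiver; for `Λ = PUnit` the conditions on the degrees are void. -/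
def Rep (V W : GradedSpace I Λ) : Submodule ℂ (Tuple V W) where
  carrier := {x |
    (∀ i j b b', x.α i j b b' ≠ 0 →
      D.c i j < 0 ∧ V.deg i b = V.deg j b' + ((D.d i * D.c i j : ℤ) : Λ)) ∧
    (∀ i b b', x.ε i b b' ≠ 0 → V.deg i b = V.deg i b' + ((2 * D.d i : ℤ) : Λ)) ∧
    (∀ i b b', x.a i b b' ≠ 0 → W.deg i b = V.deg i b' + ((-D.d i : ℤ) : Λ)) ∧
    (∀ i b b', x.a' i b b' ≠ 0 → V.deg i b = W.deg i b' + ((-D.d i : ℤ) : Λ))}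
  zero_mem' := by
    refine ⟨?_, ?_, ?_, ?_⟩ <;> intros <;> simp_all [Tuple.α, Tuple.ε, Tuple.a, Tuple.a']
  add_mem' := by
    rintro x y ⟨hx1, hx2, hx3, hx4⟩ ⟨hy1, hy2, hy3, hy4⟩
    have key : ∀ {p q : ℂ}, p + q ≠ 0 → p ≠ 0 ∨ q ≠ 0 := by
      intro p q h
      by_contra! h'
      simp [h'.1, h'.2] at h
    refine ⟨fun i j b b' h => ?_, fun i b b' h => ?_, fun i b b' h => ?_, fun i b b' h => ?_⟩
    · exact (key h).elim (hx1 i j b b') (hy1 i j b b')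
    · exact (key h).elim (hx2 i b b') (hy2 i b b')
    · exact (key h).elim (hx3 i b b') (hy3 i b b')
    · exact (key h).elim (hx4 i b b') (hy4 i b b')
  smul_mem' := by
    rintro z x ⟨hx1, hx2, hx3, hx4⟩
    refine ⟨fun i j b b' h => ?_, fun i b b' h => ?_, fun i b b' h => ?_, fun i b b' h => ?_⟩
    · exact hx1 i j b b' (right_ne_zero_of_mul h)
    · exact hx2 i b b' (right_ne_zero_of_mul h)
    · exact hx3 i b b' (right_ne_zero_of_mul h)
    · exact hx4 i b b' (right_ne_zero_of_mul h)

/-- A representation is stable if it has no non-zero (graded) subrepresentation supported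
on `V`. -/
def Stable {V W : GradedSpace I Λ} (x : Rep D V W) : Prop :=
  ∀ S : ∀ i, Submodule ℂ (V.Basis i → ℂ),
    (∀ i, ∀ u ∈ S i, ∀ k : Λ,
      (open Classical in fun b => if V.deg i b = k then u b else 0) ∈ S i) →
    (∀ i j, ∀ u ∈ S j, (x.1.α i j).mulVec u ∈ S i) →
    (∀ i, ∀ u ∈ S i, (x.1.ε i).mulVec u ∈ S i) →
    (∀ i, ∀ u ∈ S i, (x.1.a i).mulVec u = 0) →
    ∀ i, S i = ⊥

/-- The group of automorphisms of the graded vector space `V`: it is `∏ᵢ GL(Vᵢ)` for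
`Λ = PUnit`, and `∏ᵢₖ GL(Vᵢₖ)` for `Λ = ℤ`. -/
def gaugeGroup (V : GradedSpace I Λ) :
    Subgroup (∀ i, (Matrix (V.Basis i) (V.Basis i) ℂ)ˣ) where
  carrier := {g | ∀ i b b', V.deg i b ≠ V.deg i b' → (g i : Matrix _ _ ℂ) b b' = 0}
  one_mem' := by
    intro i b b' h
    simp only [Pi.one_apply, Units.val_one]
    exact Matrix.one_apply_ne fun e => h (by rw [e])
  mul_mem' := by
    intro g g' hg hg' i b b' h
    simp only [Pi.mul_apply, Units.val_mul, Matrix.mul_apply]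
    refine Finset.sum_eq_zero fun b'' _ => ?_
    by_cases e : V.deg i b = V.deg i b''
    · rw [hg' i b'' b' (by rwa [← e]), mul_zero]
    · rw [hg i b b'' e, zero_mul]
  inv_mem' := by
    classical
    intro g hg i b b' h
    have hc : Commute (g i : Matrix _ _ ℂ)
        (Matrix.diagonal fun b'' => if V.deg i b'' = V.deg i b then (1 : ℂ) else 0) := by
      ext p q
      simp only [Matrix.mul_diagonal, Matrix.diagonal_mul]
      by_cases e : V.deg i p = V.deg i q
      · simp [e]
      · simp [hg i p q e]
    have h' := congrFun (congrFun (Commute.units_inv_left hc).eq b) b'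
    simpa [Matrix.mul_diagonal, Matrix.diagonal_mul, Ne.symm h] using h'.symm

/-- `y = g · x` for some `g` in the group of automorphisms of `V`. -/
def SameOrbit {V W : GradedSpace I Λ} (x y : Rep D V W) : Prop :=
  ∃ g ∈ gaugeGroup V,
    (∀ i j, y.1.α i j = (g i).val * x.1.α i j * ((g j)⁻¹).val) ∧
    (∀ i, y.1.ε i = (g i).val * x.1.ε i * ((g i)⁻¹).val) ∧
    (∀ i, y.1.a i = x.1.a i * ((g i)⁻¹).val) ∧
    (∀ i, y.1.a' i = (g i).val * x.1.a' i)

theorem sameOrbit_equivalence (V W : GradedSpace I Λ) :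
    Equivalence (SameOrbit D (V := V) (W := W)) where
  refl x := ⟨1, one_mem _, by simp, by simp, by simp, by simp⟩
  symm := by
    rintro x y ⟨g, hg, h1, h2, h3, h4⟩
    have e1 : ∀ i, (g i)⁻¹.val * (g i).val = 1 := fun i => Units.inv_mul _
    refine ⟨g⁻¹, inv_mem hg, fun i j => ?_, fun i => ?_, fun i => ?_, fun i => ?_⟩
    · rw [h1]
      simp only [Pi.inv_apply, inv_inv]
      rw [Matrix.mul_assoc, Matrix.mul_assoc _ _ (g j).val, e1, Matrix.mul_one,
        ← Matrix.mul_assoc, e1, Matrix.one_mul]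
    · rw [h2]
      simp only [Pi.inv_apply, inv_inv]
      rw [Matrix.mul_assoc, Matrix.mul_assoc _ _ (g i).val, e1, Matrix.mul_one,
        ← Matrix.mul_assoc, e1, Matrix.one_mul]
    · rw [h3]
      simp only [Pi.inv_apply, inv_inv]
      rw [Matrix.mul_assoc, e1, Matrix.mul_one]
    · rw [h4]
      simp only [Pi.inv_apply]
      rw [← Matrix.mul_assoc, e1, Matrix.one_mul]
  trans := by
    rintro x y z ⟨g, hg, h1, h2, h3, h4⟩ ⟨g', hg', h1', h2', h3', h4'⟩
    refine ⟨g' * g, mul_mem hg' hg, fun i j => ?_, fun i => ?_, fun i => ?_, fun i => ?_⟩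
    · rw [h1', h1]
      simp [Matrix.mul_assoc]
    · rw [h2', h2]
      simp [Matrix.mul_assoc]
    · rw [h3', h3]
      simp [Matrix.mul_assoc]
    · rw [h4', h4]
      simp [Matrix.mul_assoc]

/-- The orbit relation on the stable representations. -/
def orbitSetoid (V W : GradedSpace I Λ) : Setoid {x : Rep D V W // Stable D x} :=
  Setoid.comap Subtype.val ⟨SameOrbit D, sameOrbit_equivalence D V W⟩

/-- The (graded) triple quiver variety: the set of orbits of stable representations. -/
def QuiverVariety (V W : GradedSpace I Λ) := Quotient (orbitSetoid D V W)

/-- The Zariski, resp. classical topology on the quiver variety, as a quotient of the open set of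
stable representations. -/
abbrev quiverVarietyTop (T : TopKind) (V W : GradedSpace I Λ) :
    TopologicalSpace (QuiverVariety D V W) :=
  TopologicalSpace.coinduced (Quotient.mk (orbitSetoid D V W))
    (TopologicalSpace.induced Subtype.val (T.on (Rep D V W)))

/-- The invariant polynomial functions on the representation space. -/
def invariantPolynomials (V W : GradedSpace I Λ) : Set (Rep D V W → ℂ) :=
  {p | p ∈ polynomialFunctions (Rep D V W) ∧ ∀ x y, SameOrbit D x y → p x = p y}

/-- Two representations have the same image in the spectrum of the algebra of invariants. -/
def affineSetoid (V W : GradedSpace I Λ) : Setoid (Rep D V W) where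
  r x y := ∀ p ∈ invariantPolynomials D V W, p x = p y
  iseqv := ⟨fun _ _ _ => rfl, fun h p hp => (h p hp).symm,
    fun h h' p hp => (h p hp).trans (h' p hp)⟩

/-- The points of the categorical quotient of the representation space. -/
def AffineQuotient (V W : GradedSpace I Λ) := Quotient (affineSetoid D V W)

/-- The canonical map from the quiver variety to the categorical quotient. -/
def toAffineQuotient (V W : GradedSpace I Λ) : QuiverVariety D V W → AffineQuotient D V W :=
  Quotient.lift (fun x => Quotient.mk (affineSetoid D V W) x.1)
    fun x y h => Quotient.sound fun _ hp => hp.2 x.1 y.1 h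

/-- The central fiber: the fiber of the class of the zero representation. -/
def centralFiber (V W : GradedSpace I Λ) : Set (QuiverVariety D V W) :=
  toAffineQuotient D V W ⁻¹' {Quotient.mk (affineSetoid D V W) 0}

/-- The deformed potential, as an invariant function on the representation space:
`∑ᵢⱼ oᵢⱼ Tr(εᵢ^(-cᵢⱼ) αᵢⱼ αⱼᵢ) + ∑ᵢ Tr(εᵢ aᵢ* aᵢ) - ∑ᵢ Tr(γᵢ aᵢ aᵢ*)`. -/
def potential {V W : GradedSpace I Λ} (γ : ∀ i, Matrix (W.Basis i) (W.Basis i) ℂ)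
    (x : Rep D V W) : ℂ :=
  ∑ i, ∑ j, D.sign i j * (x.1.ε i ^ D.n i j * x.1.α i j * x.1.α j i).trace
    + ∑ i, (x.1.ε i * x.1.a' i * x.1.a i).trace
    - ∑ i, (γ i * x.1.a i * x.1.a' i).trace

theorem potential_eq_of_sameOrbit {V W : GradedSpace I Λ}
    (γ : ∀ i, Matrix (W.Basis i) (W.Basis i) ℂ) (x y : Rep D V W) (h : SameOrbit D x y) :
    potential D γ x = potential D γ y := by
  obtain ⟨g, -, h1, h2, h3, h4⟩ := h
  have e1 : ∀ i, (g i)⁻¹.val * (g i).val = 1 := fun i => Units.inv_mul _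
  have hp : ∀ i m, y.1.ε i ^ m = (g i).val * x.1.ε i ^ m * ((g i)⁻¹).val := by
    intro i m
    rw [h2, Units.conj_pow]
  have hc : ∀ i (A : Matrix (V.Basis i) (V.Basis i) ℂ),
      ((g i).val * A * ((g i)⁻¹).val).trace = A.trace := by
    intro i A
    rw [Matrix.trace_mul_comm, ← Matrix.mul_assoc, e1, Matrix.one_mul]
  have e2 : ∀ {R : Type} (i) (A : Matrix (V.Basis i) R ℂ),
      (g i)⁻¹.val * ((g i).val * A) = A := by
    intro R i A
    rw [← Matrix.mul_assoc, e1, Matrix.one_mul]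
  have s1 : ∀ i j, (x.1.ε i ^ D.n i j * x.1.α i j * x.1.α j i).trace =
      (y.1.ε i ^ D.n i j * y.1.α i j * y.1.α j i).trace := by
    intro i j
    rw [← hc i, hp, h1 i j, h1 j i]
    simp only [Matrix.mul_assoc, e2]
  have s2 : ∀ i, (x.1.ε i * x.1.a' i * x.1.a i).trace =
      (y.1.ε i * y.1.a' i * y.1.a i).trace := by
    intro i
    rw [← hc i, h2, h3, h4]
    simp only [Matrix.mul_assoc, e2]
  have s3 : ∀ i, (γ i * x.1.a i * x.1.a' i).trace = (γ i * y.1.a i * y.1.a' i).trace := by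
    intro i
    rw [h3, h4]
    simp only [Matrix.mul_assoc, e2]
  simp only [potential, s1, s2, s3]

/-- The deformed potential, as a function on the quiver variety. -/
def deformedPotential {V W : GradedSpace I Λ} (γ : ∀ i, Matrix (W.Basis i) (W.Basis i) ℂ) :
    QuiverVariety D V W → ℂ :=
  Quotient.lift (fun x => potential D γ x.1) fun x y h => potential_eq_of_sameOrbit D γ x.1 y.1 h

/-- The critical locus of the deformed potential. The quotient map from the open set of stable
representations to the quiver variety is a principal bundle, hence a submersion, and the pull-back
of `deformedPotential` is the restriction of `potential`. So the differential of the former vanishes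
at the class of `x` if and only if the differential of the latter vanishes at `x`, i.e., all its
directional derivatives do. -/
def criticalLocus {V W : GradedSpace I Λ} (γ : ∀ i, Matrix (W.Basis i) (W.Basis i) ℂ) :
    Set (QuiverVariety D V W) :=
  {m | ∃ x : {x : Rep D V W // Stable D x}, Quotient.mk (orbitSetoid D V W) x = m ∧
    ∀ y : Rep D V W, HasLineDerivAt ℂ (potential D γ) 0 x.1 y}

end Varieties

/-! ### The generalized preprojective algebra -/

/-- The generators of the path algebra of the triple quiver: the idempotents `eᵢ` and the arrows
`εᵢ : i → i`, `αᵢⱼ : j → i` (those with `cᵢⱼ < 0` only, the others are put to zero below). -/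
inductive Gen (I : Type*)
  | e (i : I)
  | ε (i : I)
  | α (i j : I)

namespace Gen

/-- The degree of a generator. -/
def deg : Gen I → ℤ
  | e _ => 0
  | ε i => 2 * D.d i
  | α i j => D.d i * D.c i j

/-- The involution which exchanges `αᵢⱼ` and `αⱼᵢ`. -/
def swap : Gen I → Gen I
  | e i => e i
  | ε i => ε i
  | α i j => α j i

/-- The generator in the free algebra. -/
def free (x : Gen I) : FreeAlgebra ℂ (Gen I) := FreeAlgebra.ι ℂ x

end Gen

open Gen in
/-- The defining relations of the generalized preprojective algebra: those of the path algebra of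
the triple quiver, and the cyclic derivatives of the potential
`∑ᵢⱼ oᵢⱼ εᵢ^(-cᵢⱼ) αᵢⱼ αⱼᵢ`. -/
inductive Relation : FreeAlgebra ℂ (Gen I) → FreeAlgebra ℂ (Gen I) → Prop
  | e_mul_self (i : I) : Relation ((e i).free * (e i).free) (e i).free
  | e_mul_of_ne (i j : I) (h : i ≠ j) : Relation ((e i).free * (e j).free) 0
  | sum_e : Relation (∑ i, (e i).free) 1
  | e_mul_ε (i : I) : Relation ((e i).free * (ε i).free) (ε i).free
  | ε_mul_e (i : I) : Relation ((ε i).free * (e i).free) (ε i).free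
  | e_mul_α (i j : I) : Relation ((e i).free * (α i j).free) (α i j).free
  | α_mul_e (i j : I) : Relation ((α i j).free * (e j).free) (α i j).free
  | no_arrow (i j : I) (h : ¬ D.c i j < 0) : Relation (α i j).free 0
  | deriv_α (i j : I) (h : D.c i j < 0) :
      Relation ((ε i).free ^ D.n i j * (α i j).free) ((α i j).free * (ε j).free ^ D.n j i)
  | deriv_ε (i : I) :
      Relation (∑ j, ∑ k ∈ Finset.range (D.n i j), D.sign i j •
        ((ε i).free ^ k * (α i j).free * (α j i).free * (ε i).free ^ (D.n i j - 1 - k))) 0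

/-- The generalized preprojective algebra. -/
def Preproj := RingQuot (Relation D)

instance : Ring (Preproj D) := inferInstanceAs (Ring (RingQuot (Relation D)))

instance : Algebra ℂ (Preproj D) := inferInstanceAs (Algebra ℂ (RingQuot (Relation D)))

namespace Preproj

/-- The class of an element of the free algebra. -/
def mk : FreeAlgebra ℂ (Gen I) →ₐ[ℂ] Preproj D := RingQuot.mkAlgHom ℂ (Relation D)

/-- The class of a generator. -/
def gen (x : Gen I) : Preproj D := mk D x.free

/-- The elements of degree `k`: the span of the words of degree `k` in the generators. -/
def homogeneous {Λ : Type} [AddCommGroupWithOne Λ] (k : Λ) : Submodule ℂ (Preproj D) :=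
  Submodule.span ℂ
    {p | ∃ w : List (Gen I), (((w.map (Gen.deg D)).sum : ℤ) : Λ) = k ∧ p = (w.map (gen D)).prod}

theorem neg_swap (i j : I) : D.c i j < 0 ↔ D.c j i < 0 := by
  rw [← D.O_iff, ← D.O_iff, or_comm]

/-- The anti-involution `τ` which fixes `eᵢ`, `εᵢ` and exchanges `αᵢⱼ` and `αⱼᵢ`, as a morphism to
the opposite algebra. -/
def τ : Preproj D →ₐ[ℂ] (Preproj D)ᵐᵒᵖ :=
  RingQuot.liftAlgHom ℂ
    ⟨FreeAlgebra.lift ℂ fun x : Gen I => MulOpposite.op (gen D x.swap), by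
      have hl : ∀ x : Gen I, FreeAlgebra.lift ℂ (fun x : Gen I => MulOpposite.op (gen D x.swap))
          x.free = MulOpposite.op (mk D x.swap.free) := fun x => FreeAlgebra.lift_ι_apply _ _
      generalize FreeAlgebra.lift ℂ (fun x : Gen I => MulOpposite.op (gen D x.swap)) = L at hl
      have hr : ∀ {x y}, Relation D x y → mk D x = mk D y :=
        fun h => RingQuot.mkAlgHom_rel ℂ h
      intro x y h
      apply MulOpposite.unop_injective
      cases h with
      | e_mul_self i => simpa [hl, Gen.swap] using hr (.e_mul_self i)
      | e_mul_of_ne i j h => simpa [hl, Gen.swap] using hr (.e_mul_of_ne j i h.symm)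
      | sum_e => simpa [hl, Gen.swap] using hr .sum_e
      | e_mul_ε i => simpa [hl, Gen.swap] using hr (.ε_mul_e i)
      | ε_mul_e i => simpa [hl, Gen.swap] using hr (.e_mul_ε i)
      | e_mul_α i j => simpa [hl, Gen.swap] using hr (.α_mul_e j i)
      | α_mul_e i j => simpa [hl, Gen.swap] using hr (.e_mul_α j i)
      | no_arrow i j h =>
        simpa [hl, Gen.swap] using hr (.no_arrow j i (by rwa [neg_swap]))
      | deriv_α i j h =>
        simpa [hl, Gen.swap] using (hr (.deriv_α j i (by rwa [neg_swap]))).symm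
      | deriv_ε i =>
        have := hr (.deriv_ε i)
        rw [map_zero, map_sum] at this
        rw [map_zero, map_sum, MulOpposite.unop_zero, ← this, Finset.unop_sum]
        refine Finset.sum_congr rfl fun j _ => ?_
        refine Eq.trans ?_ (congrArg (mk D) (Finset.sum_range_reflect _ _))
        rw [map_sum, map_sum, Finset.unop_sum]
        refine Finset.sum_congr rfl fun k hk => ?_
        have hk' : D.n i j - 1 - (D.n i j - 1 - k) = k := by
          have := Finset.mem_range.1 hk
          omega
        simp [hl, Gen.swap, hk', mul_assoc]⟩

/-- The left module `Π eᵢ / Π εᵢˡ`. -/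
abbrev CyclicModule (i : I) (l : ℕ) :=
  ↥(Ideal.span {gen D (.e i)}) ⧸ (Ideal.span {gen D (.ε i) ^ l}).submoduleOf
    (Ideal.span {gen D (.e i)})

/-- The image in `Π eᵢ / Π εᵢˡ` of the elements of degree `k`. -/
def CyclicModule.homogeneous {Λ : Type} [AddCommGroupWithOne Λ] (i : I) (l : ℕ) (k : Λ) :
    Set (CyclicModule D i l) :=
  {n | ∃ x : ↥(Ideal.span {gen D (.e i)}), (x : Preproj D) ∈ Preproj.homogeneous D k ∧
    n = Submodule.Quotient.mk x}

end Preproj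

open Preproj

/-- The module `K` dual to `Π eᵢ / Π εᵢˡ`, with the transposed action twisted by `τ`. -/
def DualModule (i : I) (l : ℕ) : Type _ := Module.Dual ℂ (CyclicModule D i l)

namespace DualModule

variable (i : I) (l : ℕ)

instance : AddCommGroup (DualModule D i l) :=
  inferInstanceAs (AddCommGroup (Module.Dual ℂ (CyclicModule D i l)))

instance : Module ℂ (DualModule D i l) :=
  inferInstanceAs (Module ℂ (Module.Dual ℂ (CyclicModule D i l)))

/-- The value of a linear form. -/
def eval : DualModule D i l →ₗ[ℂ] Module.Dual ℂ (CyclicModule D i l) := LinearMap.id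

/-- The action `(p φ)(n) = φ(τ(p) n)`. -/
instance : Module (Preproj D) (DualModule D i l) where
  smul p φ := (eval D i l φ).comp (Algebra.lsmul ℂ ℂ (CyclicModule D i l) (τ D p).unop)
  one_smul φ := by
    refine LinearMap.ext fun n => congrArg (eval D i l φ) ?_
    simp
  mul_smul p q φ := by
    refine LinearMap.ext fun n => congrArg (eval D i l φ) ?_
    simp
  smul_zero p := by
    refine LinearMap.ext fun n => ?_
    rfl
  smul_add p φ ψ := by
    refine LinearMap.ext fun n => ?_
    rfl
  add_smul p q φ := by
    refine LinearMap.ext fun n => ?_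
    refine Eq.trans (congrArg (eval D i l φ) ?_) (map_add _ _ _)
    simp
  zero_smul φ := by
    refine LinearMap.ext fun n => ?_
    refine Eq.trans (congrArg (eval D i l φ) ?_) (map_zero _)
    simp

theorem smul_apply (p : Preproj D) (φ : DualModule D i l) (n : CyclicModule D i l) :
    eval D i l (p • φ) n = eval D i l φ ((τ D p).unop • n) := rfl

instance : IsScalarTower ℂ (Preproj D) (DualModule D i l) where
  smul_assoc z p φ := by
    refine LinearMap.ext fun n => ?_
    refine Eq.trans (congrArg (eval D i l φ) ?_)
      (map_smul (eval D i l φ) z ((τ D p).unop • n))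
    simp

/-- The component of vertex `j` and degree `k` of `(Π eᵢ / Π εᵢˡ)^∨[-s]`: the linear forms `φ` such
that `eⱼ φ = φ`, which vanish on the elements of degree `m` for `m ≠ s - k`. -/
def component {Λ : Type} [AddCommGroupWithOne Λ] (s : ℤ) (j : I) (k : Λ) :
    Submodule ℂ (DualModule D i l) where
  carrier := {φ | gen D (.e j) • φ = φ ∧
    ∀ m : Λ, m ≠ (s : Λ) - k → ∀ n ∈ CyclicModule.homogeneous D i l m, eval D i l φ n = 0}
  zero_mem' := ⟨smul_zero _, fun _ _ _ _ => rfl⟩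
  add_mem' := by
    rintro φ ψ ⟨h1, h2⟩ ⟨h1', h2'⟩
    refine ⟨by rw [smul_add, h1, h1'], fun m hm n hn => ?_⟩
    rw [map_add, LinearMap.add_apply, h2 m hm n hn, h2' m hm n hn, add_zero]
  smul_mem' := by
    rintro z φ ⟨h1, h2⟩
    refine ⟨?_, fun m hm n hn => ?_⟩
    · refine LinearMap.ext fun n => ?_
      exact congrArg (z • ·) (LinearMap.congr_fun h1 n)
    · rw [map_smul, LinearMap.smul_apply, h2 m hm n hn, smul_zero]

end DualModule

/-! ### The framing `W`, the nilpotent operator `γ`, and the module `K_γ` -/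

/-- The degrees `k - (l - 1) dᵢ, k - (l - 3) dᵢ, …, k + (l - 1) dᵢ`. -/
def blockDeg (i : I) (k : ℤ) (l : ℕ) (m : Fin l) : ℤ := k - (l - 1) * D.d i + 2 * D.d i * (m : ℕ)

/-- Triples `(iᵣ, kᵣ, lᵣ)` with `lᵣ ≥ 1`, for `r = 1, …, s`. For each of them, `W_r` is the
graded space with a homogeneous basis of vectors of vertex `iᵣ` and of degrees
`kᵣ - (lᵣ - 1) d, kᵣ - (lᵣ - 3) d, …, kᵣ + (lᵣ - 1) d`, where `d = d_{iᵣ}`, and `γᵣ` is a regular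
nilpotent operator on `W_r` (i.e., with a single Jordan block) which is homogeneous of
degree `2 d`. -/
structure KRDatum where
  s : ℕ
  i : Fin s → I
  k : Fin s → ℤ
  l : Fin s → ℕ
  l_pos : ∀ r, 1 ≤ l r
  γ : ∀ r, Matrix (Fin (l r)) (Fin (l r)) ℂ
  γ_homogeneous : ∀ r m m', γ r m m' ≠ 0 →
    blockDeg D (i r) (k r) (l r) m = blockDeg D (i r) (k r) (l r) m' + 2 * D.d (i r)
  γ_nilpotent : ∀ r, IsNilpotent (γ r)
  γ_regular : ∀ r, γ r ^ (l r - 1) ≠ 0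

namespace KRDatum

variable {D} (K : KRDatum D)

/-- The graded space `W = ⨁ᵣ W_r`, with degrees taken in `Λ`. -/
def W (Λ : Type) [AddCommGroupWithOne Λ] : GradedSpace I Λ where
  Basis i := Σ r : {r : Fin K.s // K.i r = i}, Fin (K.l r)
  fintype _ := inferInstance
  decEq _ := inferInstance
  deg _ b := (blockDeg D (K.i b.1) (K.k b.1) (K.l b.1) b.2 : Λ)

/-- The operator `γ = ⨁ᵣ γᵣ` on `W`. -/
def gamma (Λ : Type) [AddCommGroupWithOne Λ] (i : I) :
    Matrix ((K.W Λ).Basis i) ((K.W Λ).Basis i) ℂ :=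
  Matrix.blockDiagonal' fun r : {r : Fin K.s // K.i r = i} => K.γ r

/-- The module `K_γ = ⨁ᵣ (Π e_{iᵣ} / Π ε_{iᵣ}^{lᵣ})^∨`. -/
abbrev KGamma := ∀ r, DualModule D (K.i r) (K.l r)

/-- The component of `K_γ` of vertex `j` and degree `k`, where the `r`-th summand is shifted
by `[-kᵣ - lᵣ d_{iᵣ}]`. For `Λ = PUnit` this is `eⱼ K_γ`. -/
def component {Λ : Type} [AddCommGroupWithOne Λ] (j : I) (k : Λ) : Submodule ℂ K.KGamma :=
  Submodule.pi Set.univ fun r =>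
    DualModule.component D (K.i r) (K.l r) (K.k r + K.l r * D.d (K.i r)) j k

/-! ### Quiver Grassmannians -/

variable {Λ : Type} [AddCommGroupWithOne Λ]

/-- The Grassmannian of the (graded) submodules of `K_γ` of dimension vector `dim V`. -/
def grassmannian (V : GradedSpace I Λ) : Set (Submodule (Preproj D) K.KGamma) :=
  {U | (U.restrictScalars ℂ = ⨆ (j : I) (k : Λ), U.restrictScalars ℂ ⊓ K.component j k) ∧
    ∀ (j : I) (k : Λ), Module.finrank ℂ ↥(U.restrictScalars ℂ ⊓ K.component j k) = V.dim j k}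

/-- The frames: the injective graded linear maps `V → K_γ` whose image is a submodule, each of them
being given by the images of the basis vectors of `V`. -/
def frames (V : GradedSpace I Λ) : Set (∀ i, V.Basis i → K.KGamma) :=
  {f | (∀ i b, f i b ∈ K.component i (V.deg i b)) ∧
    LinearIndependent ℂ (fun b : Σ i, V.Basis i => f b.1 b.2) ∧
    ∀ p : Preproj D, ∀ u ∈ Submodule.span ℂ (Set.range fun b : Σ i, V.Basis i => f b.1 b.2),
      p • u ∈ Submodule.span ℂ (Set.range fun b : Σ i, V.Basis i => f b.1 b.2)}

/-- The Zariski, resp. classical topology on the quiver Grassmannian: a set of submodules is open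
if and only if the set of the frames of its members is open among all frames. -/
abbrev grassmannianTop (T : TopKind) (V : GradedSpace I Λ) :
    TopologicalSpace (K.grassmannian V) :=
  TopologicalSpace.induced Subtype.val
    (TopologicalSpace.coinduced
      (fun f : K.frames V => Submodule.span (Preproj D)
        (Set.range fun b : Σ i, V.Basis i => f.1 b.1 b.2))
      (TopologicalSpace.induced Subtype.val (T.on (∀ i, V.Basis i → K.KGamma))))

/-- The intersection of the critical locus of the deformed potential with the central fiber. -/
def criticalFiber (V : GradedSpace I Λ) : Set (QuiverVariety D V (K.W Λ)) :=
  criticalLocus D (K.gamma Λ) ∩ centralFiber D V (K.W Λ)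

/-- Its Zariski, resp. classical topology, as a subspace of the quiver variety. -/
abbrev criticalFiberTop (T : TopKind) (V : GradedSpace I Λ) :
    TopologicalSpace (K.criticalFiber V) :=
  TopologicalSpace.induced Subtype.val (quiverVarietyTop D T V (K.W Λ))

end KRDatum

end

end TripleQuiver

end

/-!
A stable representation `x = (α, ε, a, a*)` in the central fiber has `a* = 0`, because the matrix
entries of `a w a*`, for the paths `w` in `α` and `ε`, are invariants without constant term, and by
stability the maps `a w` separate the vectors of `V` (`a'_eq_zero`). If `a* = 0`, then `x` is a
critical point of the potential if and only if `α` and `ε` satisfy the relations of the generalized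
preprojective algebra `Π` and `a ε = γ a` (`critical_iff`). So `V` is a `Π`-module, and since `γ_r`
is a single Jordan block, `a` is determined by its component of highest degree in each `W_r`, which
is a linear form on `V` killed by `ε ^ l`. A vector `b` of `V` then gives, for each `r`, the linear
form `p ↦ a_r (τ(p) b)` on `Π e / Π ε ^ l`, i.e., an element of the `r`-th summand of `K_γ`. This is
a morphism of graded `Π`-modules `V → K_γ`, and it is injective if and only if `x` is stable.
Conversely, the values of linear forms at the powers of `ε` define a stable framing of each
submodule of `K_γ` (`KRDatum.IsFrame.isPoint`).

This matches the critical points in the central fiber with the frames, i.e., with the injective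
graded maps `V → K_γ` whose image is a submodule, and the orbits of the automorphism group of `V`
with the images of the frames (`KRDatum.IsFrame.exists_gauge`). Frames depend polynomially on the
critical points, and the critical points are obtained from the frames by Cramer's rule, so they are
locally regular functions of them. Both topologies are quotient topologies, and the quotient map on
the side of the quiver variety is open, hence the bijection between the quotients is a homeomorphism
for the Zariski and for the classical topologies (`exists_isHomeomorph_quotient`).

It remains to see that the representations obtained from submodules of `K_γ` are in the central
fiber. By a one-parameter subgroup argument this follows from the nilpotency of the arrows on `K_γ`
(`apply_eq_apply_zero`). The nilpotency is where the finite type of the Cartan matrix is used: by an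
induction on dimensions in which the relation at a vertex `i` lets one replace the `i`-th component
of a module by the sum of the images of the maps into it, the dimension vector `v` of a module with
an injective framing of dimension `w` satisfies `(v, v) ≤ 2 (w, v)` (`form_finrank_le`). Since the
form is positive definite, this bounds the steps of the socle filtration of `K_γ`, which is
therefore stationary, and a positive grading shows that it exhausts `K_γ`
(`DualModule.exists_filt_eq_top`).

The `I`-graded and the `I × ℤ`-graded statements are proved at once, for degrees in an additive
group `Λ` which contains an image of `ℤ`.
-/

noncomputable section

set_option linter.unusedSectionVars false

namespace TripleQuiver

/-! ### Locally regular functions and the two topologies -/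

section Regular

variable {X E E' : Type*} [AddCommGroup E] [Module ℂ E] [AddCommGroup E'] [Module ℂ E']

theorem dual_mem_polynomialFunctions (φ : Module.Dual ℂ E) :
    (φ : E → ℂ) ∈ polynomialFunctions E :=
  Algebra.subset_adjoin ⟨φ, rfl⟩

/-- A function on `X` is locally regular with respect to a map `ι` from `X` to a vector space `E`
if near every point it is the pull-back of a quotient of two polynomial functions. Here a
neighbourhood of a point is the non-vanishing locus of the denominator. -/
def LocallyRegular (ι : X → E) (h : X → ℂ) : Prop :=
  ∀ x₀, ∃ p ∈ polynomialFunctions E, ∃ q ∈ polynomialFunctions E,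
    q (ι x₀) ≠ 0 ∧ ∀ x, q (ι x) ≠ 0 → h x = p (ι x) / q (ι x)

theorem LocallyRegular.of_polynomial {ι : X → E} {h : X → ℂ} {p : E → ℂ}
    (hp : p ∈ polynomialFunctions E) (hh : ∀ x, h x = p (ι x)) : LocallyRegular ι h :=
  fun _ => ⟨p, hp, 1, one_mem _, by simp, fun x _ => by simp [hh]⟩

theorem LocallyRegular.const (ι : X → E) (c : ℂ) : LocallyRegular ι fun _ => c :=
  .of_polynomial (p := fun _ => c) (Subalgebra.algebraMap_mem (polynomialFunctions E) c)
    fun _ => rfl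

theorem LocallyRegular.add {ι : X → E} {h h' : X → ℂ} (H : LocallyRegular ι h)
    (H' : LocallyRegular ι h') : LocallyRegular ι fun x => h x + h' x := by
  intro x₀
  obtain ⟨p, hp, q, hq, h0, hx⟩ := H x₀
  obtain ⟨p', hp', q', hq', h0', hx'⟩ := H' x₀
  refine ⟨p * q' + q * p', add_mem (mul_mem hp hq') (mul_mem hq hp'), q * q', mul_mem hq hq',
    mul_ne_zero h0 h0', fun x hne => ?_⟩
  have h1 : q (ι x) ≠ 0 := left_ne_zero_of_mul hne
  have h2 : q' (ι x) ≠ 0 := right_ne_zero_of_mul hne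
  simp only [hx x h1, hx' x h2, Pi.add_apply, Pi.mul_apply]
  rw [div_add_div _ _ h1 h2]

theorem LocallyRegular.mul {ι : X → E} {h h' : X → ℂ} (H : LocallyRegular ι h)
    (H' : LocallyRegular ι h') : LocallyRegular ι fun x => h x * h' x := by
  intro x₀
  obtain ⟨p, hp, q, hq, h0, hx⟩ := H x₀
  obtain ⟨p', hp', q', hq', h0', hx'⟩ := H' x₀
  refine ⟨p * p', mul_mem hp hp', q * q', mul_mem hq hq', mul_ne_zero h0 h0', fun x hne => ?_⟩
  have h1 : q (ι x) ≠ 0 := left_ne_zero_of_mul hne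
  have h2 : q' (ι x) ≠ 0 := right_ne_zero_of_mul hne
  simp only [hx x h1, hx' x h2, Pi.mul_apply]
  rw [div_mul_div_comm]

theorem LocallyRegular.sum {ι : X → E} {S : Type*} {s : Finset S} {h : S → X → ℂ}
    (H : ∀ a ∈ s, LocallyRegular ι (h a)) : LocallyRegular ι fun x => ∑ a ∈ s, h a x := by
  classical
  induction s using Finset.induction_on with
  | empty => simpa using LocallyRegular.const ι 0
  | insert a s ha ih =>
    simp only [Finset.sum_insert ha]
    exact (H a (by simp)).add (ih fun b hb => H b (by simp [hb]))

theorem LocallyRegular.comp_polynomial {ι : X → E} {F : X → E'}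
    (H : ∀ φ : Module.Dual ℂ E', LocallyRegular ι fun x => φ (F x)) {p : E' → ℂ}
    (hp : p ∈ polynomialFunctions E') : LocallyRegular ι fun x => p (F x) := by
  induction hp using Algebra.adjoin_induction with
  | mem p hp => obtain ⟨φ, rfl⟩ := hp; exact H φ
  | algebraMap c => exact .const ι c
  | add p q _ _ h h' => exact h.add h'
  | mul p q _ _ h h' => exact h.mul h'

theorem continuous_of_mem_polynomialFunctions {p : E → ℂ} (hp : p ∈ polynomialFunctions E) :
    @Continuous _ _ (TopKind.classical.on E) _ p := by
  let := TopKind.classical.on E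
  have h0 : Continuous fun (x : E) (φ : Module.Dual ℂ E) => φ x := continuous_induced_dom
  induction hp using Algebra.adjoin_induction with
  | mem p hp =>
    obtain ⟨φ, rfl⟩ := hp
    exact continuous_pi_iff.1 h0 φ
  | algebraMap c => exact continuous_const
  | add p q _ _ h h' => exact h.add h'
  | mul p q _ _ h h' => exact h.mul h'

theorem isOpen_ne_zero (T : TopKind) {p : E → ℂ} (hp : p ∈ polynomialFunctions E) :
    @IsOpen _ (T.on E) {x | p x ≠ 0} := by
  cases T with
  | zariski => exact TopologicalSpace.isOpen_generateFrom_of_mem ⟨p, hp, rfl⟩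
  | classical =>
    let := TopKind.classical.on E
    exact isOpen_compl_singleton.preimage (continuous_of_mem_polynomialFunctions hp)

/-- A map with locally regular coordinates is continuous for both topologies. -/
theorem continuous_of_locallyRegular (T : TopKind) {ι : X → E} {F : X → E'}
    (H : ∀ φ : Module.Dual ℂ E', LocallyRegular ι fun x => φ (F x)) :
    @Continuous _ _ (TopologicalSpace.induced ι (T.on E)) (T.on E') F := by
  let tE := T.on E
  let tX := TopologicalSpace.induced ι tE
  have hι : Continuous ι := continuous_induced_dom
  have hopen : ∀ {p : E → ℂ}, p ∈ polynomialFunctions E → IsOpen {x | p (ι x) ≠ 0} :=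
    fun hp => (isOpen_ne_zero T hp).preimage hι
  cases T with
  | zariski =>
    refine continuous_generateFrom_iff.2 ?_
    rintro _ ⟨p, hp, rfl⟩
    have Hp := LocallyRegular.comp_polynomial H hp
    refine isOpen_iff_mem_nhds.2 fun x₀ hx₀ => ?_
    obtain ⟨r, hr, q, hq, h0, hx⟩ := Hp x₀
    have hr0 : r (ι x₀) ≠ 0 := fun h => hx₀ (by simp [hx x₀ h0, h])
    filter_upwards [(hopen hq).mem_nhds h0, (hopen hr).mem_nhds hr0] with x h1 h2
    change p (F x) ≠ 0
    exact (hx x h1).trans_ne (div_ne_zero h2 h1)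
  | classical =>
    refine continuous_induced_rng.2 (continuous_pi fun φ => ?_)
    refine continuous_iff_continuousAt.2 fun x₀ => ?_
    obtain ⟨r, hr, q, hq, h0, hx⟩ := H φ x₀
    have h1 : ContinuousAt (fun x => r (ι x) / q (ι x)) x₀ :=
      ((continuous_of_mem_polynomialFunctions hr).comp hι).continuousAt.div
        ((continuous_of_mem_polynomialFunctions hq).comp hι).continuousAt h0
    refine h1.congr ?_
    filter_upwards [(hopen hq).mem_nhds h0] with x h2
    exact (hx x h2).symm

theorem continuous_linearMap (T : TopKind) (f : E →ₗ[ℂ] E') :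
    @Continuous _ _ (T.on E) (T.on E') f := by
  have := continuous_of_locallyRegular T (ι := (id : E → E)) (F := f) fun φ =>
    .of_polynomial (dual_mem_polynomialFunctions (φ.comp f)) fun _ => rfl
  rwa [@induced_id _ (T.on E)] at this

/-- If a polynomial function is constant on the line through `x` and `x + y`, except possibly
at the point `x`, then it is constant on it. -/
theorem eq_of_forall_ne_zero {p : E → ℂ} (hp : p ∈ polynomialFunctions E) {x y : E} {c : ℂ}
    (h : ∀ t : ℂ, t ≠ 0 → p (x + t • y) = c) : p x = c := by
  have hc : Continuous fun t : ℂ => p (x + t • y) := by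
    clear h
    induction hp using Algebra.adjoin_induction with
    | mem p hp =>
      obtain ⟨φ, rfl⟩ := hp
      simp only [map_add, map_smul]
      fun_prop
    | algebraMap c => exact continuous_const
    | add p q hp hq h h' => exact h.add h'
    | mul p q hp hq h h' => exact h.mul h'
  have := congrFun (hc.ext_on (dense_compl_singleton (0 : ℂ)) continuous_const
    (fun t ht => h t ht)) 0
  simpa using this

end Regular

/-- Passing to quotients: a bijection `Ψ` between a saturated subset of `S` and the set `F`, which
respects the equivalence relations, induces a bijection `e` between a subset `C` of the quotient `Q`
of `S` and a set `G` of classes of elements of `F`. If `Ψ` is a homeomorphism and `S → Q` is open,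
then `e` is a homeomorphism. -/
theorem exists_isHomeomorph_quotient {ι S Q F B : Type*} (tS : ι → TopologicalSpace S)
    (tF : ι → TopologicalSpace F) (π : S → Q) (hπ : Function.Surjective π) (σ : F → B)
    (C : Set Q) (G : Set B) (Ψ : {x // π x ∈ C} → F) (Ψ' : F → {x // π x ∈ C})
    (hΨ' : ∀ f, Ψ (Ψ' f) = f) (hG : Set.range σ = G)
    (hrel : ∀ x y, π x.1 = π y.1 ↔ σ (Ψ x) = σ (Ψ y))
    (hc : ∀ T, @Continuous _ _ (TopologicalSpace.induced Subtype.val (tS T)) (tF T) Ψ)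
    (hc' : ∀ T, @Continuous _ _ (tF T) (TopologicalSpace.induced Subtype.val (tS T)) Ψ')
    (hopen : ∀ T (U : Set S), @IsOpen _ (tS T) U → @IsOpen _ (tS T) (π ⁻¹' (π '' U))) :
    ∃ e : C → G, ∀ T, @IsHomeomorph _ _
      (TopologicalSpace.induced Subtype.val (TopologicalSpace.coinduced π (tS T)))
      (TopologicalSpace.induced Subtype.val (TopologicalSpace.coinduced σ (tF T))) e := by
  choose out hout using hπ
  have hmem : ∀ m : C, π (out m) ∈ C := fun m => by rw [hout]; exact m.2
  let e : C → G := fun m => ⟨σ (Ψ ⟨out m, hmem m⟩), hG ▸ ⟨_, rfl⟩⟩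
  have he : ∀ (x : {x // π x ∈ C}), e ⟨π x, x.2⟩ = σ (Ψ x) := fun x =>
    (hrel ⟨out (π x), hmem ⟨π x, x.2⟩⟩ x).1 (hout _)
  have hsurj : ∀ m : C, ∃ x : {x // π x ∈ C}, m = ⟨π x, x.2⟩ := fun m =>
    ⟨⟨out m, hmem m⟩, Subtype.ext (hout _).symm⟩
  have hbij : Function.Bijective e := by
    constructor
    · intro m m' h
      obtain ⟨x, rfl⟩ := hsurj m
      obtain ⟨y, rfl⟩ := hsurj m'
      have h' := congrArg Subtype.val h
      rw [he, he] at h'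
      exact Subtype.ext ((hrel x y).2 h')
    · rintro ⟨b, hb⟩
      obtain ⟨f, rfl⟩ : b ∈ Set.range σ := hG ▸ hb
      refine ⟨⟨π (Ψ' f), (Ψ' f).2⟩, Subtype.ext ?_⟩
      rw [he, hΨ']
  refine ⟨e, fun T => ?_⟩
  let := tS T
  let := tF T
  let : TopologicalSpace Q := TopologicalSpace.coinduced π (tS T)
  let : TopologicalSpace B := TopologicalSpace.coinduced σ (tF T)
  have c1 : Continuous Ψ := hc T
  have c2 : Continuous Ψ' := hc' T
  refine ⟨⟨?_⟩, ?_, hbij⟩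
  · rintro _ ⟨O, hO, rfl⟩
    have h1 : IsOpen (Ψ ⁻¹' (σ ⁻¹' O)) := (isOpen_coinduced.1 hO).preimage c1
    obtain ⟨N, hN, hN'⟩ := isOpen_induced_iff.1 h1
    refine isOpen_induced_iff.2 ⟨π '' N, isOpen_coinduced.2 (hopen T N hN), ?_⟩
    ext m
    obtain ⟨x, rfl⟩ := hsurj m
    have key : ∀ z : {x // π x ∈ C}, z.1 ∈ N ↔ σ (Ψ z) ∈ O := fun z =>
      Set.ext_iff.1 hN' z
    simp only [Set.mem_preimage, he]
    constructor
    · rintro ⟨y, hy, hxy⟩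
      have hyC : π y ∈ C := hxy ▸ x.2
      rw [← (hrel ⟨y, hyC⟩ x).1 hxy]
      exact (key ⟨y, hyC⟩).1 hy
    · exact fun h => ⟨x, (key x).2 h, rfl⟩
  · intro A hA
    obtain ⟨A', hA', rfl⟩ := isOpen_induced_iff.1 hA
    refine isOpen_induced_iff.2 ⟨Subtype.val '' (e '' (Subtype.val ⁻¹' A')), ?_, ?_⟩
    · refine isOpen_coinduced.2 ?_
      have h1 : IsOpen (Ψ' ⁻¹' (Subtype.val ⁻¹' (π ⁻¹' A'))) :=
        ((isOpen_coinduced.1 hA').preimage continuous_subtype_val).preimage c2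
      convert h1 using 1
      ext f
      constructor
      · rintro ⟨_, ⟨m, hm, rfl⟩, hf⟩
        obtain ⟨x, rfl⟩ := hsurj m
        rw [he, ← hΨ' f, ← hrel] at hf
        change π (Ψ' f) ∈ A'
        rw [← hf]
        exact hm
      · intro hf
        refine ⟨_, ⟨⟨π (Ψ' f), (Ψ' f).2⟩, hf, rfl⟩, ?_⟩
        rw [he, hΨ']
    · exact Set.preimage_image_eq _ Subtype.val_injective

theorem Gen.swap_swap {I : Type*} (x : Gen I) : x.swap.swap = x := by
  cases x <;> rfl

section

variable {I : Type*} [Fintype I] [DecidableEq I] {D : CartanDatum I}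

/-! ### Cartan data -/

namespace CartanDatum

variable (D)

theorem n_cast {i j : I} (h : D.c i j < 0) : (D.n i j : ℤ) = -D.c i j :=
  Int.toNat_of_nonneg (by omega)

theorem n_pos {i j : I} (h : D.c i j < 0) : 0 < D.n i j := by
  have := D.n_cast h
  omega

theorem n_eq_zero {i j : I} (h : ¬ D.c i j < 0) : D.n i j = 0 :=
  Int.toNat_of_nonpos (by omega)

theorem n_self (i : I) : D.n i i = 0 := D.n_eq_zero (by rw [D.diag]; omega)

theorem c_eq_neg_n {i j : I} (h : i ≠ j) : D.c i j = -D.n i j := by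
  by_cases hc : D.c i j < 0
  · rw [D.n_cast hc, neg_neg]
  · rw [D.n_eq_zero hc]
    have := D.nonpos i j h
    omega

theorem d_mul_n (i j : I) : D.d i * D.n i j = D.d j * D.n j i := by
  by_cases hc : D.c i j < 0
  · have hc' := (Preproj.neg_swap D i j).1 hc
    have := D.symm i j
    zify
    rw [D.n_cast hc, D.n_cast hc']
    linarith
  · have hc' := fun h => hc ((Preproj.neg_swap D i j).2 h)
    simp [D.n_eq_zero hc, D.n_eq_zero hc']

theorem sign_swap (i j : I) : D.sign j i = -D.sign i j := by
  unfold sign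
  have h1 := D.O_asymm i j
  have h2 := D.O_asymm j i
  split_ifs <;> simp_all

theorem sign_eq_zero {i j : I} (h : ¬ D.c i j < 0) : D.sign i j = 0 := by
  rw [← D.O_iff] at h
  push Not at h
  simp [sign, h]

theorem sign_ne_zero {i j : I} (h : D.c i j < 0) : D.sign i j ≠ 0 := by
  rw [← D.O_iff] at h
  unfold sign
  split_ifs <;> simp_all

end CartanDatum

/-! ### The generalized preprojective algebra -/

namespace Preproj

theorem mk_eq_of_relation {x y : FreeAlgebra ℂ (Gen I)} (h : Relation D x y) : mk D x = mk D y :=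
  RingQuot.mkAlgHom_rel ℂ h

theorem e_mul_self (i : I) : gen D (.e i) * gen D (.e i) = gen D (.e i) := by
  simpa [gen] using mk_eq_of_relation (D := D) (.e_mul_self i)

theorem e_mul_of_ne {i j : I} (h : i ≠ j) : gen D (.e i) * gen D (.e j) = 0 := by
  simpa [gen] using mk_eq_of_relation (D := D) (.e_mul_of_ne i j h)

theorem sum_e : ∑ i, gen D (.e i) = 1 := by
  simpa [gen] using mk_eq_of_relation (D := D) .sum_e

theorem e_mul_ε (i : I) : gen D (.e i) * gen D (.ε i) = gen D (.ε i) := by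
  simpa [gen] using mk_eq_of_relation (D := D) (.e_mul_ε i)

theorem ε_mul_e (i : I) : gen D (.ε i) * gen D (.e i) = gen D (.ε i) := by
  simpa [gen] using mk_eq_of_relation (D := D) (.ε_mul_e i)

theorem e_mul_α (i j : I) : gen D (.e i) * gen D (.α i j) = gen D (.α i j) := by
  simpa [gen] using mk_eq_of_relation (D := D) (.e_mul_α i j)

theorem α_mul_e (i j : I) : gen D (.α i j) * gen D (.e j) = gen D (.α i j) := by
  simpa [gen] using mk_eq_of_relation (D := D) (.α_mul_e i j)

theorem no_arrow {i j : I} (h : ¬ D.c i j < 0) : gen D (.α i j) = 0 := by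
  simpa [gen] using mk_eq_of_relation (D := D) (.no_arrow i j h)

theorem deriv_α {i j : I} (h : D.c i j < 0) :
    gen D (.ε i) ^ D.n i j * gen D (.α i j) = gen D (.α i j) * gen D (.ε j) ^ D.n j i := by
  simpa [gen] using mk_eq_of_relation (D := D) (.deriv_α i j h)

theorem deriv_ε (i : I) :
    ∑ j, ∑ k ∈ Finset.range (D.n i j), D.sign i j •
      (gen D (.ε i) ^ k * gen D (.α i j) * gen D (.α j i) * gen D (.ε i) ^ (D.n i j - 1 - k))
      = 0 := by
  have := mk_eq_of_relation (D := D) (.deriv_ε i)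
  simpa only [map_sum, map_smul, map_mul, map_pow, map_zero, gen] using this

theorem ε_mul_e_of_ne {i j : I} (h : i ≠ j) : gen D (.ε i) * gen D (.e j) = 0 := by
  rw [← ε_mul_e, mul_assoc, e_mul_of_ne h, mul_zero]

theorem α_mul_e_of_ne {i j k : I} (h : j ≠ k) : gen D (.α i j) * gen D (.e k) = 0 := by
  rw [← α_mul_e, mul_assoc, e_mul_of_ne h, mul_zero]

theorem mk_surjective : Function.Surjective (mk D) :=
  RingQuot.mkAlgHom_surjective ℂ (Relation D)

theorem e_mul_ε_pow (i : I) (l : ℕ) :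
    gen D (.e i) * gen D (.ε i) ^ l = gen D (.ε i) ^ l * gen D (.e i) := by
  have : Commute (gen D (.e i)) (gen D (.ε i)) := (e_mul_ε i).trans (ε_mul_e i).symm
  exact this.pow_right l

section Module

variable {E : Type*} [AddCommGroup E] [Module ℂ E] [Module (Preproj D) E]
  [IsScalarTower ℂ (Preproj D) E]

theorem smul_mem_of_gen {N : Submodule ℂ E} (h : ∀ x, ∀ u ∈ N, gen D x • u ∈ N) (p : Preproj D) :
    ∀ u ∈ N, p • u ∈ N := by
  obtain ⟨p, rfl⟩ := mk_surjective p
  induction p using FreeAlgebra.induction with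
  | grade0 r =>
    intro u hu
    rw [AlgHom.commutes, algebraMap_smul]
    exact N.smul_mem r hu
  | grade1 x => exact h x
  | mul a b ha hb =>
    intro u hu
    rw [map_mul, mul_smul]
    exact ha _ (hb _ hu)
  | add a b ha hb =>
    intro u hu
    rw [map_add, add_smul]
    exact N.add_mem (ha _ hu) (hb _ hu)

end Module

/-- The class of a word in the generators. -/
def word (w : List (Gen I)) : Preproj D := (w.map (gen D)).prod

@[simp] theorem word_nil : word (D := D) [] = 1 := rfl

@[simp] theorem word_cons (x : Gen I) (w : List (Gen I)) :
    word (D := D) (x :: w) = gen D x * word w := by simp [word]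

theorem word_append (w w' : List (Gen I)) :
    word (D := D) (w ++ w') = word w * word w' := by simp [word]

theorem word_replicate (n : ℕ) (x : Gen I) :
    word (D := D) (List.replicate n x) = gen D x ^ n := by simp [word]

theorem mem_span_word (p : Preproj D) : p ∈ Submodule.span ℂ (Set.range (word (D := D))) := by
  have := smul_mem_of_gen (D := D) (N := Submodule.span ℂ (Set.range (word (D := D))))
    (fun x u hu => by
      induction hu using Submodule.span_induction with
      | mem u hu =>
        obtain ⟨w, rfl⟩ := hu
        exact Submodule.subset_span ⟨x :: w, by simp⟩
      | zero => simp
      | add u v _ _ h h' => rw [smul_add]; exact add_mem h h'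
      | smul c u _ h => rw [smul_comm]; exact Submodule.smul_mem _ c h) p 1
      (Submodule.subset_span ⟨[], rfl⟩)
  simpa using this

theorem word_induction {P : Preproj D → Prop} (p : Preproj D) (h : ∀ w, P (word w))
    (h0 : P 0) (hadd : ∀ p q, P p → P q → P (p + q)) (hsmul : ∀ (c : ℂ) p, P p → P (c • p)) :
    P p := by
  induction mem_span_word p using Submodule.span_induction with
  | mem u hu => obtain ⟨w, rfl⟩ := hu; exact h w
  | zero => exact h0
  | add u v _ _ h h' => exact hadd _ _ h h'
  | smul c u _ h => exact hsmul _ _ h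

theorem linearMap_ext {E : Type*} [AddCommGroup E] [Module ℂ E] {f g : Preproj D →ₗ[ℂ] E}
    (h : ∀ w, f (word w) = g (word w)) : f = g :=
  LinearMap.ext_on_range (v := word)
    (Submodule.eq_top_iff'.2 mem_span_word) h

/-- The anti-involution `τ`, as a linear endomorphism. -/
def transp : Preproj D →ₗ[ℂ] Preproj D :=
  (MulOpposite.opLinearEquiv ℂ).symm.toLinearMap ∘ₗ (τ D).toLinearMap

theorem unop_τ (p : Preproj D) : (τ D p).unop = transp p := rfl

@[simp] theorem transp_gen (x : Gen I) : transp (gen D x) = gen D x.swap := by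
  have : τ D (gen D x) = MulOpposite.op (gen D x.swap) := by
    change RingQuot.liftAlgHom ℂ _ (RingQuot.mkAlgHom ℂ (Relation D) (FreeAlgebra.ι ℂ x)) = _
    rw [RingQuot.liftAlgHom_mkAlgHom_apply, FreeAlgebra.lift_ι_apply]
  rw [← unop_τ, this, MulOpposite.unop_op]

@[simp] theorem transp_one : transp (1 : Preproj D) = 1 := by
  rw [← unop_τ, map_one, MulOpposite.unop_one]

theorem transp_mul (p q : Preproj D) : transp (p * q) = transp q * transp p := by
  simp only [← unop_τ, map_mul, MulOpposite.unop_mul]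

theorem transp_word (w : List (Gen I)) :
    transp (word (D := D) w) = word (w.map Gen.swap).reverse := by
  induction w with
  | nil => simp
  | cons x w ih => simp [transp_mul, ih, word_append]

@[simp] theorem transp_pow (p : Preproj D) (n : ℕ) : transp (p ^ n) = transp p ^ n := by
  simp only [← unop_τ, map_pow, MulOpposite.unop_pow]

@[simp] theorem transp_transp (p : Preproj D) : transp (transp p) = p := by
  have : (transp ∘ₗ transp : Preproj D →ₗ[ℂ] Preproj D) = LinearMap.id := by
    refine linearMap_ext fun w => ?_
    simp only [LinearMap.comp_apply, LinearMap.id_apply, transp_word]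
    simp only [List.map_reverse, List.reverse_reverse, List.map_map]
    congr 1
    exact (List.map_congr_left fun x _ => x.swap_swap).trans (List.map_id _)
  exact LinearMap.congr_fun this p

theorem deg_swap (x : Gen I) : x.swap.deg D = x.deg D := by
  cases x with
  | α i j => exact D.symm j i
  | _ => rfl

/-! ### A positive grading -/

variable (D) in
/-- A degree for which the defining relations are homogeneous, all arrows have a positive degree,
and the `eᵢ` have degree zero. It is a combination of the degree `deg` and of the number of
arrows `αᵢⱼ`. -/
def posDeg : Gen I → ℕ
  | .e _ => 0
  | .ε i => 2 * D.d i
  | .α i j => 1 + ∑ p, ∑ q, D.d p * D.n p q - D.d i * D.n i j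

theorem d_mul_n_le (i j : I) : D.d i * D.n i j ≤ ∑ p, ∑ q, D.d p * D.n p q :=
  (Finset.single_le_sum (f := fun q => D.d i * D.n i q) (fun _ _ => Nat.zero_le _)
    (Finset.mem_univ j)).trans
    (Finset.single_le_sum (f := fun p => ∑ q, D.d p * D.n p q) (fun _ _ => Nat.zero_le _)
    (Finset.mem_univ i))

theorem posDeg_swap (x : Gen I) : posDeg D x.swap = posDeg D x := by
  cases x with
  | α i j => simp only [Gen.swap, posDeg, D.d_mul_n i j]
  | _ => rfl

open Polynomial in
variable (D) in
/-- The coaction `x ↦ x X ^ deg x` attached to the positive grading. -/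
def coaction : Preproj D →ₐ[ℂ] Polynomial (Preproj D) :=
  RingQuot.liftAlgHom ℂ
    ⟨FreeAlgebra.lift ℂ fun x : Gen I => monomial (posDeg D x) (gen D x), by
      have hl : ∀ x : Gen I, FreeAlgebra.lift ℂ
          (fun x : Gen I => monomial (posDeg D x) (gen D x)) x.free =
          monomial (posDeg D x) (gen D x) := fun x => FreeAlgebra.lift_ι_apply _ _
      generalize FreeAlgebra.lift ℂ (fun x : Gen I => monomial (posDeg D x) (gen D x)) = L at hl
      intro x y h
      cases h with
      | e_mul_self i => rw [map_mul, hl, monomial_mul_monomial, e_mul_self]; rfl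
      | e_mul_of_ne i j h => simp [hl, monomial_mul_monomial, e_mul_of_ne h]
      | sum_e =>
        rw [map_sum, map_one, Finset.sum_congr rfl fun i _ => hl (.e i)]
        simp only [posDeg]
        rw [← map_sum, sum_e, monomial_zero_one]
      | e_mul_ε i => simp [hl, e_mul_ε, posDeg]
      | ε_mul_e i => simp [hl, ε_mul_e, posDeg]
      | e_mul_α i j => simp [hl, e_mul_α, posDeg]
      | α_mul_e i j => simp [hl, α_mul_e, posDeg]
      | no_arrow i j h => simp [hl, no_arrow h]
      | deriv_α i j h =>
        simp only [map_mul, map_pow, hl, monomial_pow, monomial_mul_monomial, deriv_α h]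
        congr 1
        have := D.d_mul_n i j
        simp only [posDeg]
        rw [mul_assoc, mul_assoc, this, add_comm]
      | deriv_ε i =>
        rw [map_zero]
        have key : ∀ j, ∀ k ∈ Finset.range (D.n i j),
            L (D.sign i j • ((Gen.ε i).free ^ k * (Gen.α i j).free * (Gen.α j i).free *
              (Gen.ε i).free ^ (D.n i j - 1 - k))) =
            monomial (2 * (1 + ∑ p, ∑ q, D.d p * D.n p q) - 2 * D.d i)
              (D.sign i j • (gen D (.ε i) ^ k * gen D (.α i j) * gen D (.α j i) *
              gen D (.ε i) ^ (D.n i j - 1 - k))) := by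
          intro j k hk
          simp only [map_smul, map_mul, map_pow, hl, monomial_pow, monomial_mul_monomial,
            smul_monomial]
          congr 1
          have h1 := D.d_mul_n i j
          have h2 := d_mul_n_le (D := D) i j
          have hk := Finset.mem_range.1 hk
          simp only [posDeg, ← h1]
          obtain ⟨m, hm⟩ : ∃ m, D.n i j = k + m + 1 := ⟨D.n i j - 1 - k, by omega⟩
          have h3 : D.n i j - 1 - k = m := by omega
          rw [h3]
          rw [hm] at h2 ⊢
          generalize ∑ p, ∑ q, D.d p * D.n p q = y at *
          obtain ⟨z, rfl⟩ := Nat.exists_eq_add_of_le h2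
          have h4 : 1 + (D.d i * (k + m + 1) + z) - D.d i * (k + m + 1) = 1 + z := by omega
          rw [h4]
          rw [show 2 * (1 + (D.d i * (k + m + 1) + z)) =
            2 * D.d i * k + (1 + z) + (1 + z) + 2 * D.d i * m + 2 * D.d i by ring,
            Nat.add_sub_cancel]
        rw [map_sum]
        simp only [map_sum]
        rw [Finset.sum_congr rfl fun j _ => Finset.sum_congr rfl (key j)]
        simp only [← map_sum, deriv_ε, map_zero]⟩

theorem coaction_word (w : List (Gen I)) : coaction D (word w) =
    Polynomial.monomial (w.map (posDeg D)).sum (word w) := by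
  induction w with
  | nil => simp
  | cons x w ih =>
    have : coaction D (gen D x) = Polynomial.monomial (posDeg D x) (gen D x) := by
      change RingQuot.liftAlgHom ℂ _ (RingQuot.mkAlgHom ℂ (Relation D) (FreeAlgebra.ι ℂ x)) = _
      rw [RingQuot.liftAlgHom_mkAlgHom_apply, FreeAlgebra.lift_ι_apply]
    simp [ih, this, Polynomial.monomial_mul_monomial]

/-- The projection to the component of degree `k` for the positive grading. -/
def proj (k : ℕ) : Preproj D →ₗ[ℂ] Preproj D :=
  (Polynomial.lcoeff (Preproj D) k).restrictScalars ℂ ∘ₗ (coaction D).toLinearMap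

theorem proj_word (k : ℕ) (w : List (Gen I)) :
    proj k (word (D := D) w) = if (w.map (posDeg D)).sum = k then word w else 0 := by
  simp [proj, coaction_word, Polynomial.coeff_monomial]

theorem proj_mul_word (k : ℕ) (w : List (Gen I)) (p : Preproj D) :
    proj k (p * word w) =
      if (w.map (posDeg D)).sum ≤ k then proj (k - (w.map (posDeg D)).sum) p * word w else 0 := by
  induction p using word_induction with
  | h w' =>
    rw [← word_append, proj_word, proj_word, List.map_append, List.sum_append, word_append]
    split_ifs <;> first | omega | simp
  | h0 => simp
  | hadd p q hp hq =>
    rw [add_mul, map_add, hp, hq]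
    split_ifs <;> simp [add_mul]
  | hsmul c p hp =>
    rw [smul_mul_assoc, map_smul, hp]
    split_ifs <;> simp

end Preproj

/-! ### The modules dual to `Π eᵢ / Π εᵢˡ` -/

open Preproj

namespace DualModule

variable {i : I} {l : ℕ}

variable (D i l) in
/-- The class of `eᵢ`, which generates the module `Π eᵢ / Π εᵢˡ`. -/
def vac : CyclicModule D i l :=
  Submodule.Quotient.mk ⟨gen D (.e i), Ideal.subset_span rfl⟩

theorem smul_vac (p : Preproj D) (x : ↥(Ideal.span {gen D (.e i)}))
    (hx : (x : Preproj D) = p * gen D (.e i)) :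
    p • vac D i l = Submodule.Quotient.mk x := by
  rw [vac, ← Submodule.Quotient.mk_smul]
  exact congrArg _ (Subtype.ext hx.symm)

theorem exists_smul_vac (n : CyclicModule D i l) : ∃ p : Preproj D, n = p • vac D i l := by
  obtain ⟨⟨x, hx⟩, rfl⟩ := Submodule.Quotient.mk_surjective _ n
  obtain ⟨p, rfl⟩ := Ideal.mem_span_singleton'.1 hx
  exact ⟨p, (smul_vac p _ rfl).symm⟩

theorem mul_ε_pow_smul_vac (p : Preproj D) :
    (p * gen D (.ε i) ^ l) • vac D i l = 0 := by
  have h : gen D (.ε i) ^ l * gen D (.e i) ∈ Ideal.span {gen D (.e i)} :=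
    Ideal.mem_span_singleton'.2 ⟨_, rfl⟩
  rw [mul_smul, smul_vac (l := l) (gen D (.ε i) ^ l) ⟨_, h⟩ rfl]
  refine (congrArg (p • ·) ?_).trans (smul_zero p)
  refine (Submodule.Quotient.mk_eq_zero _).2 (Submodule.mem_comap.2 ?_)
  exact Ideal.mem_span_singleton'.2 ⟨gen D (.e i), e_mul_ε_pow i l⟩

variable (D i l) in
/-- The linear form on the preprojective algebra which corresponds to a linear form on its
quotient `Π eᵢ / Π εᵢˡ`. -/
def ev : DualModule D i l →ₗ[ℂ] Preproj D →ₗ[ℂ] ℂ where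
  toFun φ := eval D i l φ ∘ₗ (LinearMap.toSpanSingleton (Preproj D) _ (vac D i l)).restrictScalars ℂ
  map_add' _ _ := rfl
  map_smul' _ _ := rfl

theorem ev_apply (φ : DualModule D i l) (p : Preproj D) :
    ev D i l φ p = eval D i l φ (p • vac D i l) := rfl

theorem ev_smul (p : Preproj D) (φ : DualModule D i l) (q : Preproj D) :
    ev D i l (p • φ) q = ev D i l φ (transp p * q) := by
  rw [ev_apply, ev_apply, smul_apply, unop_τ, mul_smul]

theorem ev_one_smul (p : Preproj D) (φ : DualModule D i l) :
    ev D i l (p • φ) 1 = ev D i l φ (transp p) := by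
  rw [ev_smul, mul_one]

theorem ev_injective : Function.Injective (ev D i l) := by
  intro φ ψ h
  refine LinearMap.ext fun n => ?_
  obtain ⟨p, rfl⟩ := exists_smul_vac n
  exact LinearMap.congr_fun h p

theorem ext_ev {φ ψ : DualModule D i l} (h : ∀ p, ev D i l φ p = ev D i l ψ p) : φ = ψ :=
  ev_injective (LinearMap.ext h)

theorem ev_mul_e (φ : DualModule D i l) (p : Preproj D) :
    ev D i l φ (p * gen D (.e i)) = ev D i l φ p := by
  rw [ev_apply, ev_apply, mul_smul, smul_vac (gen D (.e i)) ⟨gen D (.e i), Ideal.subset_span rfl⟩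
    (e_mul_self i).symm]
  rfl

theorem ev_mul_ε_pow (φ : DualModule D i l) (p : Preproj D) :
    ev D i l φ (p * gen D (.ε i) ^ l) = 0 := by
  rw [ev_apply, mul_ε_pow_smul_vac, map_zero]

theorem ev_mul_ε_pow_of_le (φ : DualModule D i l) (p : Preproj D) {k : ℕ} (h : l ≤ k) :
    ev D i l φ (p * gen D (.ε i) ^ k) = 0 := by
  obtain ⟨m, rfl⟩ := Nat.exists_eq_add_of_le' h
  rw [pow_add, ← mul_assoc, ev_mul_ε_pow]

/-- A linear form on `Π` which vanishes on `Π εᵢˡ` and on `Π eⱼ`, for `j ≠ i`, comes from a linear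
form on `Π eᵢ / Π εᵢˡ`. -/
theorem exists_ev_eq (ξ : Preproj D →ₗ[ℂ] ℂ) (h : ∀ p, ξ (p * gen D (.ε i) ^ l) = 0)
    (h' : ∀ p, ξ (p * gen D (.e i)) = ξ p) : ∃ φ : DualModule D i l, ev D i l φ = ξ := by
  let N := (Ideal.span {gen D (.ε i) ^ l}).submoduleOf (Ideal.span {gen D (.e i)})
  let f : ↥(Ideal.span {gen D (.e i)}) →ₗ[ℂ] ℂ :=
    ξ ∘ₗ (Submodule.subtype (Ideal.span {gen D (.e i)})).restrictScalars ℂ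
  let g : (↥(Ideal.span {gen D (.e i)}) ⧸ N.restrictScalars ℂ) →ₗ[ℂ] ℂ :=
    Submodule.liftQ (N.restrictScalars ℂ) f (by
      rintro ⟨x, hx⟩ hxN
      obtain ⟨a, ha⟩ := Ideal.mem_span_singleton'.1 (Submodule.mem_comap.1 hxN)
      change ξ x = 0
      rw [← h a]
      exact congrArg ξ ha.symm)
  let φ : DualModule D i l := show Module.Dual ℂ (CyclicModule D i l) from
    g ∘ₗ (Submodule.Quotient.restrictScalarsEquiv ℂ N).symm.toLinearMap
  refine ⟨φ, LinearMap.ext fun p => ?_⟩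
  have hp : p * gen D (.e i) ∈ Ideal.span {gen D (.e i)} := Ideal.mem_span_singleton'.2 ⟨p, rfl⟩
  rw [ev_apply, smul_vac p ⟨_, hp⟩ rfl, ← h' p]
  rfl

/-- A subspace of the dual module which is stable under the generators, and consists of
linear forms which vanish at the generator of `Π eᵢ / Π εᵢˡ`, is zero. -/
theorem eq_zero_of_ev_one_eq_zero {N : Submodule ℂ (DualModule D i l)}
    (h : ∀ x, ∀ φ ∈ N, gen D x • φ ∈ N) (h1 : ∀ φ ∈ N, ev D i l φ 1 = 0) {φ : DualModule D i l}
    (hφ : φ ∈ N) : φ = 0 := by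
  refine ext_ev fun p => ?_
  rw [← transp_transp p, ← ev_one_smul, h1 _ (smul_mem_of_gen h _ φ hφ), map_zero,
    LinearMap.zero_apply]

theorem mem_component_iff {Λ : Type} [AddCommGroupWithOne Λ] {s : ℤ} {j : I} {k : Λ}
    {φ : DualModule D i l} : φ ∈ component D i l s j k ↔ gen D (.e j) • φ = φ ∧
      ∀ w : List (Gen I), (((w.map (Gen.deg D)).sum : ℤ) : Λ) ≠ s - k →
        ev D i l φ (word w) = 0 := by
  refine and_congr_right fun _ => ⟨fun h w hw => ?_, fun h m hm n hn => ?_⟩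
  · rw [← ev_mul_e, ev_apply]
    have hp : word w * gen D (.e i) ∈ Ideal.span {gen D (.e i)} :=
      Ideal.mem_span_singleton'.2 ⟨_, rfl⟩
    have hp' : word w * gen D (.e i) * gen D (.e i) = word w * gen D (.e i) := by
      rw [mul_assoc, e_mul_self]
    refine h _ hw _ ⟨⟨_, hp⟩, Submodule.subset_span ⟨w ++ [.e i], ?_, ?_⟩, smul_vac _ _ hp'.symm⟩
    · simp [Gen.deg]
    · simp [word]
  · obtain ⟨⟨x, hx⟩, hxm, rfl⟩ := hn
    have h1 : x * gen D (.e i) = x := by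
      obtain ⟨a, rfl⟩ := Ideal.mem_span_singleton'.1 hx
      rw [mul_assoc, e_mul_self]
    rw [← smul_vac x ⟨x, hx⟩ h1.symm, ← ev_apply]
    replace hxm : x ∈ Preproj.homogeneous D m := hxm
    clear hx h1
    change x ∈ Submodule.span ℂ _ at hxm
    induction hxm using Submodule.span_induction with
    | mem x hx =>
      obtain ⟨w, hw, rfl⟩ := hx
      exact h w (hw ▸ hm)
    | zero => simp
    | add x y _ _ hx hy => rw [map_add, hx, hy, add_zero]
    | smul c x _ hx => rw [map_smul, hx, smul_zero]

/-- The composition of a linear form with the projection to a component of the positive grading. -/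
theorem exists_ev_comp_proj (φ : DualModule D i l) (k : ℕ) :
    ∃ ψ : DualModule D i l, ev D i l ψ = ev D i l φ ∘ₗ proj k := by
  refine exists_ev_eq _ (fun p => ?_) fun p => ?_
  · rw [LinearMap.comp_apply, ← word_replicate, proj_mul_word]
    split_ifs
    · rw [word_replicate, ev_mul_ε_pow]
    · rw [map_zero]
  · have := proj_mul_word k [.e i] p
    simp only [List.map_cons, List.map_nil, posDeg, List.sum_cons, List.sum_nil, add_zero,
      Nat.zero_le, if_true, Nat.sub_zero, word_cons, word_nil, mul_one] at this
    rw [LinearMap.comp_apply, this, ev_mul_e, LinearMap.comp_apply]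

end DualModule

end

section

variable {I : Type*} [Fintype I] [DecidableEq I] {D : CartanDatum I}

open Preproj Module

/-! ### A bound for the dimensions of framed modules -/

section Bound

variable {E : Type*} [AddCommGroup E] [Module ℂ E] [Module (Preproj D) E]

theorem pow_ε_smul_mem {L : I → Submodule ℂ E} (hε : ∀ i, ∀ u ∈ L i, gen D (.ε i) • u ∈ L i)
    (i : I) (k : ℕ) : ∀ u ∈ L i, gen D (.ε i) ^ k • u ∈ L i := by
  induction k with
  | zero => simp
  | succ k ih =>
    intro u hu
    rw [pow_succ, mul_smul]
    exact ih _ (hε i u hu)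

variable [IsScalarTower ℂ (Preproj D) E]

variable (D) in
/-- The sum of the images of the maps `εᵢᵏ αᵢⱼ : Lⱼ → E`, for `k < -cᵢⱼ`. -/
def sumIn (L : I → Submodule ℂ E) (i : I) :
    (∀ p : Σ j, Fin (D.n i j), L p.1) →ₗ[ℂ] E :=
  ∑ p : Σ j, Fin (D.n i j), Algebra.lsmul ℂ ℂ E (gen D (.ε i) ^ (p.2 : ℕ) * gen D (.α i p.1)) ∘ₗ
    (L p.1).subtype ∘ₗ LinearMap.proj p

theorem sumIn_apply (L : I → Submodule ℂ E) (i : I) (u : ∀ p : Σ j, Fin (D.n i j), L p.1) :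
    sumIn D L i u = ∑ p : Σ j, Fin (D.n i j),
      (gen D (.ε i) ^ (p.2 : ℕ) * gen D (.α i p.1)) • (u p : E) := by
  simp only [sumIn, LinearMap.sum_apply]
  rfl

theorem mem_range_sumIn {L : I → Submodule ℂ E} {i j : I} {k : ℕ} (hk : k < D.n i j) {u : E}
    (hu : u ∈ L j) : (gen D (.ε i) ^ k * gen D (.α i j)) • u ∈ LinearMap.range (sumIn D L i) := by
  classical
  refine ⟨Pi.single ⟨j, ⟨k, hk⟩⟩ ⟨u, hu⟩, ?_⟩
  rw [sumIn_apply, Finset.sum_eq_single ⟨j, ⟨k, hk⟩⟩]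
  · simp
  · intro p _ hp
    rw [Pi.single_eq_of_ne hp]
    simp
  · simp

/-- The cyclic derivative of the potential along `εᵢ` says that the composition of
`Lᵢ → ⨁ⱼ Lⱼ ^ (-cᵢⱼ) → Lᵢ` is zero. -/
theorem finrank_range_sumIn_add_le {L : I → Submodule ℂ E}
    [∀ i, FiniteDimensional ℂ (L i)] {w : I → ℕ} (a : ∀ i, E →ₗ[ℂ] (Fin (w i) → ℂ))
    (hε : ∀ i, ∀ u ∈ L i, gen D (.ε i) • u ∈ L i)
    (hα : ∀ i j, ∀ u ∈ L j, gen D (.α i j) • u ∈ L i)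
    (ha : ∀ i, ∀ u ∈ L i, (∀ j, ∀ k < D.n i j, (gen D (.α j i) * gen D (.ε i) ^ k) • u = 0) →
      a i u = 0 → u = 0) (i : I) :
    finrank ℂ (LinearMap.range (sumIn D L i)) + finrank ℂ (L i) ≤
      ∑ j, D.n i j * finrank ℂ (L j) + w i := by
  let out : L i →ₗ[ℂ] (∀ p : Σ j, Fin (D.n i j), L p.1) × (Fin (w i) → ℂ) :=
    LinearMap.prod (LinearMap.pi fun p => LinearMap.codRestrict (L p.1)
      (D.sign i p.1 • Algebra.lsmul ℂ ℂ E (gen D (.α p.1 i) *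
        gen D (.ε i) ^ (D.n i p.1 - 1 - p.2)) ∘ₗ (L i).subtype) fun u =>
          Submodule.smul_mem _ _ (by
            simp only [LinearMap.comp_apply, Algebra.lsmul_coe, mul_smul]
            exact hα _ _ _ (pow_ε_smul_mem hε i _ _ u.2)))
      (a i ∘ₗ (L i).subtype)
  have out_apply : ∀ u p, ((out u).1 p : E) = D.sign i p.1 • (gen D (.α p.1 i) *
        gen D (.ε i) ^ (D.n i p.1 - 1 - p.2)) • (u : E) := fun u p => rfl
  have hinj : Function.Injective out := by
    refine (injective_iff_map_eq_zero out).2 fun u hu => Subtype.ext (ha i u u.2 ?_ ?_)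
    · intro j k hk
      have hc : D.c i j < 0 := by
        by_contra h
        rw [D.n_eq_zero h] at hk
        exact absurd hk (Nat.not_lt_zero _)
      have h1 := out_apply u ⟨j, ⟨D.n i j - 1 - k, by omega⟩⟩
      rw [hu] at h1
      have h2 : D.n i j - 1 - (D.n i j - 1 - k) = k := by omega
      simp only [h2] at h1
      exact (smul_eq_zero.1 h1.symm).resolve_left (D.sign_ne_zero hc)
    · exact congrArg Prod.snd hu
  let f := sumIn D L i ∘ₗ LinearMap.fst ℂ (∀ p : Σ j, Fin (D.n i j), L p.1) (Fin (w i) → ℂ)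
  have hf : LinearMap.range f = LinearMap.range (sumIn D L i) :=
    LinearMap.range_comp_of_range_eq_top _ (LinearMap.range_eq_top.2 Prod.fst_surjective)
  have hcomp : LinearMap.range out ≤ LinearMap.ker f := by
    rintro _ ⟨u, rfl⟩
    rw [LinearMap.mem_ker]
    change sumIn D L i (out u).1 = 0
    simp only [sumIn_apply, out_apply]
    have := congrArg (· • (u : E)) (deriv_ε (D := D) i)
    simp only [zero_smul, Finset.sum_smul] at this
    rw [← this, Fintype.sum_sigma]
    refine Finset.sum_congr rfl fun j _ => ?_
    rw [Finset.sum_range]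
    refine Finset.sum_congr rfl fun k _ => ?_
    rw [smul_comm _ (D.sign i j), smul_assoc, ← mul_smul]
    simp only [mul_assoc]
  have h1 := LinearMap.finrank_range_add_finrank_ker f
  have h2 := Submodule.finrank_mono hcomp
  rw [LinearMap.finrank_range_of_inj hinj] at h2
  rw [hf, Module.finrank_prod, Module.finrank_pi_fintype, Module.finrank_fin_fun,
    Fintype.sum_sigma] at h1
  have h3 : ∀ j, ∑ k : Fin (D.n i j), finrank ℂ (L (⟨j, k⟩ : Σ j, Fin (D.n i j)).1) =
      D.n i j * finrank ℂ (L j) := fun j => by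
    change ∑ _k : Fin (D.n i j), finrank ℂ (L j) = _
    rw [Finset.sum_const, Finset.card_univ, Fintype.card_fin, smul_eq_mul]
  rw [Finset.sum_congr rfl fun j _ => h3 j] at h1
  omega

variable (D) in
/-- The symmetric bilinear form `∑ᵢⱼ dᵢ cᵢⱼ vᵢ v'ⱼ`. -/
def form (v v' : I → ℤ) : ℤ := ∑ i, D.d i * v i * ∑ j, D.c i j * v' j

theorem form_add_single (v : I → ℤ) (i : I) (s : ℤ) :
    form D (v + Pi.single i s) (v + Pi.single i s) =
      form D v v + 2 * (D.d i * s * ∑ j, D.c i j * v j) + 2 * D.d i * s ^ 2 := by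
  have h1 : ∀ v v' v'' : I → ℤ, form D (v + v') v'' = form D v v'' + form D v' v'' := by
    intro v v' v''
    simp only [form, ← Finset.sum_add_distrib, Pi.add_apply]
    exact Finset.sum_congr rfl fun _ _ => by ring
  have h2 : ∀ v v' : I → ℤ, form D v v' = form D v' v := by
    intro v v'
    simp only [form, Finset.mul_sum]
    rw [Finset.sum_comm]
    refine Finset.sum_congr rfl fun i _ => Finset.sum_congr rfl fun j _ => ?_
    linear_combination v j * v' i * D.symm j i
  have h3 : ∀ v : I → ℤ, form D (Pi.single i s) v = D.d i * s * ∑ j, D.c i j * v j := by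
    intro v
    rw [form, Finset.sum_eq_single i]
    · simp
    · intro j _ hj
      simp [hj]
    · simp
  rw [h1, h2 v (v + _), h2 (Pi.single i s) (v + _), h1, h1, h2 v (Pi.single i s), h3, h3]
  have h4 : ∑ j, D.c i j * (Pi.single i s : I → ℤ) j = 2 * s := by
    rw [Finset.sum_eq_single i]
    · simp [D.diag]
    · intro j _ hj
      simp [hj]
    · simp
  rw [h4]
  ring

/-- The dimension vector `v` of a finite dimensional module `L` with an injective framing of
dimension `w` satisfies `(v, v) ≤ 2 (w, v)`. Indeed, as long as `w - C v` is not dominant, one can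
replace `L` by a submodule without decreasing `(v, v) - 2 (w, v)`: if the component at `i` of
`w - C v` is negative, then `Lᵢ` is replaced by the sum of the images of the maps into it. -/
theorem form_finrank_le {w : I → ℕ} (a : ∀ i, E →ₗ[ℂ] (Fin (w i) → ℂ)) (N : ℕ) :
    ∀ L : I → Submodule ℂ E, (∀ i, FiniteDimensional ℂ (L i)) →
    (∀ i, ∀ u ∈ L i, gen D (.ε i) • u ∈ L i) →
    (∀ i j, ∀ u ∈ L j, gen D (.α i j) • u ∈ L i) →
    (∀ i, ∀ u ∈ L i, (∀ j, ∀ k < D.n i j, (gen D (.α j i) * gen D (.ε i) ^ k) • u = 0) →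
      a i u = 0 → u = 0) →
    ∑ i, finrank ℂ (L i) = N →
    form D (fun i => finrank ℂ (L i)) (fun i => finrank ℂ (L i)) ≤
      2 * ∑ i, D.d i * w i * (finrank ℂ (L i) : ℤ) := by
  induction N using Nat.strong_induction_on with
  | _ N ih =>
  intro L hfin hε hα ha hN
  by_cases hdom : ∀ i, ∑ j, D.c i j * (finrank ℂ (L j) : ℤ) ≤ w i
  · have h1 : form D (fun i => finrank ℂ (L i)) (fun i => finrank ℂ (L i)) ≤
        ∑ i, D.d i * w i * (finrank ℂ (L i) : ℤ) := by
      refine Finset.sum_le_sum fun i _ => ?_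
      have := mul_le_mul_of_nonneg_left (hdom i)
        (by positivity : (0 : ℤ) ≤ D.d i * finrank ℂ (L i))
      linarith
    have h2 : 0 ≤ ∑ i, D.d i * w i * (finrank ℂ (L i) : ℤ) :=
      Finset.sum_nonneg fun i _ => by positivity
    linarith
  push Not at hdom
  obtain ⟨i, hi⟩ := hdom
  have hdim := finrank_range_sumIn_add_le a hε hα ha i
  set R := LinearMap.range (sumIn D L i) with hR
  have hRL : R ≤ L i := by
    rintro _ ⟨u, rfl⟩
    rw [sumIn_apply]
    refine Submodule.sum_mem _ fun p _ => ?_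
    rw [mul_smul]
    exact pow_ε_smul_mem hε _ _ _ (hα _ _ _ (u p).2)
  let L' : I → Submodule ℂ E := Function.update L i R
  have hL'i : L' i = R := Function.update_self ..
  have hL'j : ∀ j, j ≠ i → L' j = L j := fun j hj => Function.update_of_ne hj ..
  have hle : ∀ j, L' j ≤ L j := by
    intro j
    by_cases hj : j = i
    · subst hj; rwa [hL'i]
    · rw [hL'j j hj]
  have hfin' : ∀ j, FiniteDimensional ℂ (L' j) := fun j =>
    Submodule.finiteDimensional_of_le (hle j)
  have hsum : ∑ j, D.c i j * (finrank ℂ (L j) : ℤ) =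
      2 * finrank ℂ (L i) - ∑ j, D.n i j * (finrank ℂ (L j) : ℤ) := by
    rw [← Finset.add_sum_erase _ _ (Finset.mem_univ i),
      ← Finset.add_sum_erase Finset.univ (fun j => (D.n i j : ℤ) * _) (Finset.mem_univ i),
      D.diag, D.n_self, Finset.sum_congr rfl fun j hj => by
        rw [D.c_eq_neg_n (Finset.ne_of_mem_erase hj).symm]]
    simp only [neg_mul, Finset.sum_neg_distrib]
    push_cast
    ring
  zify at hdim
  -- `s` is the codimension of the image; it is at least the `i`-th component of `C v - w`, which
  -- is positive
  obtain ⟨s, hs⟩ : ∃ s : ℤ, (finrank ℂ (L i) : ℤ) = finrank ℂ R + s := ⟨_, (add_sub_cancel _ _).symm⟩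
  have hs0 : 0 < s := by linarith
  have hv : (fun j => (finrank ℂ (L j) : ℤ)) = (fun j => (finrank ℂ (L' j) : ℤ)) +
      Pi.single i s := by
    funext j
    by_cases hj : j = i
    · subst hj
      rw [Pi.add_apply, hL'i, Pi.single_eq_same, hs]
    · rw [Pi.add_apply, hL'j j hj, Pi.single_eq_of_ne hj, add_zero]
  have hlt : ∑ j, finrank ℂ (L' j) < N := by
    rw [← hN]
    refine Finset.sum_lt_sum (fun j _ => Submodule.finrank_mono (hle j)) ⟨i, Finset.mem_univ i, ?_⟩
    rw [hL'i]
    zify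
    linarith
  have hεR : ∀ u ∈ R, gen D (.ε i) • u ∈ R := by
    rintro _ ⟨u, rfl⟩
    rw [sumIn_apply, Finset.smul_sum]
    refine Submodule.sum_mem _ fun p _ => ?_
    rw [← mul_smul, ← mul_assoc, ← pow_succ']
    have hc : D.c i p.1 < 0 := by
      by_contra h
      exact absurd (p.2.2.trans_eq (D.n_eq_zero h)) (Nat.not_lt_zero _)
    rcases (Nat.succ_le_iff.2 p.2.2).lt_or_eq with h | h
    · exact mem_range_sumIn h (u p).2
    · rw [show (p.2 : ℕ) + 1 = D.n i p.1 from h, deriv_α hc, mul_smul]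
      have := mem_range_sumIn (L := L) (D.n_pos hc) (pow_ε_smul_mem hε _ (D.n p.1 i) _ (u p).2)
      rwa [pow_zero, one_mul] at this
  have key := ih _ hlt L' hfin' ?_ ?_ (fun j u hu => ha j u (hle j hu)) rfl
  · rw [hv, form_add_single]
    have h1 : ∑ j, D.c i j * (finrank ℂ (L j) : ℤ) =
        ∑ j, D.c i j * (finrank ℂ (L' j) : ℤ) + 2 * s := by
      have h4 : ∑ j, D.c i j * (Pi.single i s : I → ℤ) j = 2 * s := by
        rw [Finset.sum_eq_single i]
        · simp [D.diag]
        · intro j _ hj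
          simp [hj]
        · simp
      rw [← h4, ← Finset.sum_add_distrib]
      refine Finset.sum_congr rfl fun j _ => ?_
      rw [congrFun hv j, Pi.add_apply]
      ring
    have h2 : ∑ j, D.d j * w j * (finrank ℂ (L j) : ℤ) =
        ∑ j, D.d j * w j * (finrank ℂ (L' j) : ℤ) + D.d i * w i * s := by
      have h4 : ∑ j, D.d j * w j * (Pi.single i s : I → ℤ) j = D.d i * w i * s := by
        rw [Finset.sum_eq_single i]
        · simp
        · intro j _ hj
          simp [hj]
        · simp
      rw [← h4, ← Finset.sum_add_distrib]
      refine Finset.sum_congr rfl fun j _ => ?_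
      rw [congrFun hv j, Pi.add_apply]
      ring
    rw [h2]
    have h3 : ∑ j, D.c i j * (finrank ℂ (L' j) : ℤ) + s ≤ w i := by linarith
    have h4 := mul_le_mul_of_nonneg_left h3 (by positivity : (0 : ℤ) ≤ D.d i * s)
    nlinarith
  · intro j u hu
    by_cases hj : j = i
    · subst hj
      rw [hL'i] at hu ⊢
      exact hεR u hu
    · rw [hL'j j hj] at hu ⊢
      exact hε j u hu
  · intro j k u hu
    by_cases hj : j = i
    · subst hj
      rw [hL'i]
      by_cases hc : D.c j k < 0
      · have := mem_range_sumIn (L := L) (D.n_pos hc) (hle k hu)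
        rwa [pow_zero, one_mul] at this
      · rw [no_arrow hc, zero_smul]
        exact zero_mem _
    · rw [hL'j j hj]
      exact hα j k u (hle k hu)

variable (D) in
/-- Since the Cartan matrix is of finite type, there are only finitely many dimension vectors `v`
with `(v, v) ≤ 2 (w, v)`. -/
theorem exists_bound (w : I → ℕ) : ∃ B : ℕ, ∀ v : I → ℕ,
    form D (fun i => v i) (fun i => v i) ≤ 2 * ∑ i, D.d i * w i * (v i : ℤ) → ∀ i, v i ≤ B := by
  classical
  let q : (I → ℝ) → ℝ := fun x => ∑ i, D.d i * x i * ∑ j, D.c i j * x j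
  have hq : ∀ x, x ≠ 0 → 0 < q x := by
    intro x hx
    have := (Matrix.posDef_iff_dotProduct_mulVec.1 D.posDef).2 hx
    refine this.trans_eq ?_
    simp only [q, dotProduct, Matrix.mulVec, Matrix.of_apply, Finset.mul_sum, Pi.star_apply,
      star_trivial]
    exact Finset.sum_congr rfl fun i _ => Finset.sum_congr rfl fun j _ => by ring
  have hqc : Continuous q := by
    fun_prop
  obtain ⟨c, hc, hcq⟩ : ∃ c : ℝ, 0 < c ∧ ∀ x, ‖x‖ = 1 → c ≤ q x := by
    rcases (Metric.sphere (0 : I → ℝ) 1).eq_empty_or_nonempty with h | h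
    · exact ⟨1, one_pos, fun x hx => absurd (by simpa using hx : x ∈ Metric.sphere (0 : I → ℝ) 1)
        (h ▸ Set.notMem_empty x)⟩
    · obtain ⟨x, hx, hmin⟩ := (isCompact_sphere (0 : I → ℝ) 1).exists_isMinOn h hqc.continuousOn
      refine ⟨q x, hq x ?_, fun y hy => hmin (by simpa using hy)⟩
      rintro rfl
      rw [mem_sphere_zero_iff_norm, norm_zero] at hx
      exact zero_ne_one hx
  let C : ℝ := 2 * ∑ i, (D.d i * w i : ℝ)
  obtain ⟨B, hB⟩ := exists_nat_ge (C / c)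
  refine ⟨B, fun v hv i => ?_⟩
  let x : I → ℝ := fun i => v i
  have h1 : q x ≤ C * ‖x‖ := by
    have h2 : q x ≤ 2 * ∑ i, D.d i * w i * x i := by
      have : ((form D (fun i => v i) (fun i => v i) : ℤ) : ℝ) ≤
        ((2 * ∑ i, D.d i * w i * (v i : ℤ) : ℤ) : ℝ) := by exact_mod_cast hv
      simpa [form, q, x] using this
    refine h2.trans ?_
    simp only [C]
    rw [mul_assoc, Finset.sum_mul]
    gcongr with i
    exact (le_abs_self _).trans (norm_le_pi_norm x i)
  have h3 : ‖x‖ ≤ C / c := by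
    by_cases hx : x = 0
    · rw [hx, norm_zero]
      positivity
    · have hx' : 0 < ‖x‖ := norm_pos_iff.2 hx
      have h4 := hcq (‖x‖⁻¹ • x) (by rw [norm_smul, norm_inv, norm_norm, inv_mul_cancel₀ hx'.ne'])
      have h5 : q (‖x‖⁻¹ • x) = ‖x‖⁻¹ ^ 2 * q x := by
        simp only [q, Pi.smul_apply, smul_eq_mul, Finset.mul_sum]
        exact Finset.sum_congr rfl fun i _ => Finset.sum_congr rfl fun j _ => by ring
      rw [h5] at h4
      rw [le_div_iff₀ hc]
      have h6 : c * ‖x‖ ^ 2 ≤ q x := by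
        have := mul_le_mul_of_nonneg_right h4 (sq_nonneg ‖x‖)
        calc c * ‖x‖ ^ 2 ≤ _ := this
          _ = q x := by field_simp
      nlinarith
  have h7 : (v i : ℝ) ≤ B := by
    calc (v i : ℝ) = x i := rfl
      _ ≤ ‖x‖ := (le_abs_self _).trans (norm_le_pi_norm x i)
      _ ≤ B := h3.trans hB
  exact_mod_cast h7

end Bound

end

section

variable {I : Type*} [Fintype I] [DecidableEq I] {D : CartanDatum I}

open Preproj Module

/-! ### The modules `K` are finite dimensional and nilpotent -/

/-- The arrows `εᵢ` and `αᵢⱼ` of the triple quiver. -/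
def arrow {I : Type*} : I ⊕ I × I → Gen I
  | .inl i => .ε i
  | .inr p => .α p.1 p.2

theorem gen_arrow_mul_e (y : I ⊕ I × I) (j : I) :
    gen D (arrow y) * gen D (.e j) = gen D (arrow y) ∨ gen D (arrow y) * gen D (.e j) = 0 := by
  rcases y with i | ⟨i, k⟩
  · by_cases h : i = j
    · subst h; exact .inl (ε_mul_e i)
    · exact .inr (ε_mul_e_of_ne h)
  · by_cases h : k = j
    · subst h; exact .inl (α_mul_e i k)
    · exact .inr (α_mul_e_of_ne h)

theorem one_le_posDeg_arrow (y : I ⊕ I × I) : 1 ≤ posDeg D (arrow y) := by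
  rcases y with i | ⟨i, k⟩
  · have := D.d_pos i
    simp only [arrow, posDeg]
    omega
  · have := d_mul_n_le (D := D) i k
    simp only [arrow, posDeg]
    omega

namespace DualModule

variable {i : I} {l : ℕ}

variable (D i l) in
/-- The socle filtration by the elements killed by all paths of length `n`. -/
def filt : ℕ → Submodule ℂ (DualModule D i l)
  | 0 => ⊥
  | n + 1 => ⨅ y : I ⊕ I × I, (filt n).comap (Algebra.lsmul ℂ ℂ _ (gen D (arrow y)))

theorem mem_filt_succ {n : ℕ} {φ : DualModule D i l} :
    φ ∈ filt D i l (n + 1) ↔ ∀ y, gen D (arrow y) • φ ∈ filt D i l n := by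
  simp [filt, Submodule.mem_iInf]

theorem filt_le_succ (n : ℕ) : filt D i l n ≤ filt D i l (n + 1) := by
  induction n with
  | zero => exact bot_le
  | succ n ih =>
    intro φ hφ
    rw [mem_filt_succ] at hφ ⊢
    exact fun y => ih (hφ y)

theorem filt_mono : Monotone (filt D i l) := monotone_nat_of_le_succ filt_le_succ

theorem gen_smul_mem_filt (n : ℕ) (x : Gen I) {φ : DualModule D i l} (hφ : φ ∈ filt D i l n) :
    gen D x • φ ∈ filt D i l n := by
  cases n with
  | zero =>
    rw [(Submodule.mem_bot ℂ).1 hφ, smul_zero]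
    exact zero_mem _
  | succ n =>
    cases x with
    | e j =>
      rw [mem_filt_succ] at hφ ⊢
      intro y
      rw [← mul_smul]
      rcases gen_arrow_mul_e (D := D) y j with h | h
      · rw [h]; exact hφ y
      · rw [h, zero_smul]; exact zero_mem _
    | ε j => exact filt_le_succ n (mem_filt_succ.1 hφ (.inl j))
    | α j k => exact filt_le_succ n (mem_filt_succ.1 hφ (.inr (j, k)))

theorem word_smul_mem_filt (w : List (I ⊕ I × I)) : ∀ (m : ℕ) {φ : DualModule D i l},
    φ ∈ filt D i l (m + w.length) → word (D := D) (w.map arrow) • φ ∈ filt D i l m := by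
  induction w with
  | nil => simp
  | cons y w ih =>
    intro m φ hφ
    rw [List.map_cons, word_cons, mul_smul]
    refine mem_filt_succ.1 (ih (m + 1) ?_) y
    rwa [List.length_cons, ← add_assoc, add_right_comm] at hφ

/-- The socle of the dual module is one-dimensional at most: it is detected by the value at the
generator. -/
theorem eq_zero_of_arrow_smul {φ : DualModule D i l} (h : ∀ y, gen D (arrow y) • φ = 0)
    (h1 : ev D i l φ 1 = 0) : φ = 0 := by
  let N : Submodule ℂ (DualModule D i l) :=
    (⨅ y : I ⊕ I × I, LinearMap.ker (Algebra.lsmul ℂ ℂ _ (gen D (arrow y)))) ⊓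
      LinearMap.ker ((LinearMap.applyₗ (1 : Preproj D)) ∘ₗ ev D i l)
  have hN : ∀ φ, φ ∈ N ↔ (∀ y, gen D (arrow y) • φ = 0) ∧ ev D i l φ 1 = 0 := by
    intro φ
    simp [N, Submodule.mem_iInf]
  refine eq_zero_of_ev_one_eq_zero (N := N) (fun x φ hφ => ?_) (fun φ hφ => ((hN φ).1 hφ).2)
    ((hN φ).2 ⟨h, h1⟩)
  rw [hN] at hφ
  cases x with
  | e j =>
    refine (hN _).2 ⟨fun y => ?_, ?_⟩
    · rw [← mul_smul]
      rcases gen_arrow_mul_e (D := D) y j with h | h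
      · rw [h]; exact hφ.1 y
      · rw [h, zero_smul]
    · rw [ev_one_smul, transp_gen, Gen.swap, ← ev_mul_e]
      by_cases hj : j = i
      · subst hj
        rw [e_mul_self, ← one_mul (gen D _), ev_mul_e, hφ.2]
      · rw [e_mul_of_ne hj, map_zero]
  | ε j => 
    have := hφ.1 (.inl j)
    rw [arrow] at this
    rw [this]
    exact zero_mem _
  | α j k =>
    have := hφ.1 (.inr (j, k))
    rw [arrow] at this
    rw [this]
    exact zero_mem _

theorem finiteDimensional_filt (n : ℕ) : FiniteDimensional ℂ (filt D i l n) := by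
  induction n with
  | zero => exact inferInstanceAs (FiniteDimensional ℂ (⊥ : Submodule ℂ (DualModule D i l)))
  | succ n ih =>
    let f : filt D i l (n + 1) →ₗ[ℂ] (I ⊕ I × I → filt D i l n) × ℂ :=
      LinearMap.prod (LinearMap.pi fun y => LinearMap.codRestrict _
        (Algebra.lsmul ℂ ℂ _ (gen D (arrow y)) ∘ₗ Submodule.subtype _)
          fun φ => mem_filt_succ.1 φ.2 y)
        ((LinearMap.applyₗ (1 : Preproj D)) ∘ₗ ev D i l ∘ₗ Submodule.subtype _)
    refine FiniteDimensional.of_injective f ((injective_iff_map_eq_zero f).2 fun φ hφ => ?_)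
    refine Subtype.ext (eq_zero_of_arrow_smul (fun y => ?_) (congrArg Prod.snd hφ))
    exact congrArg Subtype.val (congrFun (congrArg Prod.fst hφ) y)

variable (D i l) in
/-- The component at the vertex `j` of a step of the socle filtration. -/
def piece (n : ℕ) (j : I) : Submodule ℂ (DualModule D i l) :=
  filt D i l n ⊓ LinearMap.ker (Algebra.lsmul ℂ ℂ (DualModule D i l) (gen D (.e j)) - 1)

theorem mem_piece {n : ℕ} {j : I} {φ : DualModule D i l} :
    φ ∈ piece D i l n j ↔ φ ∈ filt D i l n ∧ gen D (.e j) • φ = φ := by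
  simp [piece, sub_eq_zero]

/-- If all arrows `αₖⱼ` vanish on the `ℂ[εⱼ]`-module generated by `φ`, then `φ` is determined by
its values on the powers of `εⱼ`. -/
theorem eq_zero_of_α_smul (hl : 1 ≤ l) {j : I} {φ : DualModule D i l} (hj : gen D (.e j) • φ = φ)
    (h : ∀ p, ∀ k < D.n j p, (gen D (.α p j) * gen D (.ε j) ^ k) • φ = 0)
    (h1 : ∀ k < l, ev D i l φ (gen D (.ε j) ^ k) = 0) : φ = 0 := by
  have hα : ∀ p k, (gen D (.α p j) * gen D (.ε j) ^ k) • φ = 0 := by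
    intro p k
    by_cases hc : D.c p j < 0
    · induction k using Nat.strong_induction_on with
      | _ k ih =>
      by_cases hk : k < D.n j p
      · exact h p k hk
      · obtain ⟨m, rfl⟩ := Nat.exists_eq_add_of_le (not_lt.1 hk)
        rw [pow_add, ← mul_assoc, ← deriv_α hc, mul_assoc, mul_smul, ih m, smul_zero]
        have := D.n_pos ((neg_swap D p j).1 hc)
        omega
    · rw [no_arrow hc, zero_mul, zero_smul]
  have he : ∀ k : ℕ, gen D (.e j) • gen D (.ε j) ^ k • φ = gen D (.ε j) ^ k • φ := by
    intro k
    rw [← mul_smul, e_mul_ε_pow, mul_smul, hj]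
  refine eq_zero_of_ev_one_eq_zero
    (N := Submodule.span ℂ (Set.range fun k : ℕ => gen D (.ε j) ^ k • φ)) (fun x u hu => ?_)
    (fun u hu => ?_) (Submodule.subset_span ⟨0, by simp⟩)
  · induction hu using Submodule.span_induction with
    | zero => simp
    | add u v _ _ h h' => rw [smul_add]; exact add_mem h h'
    | smul c u _ h => rw [smul_comm]; exact Submodule.smul_mem _ c h
    | mem u hu =>
      obtain ⟨k, rfl⟩ := hu
      cases x with
      | e p =>
        by_cases hp : p = j
        · subst hp
          simp only [he]
          exact Submodule.subset_span ⟨k, rfl⟩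
        · simp only
          rw [← he, ← mul_smul, e_mul_of_ne hp, zero_smul]
          exact zero_mem _
      | ε p =>
        by_cases hp : p = j
        · subst hp
          simp only
          rw [← mul_smul, ← pow_succ']
          exact Submodule.subset_span ⟨k + 1, rfl⟩
        · simp only
          rw [← he, ← mul_smul, ε_mul_e_of_ne hp, zero_smul]
          exact zero_mem _
      | α p q =>
        by_cases hq : q = j
        · subst hq
          simp only
          rw [← mul_smul, hα]
          exact zero_mem _
        · simp only
          rw [← he, ← mul_smul, α_mul_e_of_ne hq, zero_smul]
          exact zero_mem _
  · induction hu using Submodule.span_induction with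
    | zero => simp
    | add u v _ _ h h' => rw [map_add, LinearMap.add_apply, h, h', add_zero]
    | smul c u _ h => rw [map_smul, LinearMap.smul_apply, h, smul_zero]
    | mem u hu =>
      obtain ⟨k, rfl⟩ := hu
      simp only
      rw [ev_one_smul, transp_pow, transp_gen, Gen.swap]
      rcases lt_or_ge k l with hk | hk
      · exact h1 k hk
      · by_cases hji : j = i
        · subst hji
          rw [← one_mul (_ ^ k), ev_mul_ε_pow_of_le φ 1 hk]
        · obtain ⟨m, rfl⟩ := Nat.exists_eq_add_of_le' (hl.trans hk)
          rw [← ev_mul_e, pow_succ, mul_assoc, ε_mul_e_of_ne hji, mul_zero, map_zero]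

/-- The steps of the socle filtration are framed by the values of the linear forms at the powers of
`εⱼ` below the `l`-th one, so the bound for the dimensions applies, uniformly in the step. -/
theorem exists_finrank_piece_le (hl : 1 ≤ l) :
    ∃ B : ℕ, ∀ n j, finrank ℂ (piece D i l n j) ≤ B := by
  obtain ⟨B, hB⟩ := exists_bound D fun _ => l
  refine ⟨B, fun n => hB (fun j => finrank ℂ (piece D i l n j)) ?_⟩
  let a : ∀ _ : I, DualModule D i l →ₗ[ℂ] (Fin l → ℂ) := fun j => LinearMap.pi fun k =>
    (LinearMap.applyₗ (gen D (.ε j) ^ (k : ℕ))) ∘ₗ ev D i l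
  refine form_finrank_le (w := fun _ => l) a _ (piece D i l n) (fun j => ?_) (fun j u hu => ?_)
    (fun j k u hu => ?_) (fun j u hu h h' => ?_) rfl
  · have := finiteDimensional_filt (D := D) (i := i) (l := l) n
    exact Submodule.finiteDimensional_of_le inf_le_left
  · rw [mem_piece] at hu ⊢
    exact ⟨gen_smul_mem_filt n _ hu.1, by rw [← mul_smul, e_mul_ε]⟩
  · rw [mem_piece] at hu ⊢
    exact ⟨gen_smul_mem_filt n _ hu.1, by rw [← mul_smul, e_mul_α]⟩
  · exact eq_zero_of_α_smul hl (mem_piece.1 hu).2 h fun k hk => congrFun h' ⟨k, hk⟩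

theorem exists_filt_stable (hl : 1 ≤ l) : ∃ n, ∀ m, filt D i l m ≤ filt D i l n := by
  obtain ⟨B, hB⟩ := exists_finrank_piece_le (D := D) (i := i) hl
  let f : ℕ → ℕ := fun n => ∑ j, finrank ℂ (piece D i l n j)
  have hf : BddAbove (Set.range f) := by
    refine ⟨∑ _j : I, B, ?_⟩
    rintro _ ⟨n, rfl⟩
    exact Finset.sum_le_sum fun j _ => hB n j
  obtain ⟨n, hn⟩ := Nat.sSup_mem (Set.range_nonempty f) hf
  have hmax : ∀ m, f m ≤ f n := fun m => by rw [hn]; exact le_csSup hf ⟨m, rfl⟩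
  have hfin : ∀ m j, FiniteDimensional ℂ (piece D i l m j) := fun m j => by
    have := finiteDimensional_filt (D := D) (i := i) (l := l) m
    exact Submodule.finiteDimensional_of_le inf_le_left
  refine ⟨n, fun m => ?_⟩
  rcases le_total m n with hmn | hnm
  · exact filt_mono hmn
  have hle : ∀ j, piece D i l n j ≤ piece D i l m j := fun j =>
    inf_le_inf_right _ (filt_mono hnm)
  have heq : ∀ j, finrank ℂ (piece D i l n j) = finrank ℂ (piece D i l m j) := by
    have h1 : ∀ j ∈ Finset.univ, finrank ℂ (piece D i l n j) ≤ finrank ℂ (piece D i l m j) :=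
      fun j _ => Submodule.finrank_mono (hle j)
    have h2 := (Finset.sum_eq_sum_iff_of_le h1).1
      (le_antisymm (Finset.sum_le_sum h1) (hmax m))
    exact fun j => h2 j (Finset.mem_univ j)
  intro φ hφ
  have : φ = ∑ j, gen D (.e j) • φ := by rw [← Finset.sum_smul, sum_e, one_smul]
  rw [this]
  refine Submodule.sum_mem _ fun j _ => ?_
  have h3 : gen D (.e j) • φ ∈ piece D i l m j :=
    mem_piece.2 ⟨gen_smul_mem_filt m _ hφ, by rw [← mul_smul, e_mul_self]⟩
  rw [← Submodule.eq_of_le_of_finrank_eq (hle j) (heq j)] at h3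
  exact (mem_piece.1 h3).1

/-- Each arrow has positive degree, so a linear form which vanishes in degrees at least `n` is killed
by the paths of length `n`. -/
theorem mem_filt_of_posDeg (n : ℕ) : ∀ φ : DualModule D i l,
    (∀ w : List (Gen I), n ≤ (w.map (posDeg D)).sum → ev D i l φ (word w) = 0) →
    φ ∈ filt D i l n := by
  induction n with
  | zero =>
    intro φ h
    refine (Submodule.mem_bot ℂ).2 (ev_injective ?_)
    rw [map_zero]
    exact linearMap_ext fun w => h w (Nat.zero_le _)
  | succ n ih =>
    refine fun φ h => mem_filt_succ.2 fun y => ih _ fun w hw => ?_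
    rw [ev_smul, transp_gen, ← word_cons]
    refine h _ ?_
    have := one_le_posDeg_arrow (D := D) y
    rw [List.map_cons, List.sum_cons, posDeg_swap]
    omega

/-- A linear form belongs to a step of the filtration if its homogeneous components do. This is not
a finite sum a priori, but the components of the linear forms are compatible with the arrows. -/
theorem mem_filt_of_proj (n : ℕ) : ∀ φ : DualModule D i l,
    (∀ k ψ, ev D i l ψ = ev D i l φ ∘ₗ proj k → ψ ∈ filt D i l n) → φ ∈ filt D i l n := by
  induction n with
  | zero =>
    intro φ h
    refine (Submodule.mem_bot ℂ).2 (ev_injective ?_)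
    rw [map_zero]
    refine linearMap_ext fun w => ?_
    obtain ⟨ψ, hψ⟩ := exists_ev_comp_proj φ (w.map (posDeg D)).sum
    have h1 := LinearMap.congr_fun hψ (word w)
    rw [LinearMap.comp_apply, proj_word, if_pos rfl, (Submodule.mem_bot ℂ).1 (h _ ψ hψ),
      map_zero] at h1
    exact h1.symm
  | succ n ih =>
    refine fun φ h => mem_filt_succ.2 fun y => ih _ fun k ψ hψ => ?_
    obtain ⟨ψ', hψ'⟩ := exists_ev_comp_proj φ (k + posDeg D (arrow y))
    have h1 : ψ = gen D (arrow y) • ψ' := by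
      refine ev_injective (linearMap_ext fun w => ?_)
      rw [hψ, ev_smul, hψ', LinearMap.comp_apply, LinearMap.comp_apply, ev_smul, transp_gen,
        ← word_cons, proj_word, proj_word, List.map_cons, List.sum_cons, posDeg_swap]
      split_ifs
      · rw [word_cons]
      · omega
      · omega
      · rw [mul_zero]
    rw [h1]
    exact mem_filt_succ.1 (h _ ψ' hψ') y

/-- The dual module is nilpotent, as the dimensions of the steps of its socle filtration are
bounded. -/
theorem exists_filt_eq_top (hl : 1 ≤ l) : ∃ n, filt D i l n = ⊤ := by
  obtain ⟨n, hn⟩ := exists_filt_stable (D := D) (i := i) hl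
  refine ⟨n, Submodule.eq_top_iff'.2 fun φ => mem_filt_of_proj n φ fun k ψ hψ => hn (k + 1) ?_⟩
  refine mem_filt_of_posDeg _ _ fun w hw => ?_
  rw [hψ, LinearMap.comp_apply, proj_word, if_neg (by omega), map_zero]

theorem finiteDimensional (hl : 1 ≤ l) : FiniteDimensional ℂ (DualModule D i l) := by
  obtain ⟨n, hn⟩ := exists_filt_eq_top (D := D) (i := i) hl
  have := finiteDimensional_filt (D := D) (i := i) (l := l) n
  rw [hn] at this
  exact Module.Finite.equiv (Submodule.topEquiv (R := ℂ) (M := DualModule D i l))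

end DualModule

namespace KRDatum

variable (K : KRDatum D)

instance : FiniteDimensional ℂ K.KGamma := by
  have : ∀ r, FiniteDimensional ℂ (DualModule D (K.i r) (K.l r)) :=
    fun r => DualModule.finiteDimensional (K.l_pos r)
  exact Module.Finite.pi

/-- The arrows act nilpotently on `K_γ`. -/
theorem exists_word_smul_eq_zero : ∃ n : ℕ, ∀ w : List (I ⊕ I × I), w.length = n →
    ∀ φ : K.KGamma, word (D := D) (w.map arrow) • φ = 0 := by
  choose n hn using fun r => DualModule.exists_filt_eq_top (D := D) (i := K.i r) (K.l_pos r)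
  refine ⟨∑ r, n r, fun w hw φ => funext fun r => ?_⟩
  have h1 : φ r ∈ DualModule.filt D (K.i r) (K.l r) (0 + w.length) := by
    refine DualModule.filt_mono (a := n r) ?_ (by rw [hn]; trivial)
    rw [hw, zero_add]
    exact Finset.single_le_sum (f := n) (fun _ _ => Nat.zero_le _) (Finset.mem_univ r)
  exact (Submodule.mem_bot ℂ).1 (DualModule.word_smul_mem_filt w 0 h1)

/-- The linear form on `Π` attached to the `r`-th component of an element of `K_γ`. -/
def ev (r : Fin K.s) : K.KGamma →ₗ[ℂ] Preproj D →ₗ[ℂ] ℂ :=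
  DualModule.ev D (K.i r) (K.l r) ∘ₗ LinearMap.proj r

end KRDatum

end

/-! ### Homogeneous matrices -/

section Homogeneous

variable {Λ : Type} [AddCommGroupWithOne Λ] {ι κ μ : Type*} {s : ι → Λ} {t : κ → Λ} {u : μ → Λ}

/-- The matrix `A` is homogeneous of degree `δ`, for the degrees `s` and `t` of the basis vectors
of its target and of its source. -/
def Homog (s : ι → Λ) (t : κ → Λ) (δ : Λ) (A : Matrix ι κ ℂ) : Prop :=
  ∀ b b', A b b' ≠ 0 → s b = t b' + δ

theorem Homog.zero (δ : Λ) : Homog s t δ 0 := fun _ _ h => absurd rfl h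

theorem Homog.one [DecidableEq ι] : Homog s s 0 (1 : Matrix ι ι ℂ) := by
  intro b b' h
  by_cases hb : b = b'
  · rw [hb, add_zero]
  · exact absurd (Matrix.one_apply_ne hb) h

theorem Homog.add {δ : Λ} {A B : Matrix ι κ ℂ} (hA : Homog s t δ A) (hB : Homog s t δ B) :
    Homog s t δ (A + B) := by
  intro b b' h
  by_cases hb : A b b' = 0
  · refine hB b b' fun h' => h ?_
    rw [Matrix.add_apply, hb, h', add_zero]
  · exact hA b b' hb

theorem Homog.smul {δ : Λ} {A : Matrix ι κ ℂ} (c : ℂ) (hA : Homog s t δ A) :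
    Homog s t δ (c • A) := fun b b' h => hA b b' (right_ne_zero_of_mul h)

theorem Homog.sub {δ : Λ} {A B : Matrix ι κ ℂ} (hA : Homog s t δ A) (hB : Homog s t δ B) :
    Homog s t δ (A - B) := by
  have := hA.add (hB.smul (-1))
  rwa [neg_one_smul, ← sub_eq_add_neg] at this

theorem Homog.sum {S : Type*} {T : Finset S} {δ : Λ} {A : S → Matrix ι κ ℂ}
    (h : ∀ a ∈ T, Homog s t δ (A a)) : Homog s t δ (∑ a ∈ T, A a) := by
  classical
  induction T using Finset.induction_on with
  | empty => exact .zero δ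
  | insert a T ha ih =>
    rw [Finset.sum_insert ha]
    exact (h a (by simp)).add (ih fun b hb => h b (by simp [hb]))

theorem Homog.mul [Fintype κ] {δ δ' δ'' : Λ} {A : Matrix ι κ ℂ} {B : Matrix κ μ ℂ}
    (hA : Homog s t δ A) (hB : Homog t u δ' B) (h : δ + δ' = δ'') :
    Homog s u δ'' (A * B) := by
  intro b b' hb
  obtain ⟨c, -, hc⟩ := Finset.exists_ne_zero_of_sum_ne_zero hb
  rw [hA b c (left_ne_zero_of_mul hc), hB c b' (right_ne_zero_of_mul hc), ← h, add_assoc,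
    add_comm δ']

theorem Homog.pow [Fintype ι] [DecidableEq ι] {δ : Λ} {A : Matrix ι ι ℂ}
    (hA : Homog s s δ A) (n : ℕ) : Homog s s (n • δ) (A ^ n) := by
  induction n with
  | zero => simpa using Homog.one
  | succ n ih =>
    rw [pow_succ]
    exact ih.mul hA (succ_nsmul δ n).symm

theorem Homog.transpose {δ : Λ} {A : Matrix ι κ ℂ} (hA : Homog s t δ A) :
    Homog t s (-δ) A.transpose := by
  intro b b' h
  rw [hA b' b h, add_neg_cancel_right]

theorem Homog.conjTranspose {δ : Λ} {A : Matrix ι κ ℂ} (hA : Homog s t δ A) :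
    Homog t s (-δ) A.conjTranspose := by
  intro b b' h
  rw [hA b' b fun h' => h (by rw [Matrix.conjTranspose_apply, h', star_zero]),
    add_neg_cancel_right]

open Classical in
/-- The homogeneous component of degree `k` of a vector. -/
def component (s : ι → Λ) (k : Λ) (v : ι → ℂ) : ι → ℂ := fun b => if s b = k then v b else 0

theorem Homog.mulVec_component [Fintype κ] {δ : Λ} {A : Matrix ι κ ℂ} (hA : Homog s t δ A) (k : Λ)
    (v : κ → ℂ) : A.mulVec (component t k v) = component s (k + δ) (A.mulVec v) := by
  funext b
  simp only [Matrix.mulVec, dotProduct, component]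
  split_ifs with h
  · refine Finset.sum_congr rfl fun c _ => ?_
    split_ifs with h'
    · rfl
    · rw [mul_zero]
      by_contra h0
      have := hA b c (left_ne_zero_of_mul (Ne.symm h0))
      rw [h] at this
      exact h' (add_right_cancel this).symm
  · refine Finset.sum_eq_zero fun c _ => ?_
    split_ifs with h'
    · by_contra h0
      exact h (h' ▸ hA b c (left_ne_zero_of_mul h0))
    · rw [mul_zero]

/-- A graded subspace is the image of a projector which is homogeneous of degree zero. -/
theorem exists_homog_projector [Fintype ι] [DecidableEq ι] (F : Submodule ℂ (ι → ℂ))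
    (hF : ∀ u ∈ F, ∀ k, component s k u ∈ F) : ∃ P : Matrix ι ι ℂ, Homog s s 0 P ∧
      (∀ u, P.mulVec u ∈ F) ∧ ∀ u ∈ F, P.mulVec u = u := by
  classical
  obtain ⟨f, hf⟩ := F.subtype.exists_leftInverse_of_injective (Submodule.ker_subtype F)
  let P₀ : Matrix ι ι ℂ := LinearMap.toMatrix' (F.subtype ∘ₗ f)
  have hP₀ : ∀ u, P₀.mulVec u = f u := fun u => by
    rw [← Matrix.toLin'_apply, Matrix.toLin'_toMatrix']; rfl
  have hP₀' : ∀ u ∈ F, P₀.mulVec u = u := fun u hu => by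
    rw [hP₀]
    exact congrArg Subtype.val (LinearMap.congr_fun hf ⟨u, hu⟩)
  let P : Matrix ι ι ℂ := fun b b' => if s b = s b' then P₀ b b' else 0
  have hP : ∀ u b, P.mulVec u b = P₀.mulVec (component s (s b) u) b := by
    intro u b
    simp only [Matrix.mulVec, dotProduct, component, P]
    refine Finset.sum_congr rfl fun c _ => ?_
    by_cases h : s b = s c
    · rw [if_pos h, if_pos h.symm]
    · rw [if_neg h, if_neg (Ne.symm h), zero_mul, mul_zero]
  refine ⟨P, fun b b' h => ?_, fun u => ?_, fun u hu => ?_⟩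
  · by_contra h'
    rw [add_zero] at h'
    exact h (if_neg h')
  · have : P.mulVec u = ∑ k ∈ Finset.univ.image s,
        component s k (P₀.mulVec (component s k u)) := by
      funext b
      rw [hP, Finset.sum_apply, Finset.sum_eq_single (s b)]
      · simp [component]
      · intro k _ hk
        exact if_neg (Ne.symm hk)
      · simp
    rw [this]
    refine Submodule.sum_mem _ fun k _ => hF _ ?_ k
    rw [hP₀]
    exact (f _).2
  · funext b
    rw [hP, hP₀' _ (hF u hu _)]
    simp [component]

end Homogeneous

/-! ### Matrices of polynomial functions -/

section PolyMat

variable {E : Type*} [AddCommGroup E] [Module ℂ E] {ι κ μ : Type*}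

/-- The entries of the matrix valued function `F` are polynomial functions. -/
def PolyMat (F : E → Matrix ι κ ℂ) : Prop := ∀ b b', (fun x => F x b b') ∈ polynomialFunctions E

theorem const_mem_polynomialFunctions (c : ℂ) : (fun _ : E => c) ∈ polynomialFunctions E :=
  Subalgebra.algebraMap_mem (polynomialFunctions E) c

theorem PolyMat.const (A : Matrix ι κ ℂ) : PolyMat fun _ : E => A := fun b b' =>
  const_mem_polynomialFunctions (A b b')

theorem PolyMat.linear {F : E → Matrix ι κ ℂ} (hadd : ∀ x y, F (x + y) = F x + F y)
    (hsmul : ∀ (c : ℂ) x, F (c • x) = c • F x) : PolyMat F := fun b b' =>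
  dual_mem_polynomialFunctions
    { toFun := fun x => F x b b'
      map_add' := fun x y => by rw [hadd]; rfl
      map_smul' := fun c x => by rw [hsmul]; rfl }

theorem sum_mem_polynomialFunctions {S : Type*} {T : Finset S} {f : S → E → ℂ}
    (h : ∀ a ∈ T, f a ∈ polynomialFunctions E) :
    (fun x => ∑ a ∈ T, f a x) ∈ polynomialFunctions E := by
  have := sum_mem h
  convert this using 1
  funext x
  rw [Finset.sum_apply]

theorem PolyMat.mul [Fintype κ] {F : E → Matrix ι κ ℂ} {G : E → Matrix κ μ ℂ} (hF : PolyMat F)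
    (hG : PolyMat G) : PolyMat fun x => F x * G x := fun b b' =>
  sum_mem_polynomialFunctions fun c _ => mul_mem (hF b c) (hG c b')

end PolyMat

section

variable {I : Type*} [Fintype I] [DecidableEq I] {D : CartanDatum I}
variable {Λ : Type} [AddCommGroupWithOne Λ]

/-! ### The total space of a graded vector space -/

section Blocks

/-- The basis of the total space of `V`. -/
abbrev Tot (V : GradedSpace I Λ) := Σ i, V.Basis i

/-- The degrees of the basis vectors of the total space. -/
def totDeg (V : GradedSpace I Λ) (b : Tot V) : Λ := V.deg b.1 b.2

/-- The inclusion of `Vᵢ` into the total space. -/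
def inc (V : GradedSpace I Λ) (i : I) : Matrix (Tot V) (V.Basis i) ℂ :=
  (1 : Matrix (Tot V) (Tot V) ℂ).submatrix id (Sigma.mk i)

/-- The block matrix with a single block `Vⱼ → Vᵢ`. -/
def blk {V : GradedSpace I Λ} (i j : I) (A : Matrix (V.Basis i) (V.Basis j) ℂ) :
    Matrix (Tot V) (Tot V) ℂ :=
  inc V i * A * (inc V j).transpose

variable {V : GradedSpace I Λ}

theorem transpose_inc_mul {κ : Type*} (i : I) (M : Matrix (Tot V) κ ℂ) :
    (inc V i).transpose * M = M.submatrix (Sigma.mk i) id := by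
  ext b c
  simp [inc, Matrix.mul_apply, Matrix.one_apply]

theorem mul_inc {κ : Type*} (i : I) (M : Matrix κ (Tot V) ℂ) :
    M * inc V i = M.submatrix id (Sigma.mk i) := by
  ext b c
  simp [inc, Matrix.mul_apply, Matrix.one_apply]

theorem transpose_inc_mul_inc (i : I) : (inc V i).transpose * inc V i = 1 := by
  rw [transpose_inc_mul, inc, Matrix.submatrix_submatrix]
  exact Matrix.submatrix_one _ sigma_mk_injective

theorem transpose_inc_mul_inc_of_ne {i j : I} (h : i ≠ j) :
    (inc V i).transpose * inc V j = 0 := by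
  rw [transpose_inc_mul, inc, Matrix.submatrix_submatrix]
  ext b c
  exact Matrix.one_apply_ne fun h' => h (congrArg Sigma.fst h')

theorem sum_inc_mul : ∑ i, inc V i * (inc V i).transpose = 1 := by
  ext ⟨i, b⟩ c
  rw [Matrix.sum_apply, Finset.sum_eq_single i]
  · rw [Matrix.mul_apply, Finset.sum_eq_single b]
    · simp [inc, Matrix.one_apply, eq_comm]
    · intro b' _ hb
      have : inc V i ⟨i, b⟩ b' = 0 :=
        Matrix.one_apply_ne fun h => hb (sigma_mk_injective h).symm
      rw [this, zero_mul]
    · simp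
  · intro j _ hj
    rw [Matrix.mul_apply]
    refine Finset.sum_eq_zero fun b' _ => ?_
    have : inc V j ⟨i, b⟩ b' = 0 :=
      Matrix.one_apply_ne fun h => hj (congrArg Sigma.fst h).symm
    rw [this, zero_mul]
  · simp

theorem homog_inc (i : I) : Homog (totDeg V) (V.deg i) 0 (inc V i) := by
  intro b c h
  have : b = ⟨i, c⟩ := by
    by_contra h'
    exact h (Matrix.one_apply_ne h')
  rw [this, add_zero]
  rfl

theorem homog_blk {i j : I} {A : Matrix (V.Basis i) (V.Basis j) ℂ} {δ : Λ}
    (hA : Homog (V.deg i) (V.deg j) δ A) : Homog (totDeg V) (totDeg V) δ (blk i j A) :=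
  ((homog_inc i).mul hA (zero_add δ)).mul (homog_inc j).transpose (by simp)

theorem blk_mul_inc (i j : I) (A : Matrix (V.Basis i) (V.Basis j) ℂ) :
    blk i j A * inc V j = inc V i * A := by
  rw [blk, Matrix.mul_assoc, transpose_inc_mul_inc, Matrix.mul_one]

theorem blk_mul_inc_of_ne {i j k : I} (h : j ≠ k) (A : Matrix (V.Basis i) (V.Basis j) ℂ) :
    blk i j A * inc V k = 0 := by
  rw [blk, Matrix.mul_assoc, transpose_inc_mul_inc_of_ne h, Matrix.mul_zero]

theorem blk_mul_blk (i j k : I) (A : Matrix (V.Basis i) (V.Basis j) ℂ)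
    (B : Matrix (V.Basis j) (V.Basis k) ℂ) : blk i j A * blk j k B = blk i k (A * B) := by
  conv_lhs => rw [blk.eq_1 j k, ← Matrix.mul_assoc, ← Matrix.mul_assoc, blk_mul_inc]
  rw [blk, Matrix.mul_assoc _ A B]

theorem blk_mul_blk_of_ne {i j j' k : I} (h : j ≠ j') (A : Matrix (V.Basis i) (V.Basis j) ℂ)
    (B : Matrix (V.Basis j') (V.Basis k) ℂ) : blk i j A * blk j' k B = 0 := by
  rw [blk.eq_1 j' k, ← Matrix.mul_assoc, ← Matrix.mul_assoc, blk_mul_inc_of_ne h,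
    Matrix.zero_mul, Matrix.zero_mul]

theorem transpose_inc_mul_blk_mul_inc (i j : I) (A : Matrix (V.Basis i) (V.Basis j) ℂ) :
    (inc V i).transpose * blk i j A * inc V j = A := by
  rw [Matrix.mul_assoc, blk_mul_inc, ← Matrix.mul_assoc, transpose_inc_mul_inc, Matrix.one_mul]

theorem blk_injective (i j : I) : Function.Injective (blk (V := V) i j) :=
  Function.LeftInverse.injective (g := fun M => (inc V i).transpose * M * inc V j)
    (transpose_inc_mul_blk_mul_inc i j)

variable (V) in
/-- The block matrix, as a linear map. -/
def blkLin (i j : I) : Matrix (V.Basis i) (V.Basis j) ℂ →ₗ[ℂ] Matrix (Tot V) (Tot V) ℂ where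
  toFun := blk i j
  map_add' A B := by simp [blk, Matrix.mul_add, Matrix.add_mul]
  map_smul' c A := by simp [blk]

theorem blk_zero (i j : I) : blk (V := V) i j 0 = 0 := map_zero (blkLin V i j)

theorem blk_sum {S : Type*} (T : Finset S) (i j : I) (A : S → Matrix (V.Basis i) (V.Basis j) ℂ) :
    blk i j (∑ a ∈ T, A a) = ∑ a ∈ T, blk i j (A a) := map_sum (blkLin V i j) A T

theorem blk_smul (c : ℂ) (i j : I) (A : Matrix (V.Basis i) (V.Basis j) ℂ) :
    blk i j (c • A) = c • blk i j A := map_smul (blkLin V i j) c A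

/-- A matrix is a block matrix if its other blocks are zero. -/
theorem eq_blk {i j : I} {M : Matrix (Tot V) (Tot V) ℂ} (h1 : blk i i 1 * M = M)
    (h2 : M * blk j j 1 = M) : M = blk i j ((inc V i).transpose * M * inc V j) := by
  conv_lhs => rw [← h2, ← h1]
  simp only [blk, Matrix.mul_one, Matrix.mul_assoc]

/-- The block diagonal matrix. -/
def diag (A : ∀ i, Matrix (V.Basis i) (V.Basis i) ℂ) : Matrix (Tot V) (Tot V) ℂ :=
  ∑ i, blk i i (A i)

theorem diag_mul_blk (A : ∀ i, Matrix (V.Basis i) (V.Basis i) ℂ) (i j : I)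
    (B : Matrix (V.Basis i) (V.Basis j) ℂ) : diag A * blk i j B = blk i j (A i * B) := by
  rw [diag, Finset.sum_mul, Finset.sum_eq_single i]
  · rw [blk_mul_blk]
  · intro k _ hk
    exact blk_mul_blk_of_ne hk _ _
  · simp

theorem blk_mul_diag (A : ∀ i, Matrix (V.Basis i) (V.Basis i) ℂ) (i j : I)
    (B : Matrix (V.Basis i) (V.Basis j) ℂ) : blk i j B * diag A = blk i j (B * A j) := by
  rw [diag, Finset.mul_sum, Finset.sum_eq_single j]
  · rw [blk_mul_blk]
  · intro k _ hk
    exact blk_mul_blk_of_ne hk.symm _ _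
  · simp

theorem diag_mul_inc (A : ∀ i, Matrix (V.Basis i) (V.Basis i) ℂ) (i : I) :
    diag A * inc V i = inc V i * A i := by
  rw [diag, Matrix.sum_mul, Finset.sum_eq_single i]
  · rw [blk_mul_inc]
  · intro k _ hk
    exact blk_mul_inc_of_ne hk _
  · simp

theorem transpose_inc_mul_diag (A : ∀ i, Matrix (V.Basis i) (V.Basis i) ℂ) (i : I) :
    (inc V i).transpose * diag A = A i * (inc V i).transpose := by
  rw [diag, Matrix.mul_sum, Finset.sum_eq_single i]
  · rw [blk, ← Matrix.mul_assoc, ← Matrix.mul_assoc, transpose_inc_mul_inc, Matrix.one_mul]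
  · intro k _ hk
    rw [blk, ← Matrix.mul_assoc, ← Matrix.mul_assoc, transpose_inc_mul_inc_of_ne hk.symm,
      Matrix.zero_mul, Matrix.zero_mul]
  · simp

theorem diag_mul_diag (A B : ∀ i, Matrix (V.Basis i) (V.Basis i) ℂ) :
    diag A * diag B = diag fun i => A i * B i := by
  conv_lhs => rw [diag.eq_1 B, Finset.mul_sum]
  exact Finset.sum_congr rfl fun i _ => diag_mul_blk A i i (B i)

theorem diag_one : diag (V := V) (fun _ => 1) = 1 := by
  simp only [diag, blk, Matrix.mul_one, sum_inc_mul]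

end Blocks

/-! ### The operators of a representation on the total space -/

section Operators

variable {V W : GradedSpace I Λ}

theorem mem_rep_iff {x : Tuple V W} : x ∈ Rep D V W ↔
    (∀ i j, Homog (V.deg i) (V.deg j) ((D.d i * D.c i j : ℤ) : Λ) (x.α i j) ∧
      (¬ D.c i j < 0 → x.α i j = 0)) ∧
    (∀ i, Homog (V.deg i) (V.deg i) ((2 * D.d i : ℤ) : Λ) (x.ε i)) ∧
    (∀ i, Homog (W.deg i) (V.deg i) ((-D.d i : ℤ) : Λ) (x.a i)) ∧
    (∀ i, Homog (V.deg i) (W.deg i) ((-D.d i : ℤ) : Λ) (x.a' i)) := by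
  refine and_congr ⟨fun h i j => ⟨fun b b' hb => (h i j b b' hb).2, fun hc => ?_⟩,
    fun h i j b b' hb => ⟨?_, (h i j).1 b b' hb⟩⟩ Iff.rfl
  · ext b b'
    by_contra hb
    exact hc (h i j b b' hb).1
  · by_contra hc
    rw [(h i j).2 hc] at hb
    exact hb rfl

/-- The action of a generator of `Π` on the total space of a representation. -/
def opMat (x : Tuple V W) : Gen I → Matrix (Tot V) (Tot V) ℂ
  | .e i => blk i i 1
  | .ε i => blk i i (x.ε i)
  | .α i j => blk i j (x.α i j)

/-- The action of a word in the generators on the total space of a representation. -/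
def wordMat (x : Tuple V W) (w : List (Gen I)) : Matrix (Tot V) (Tot V) ℂ :=
  (w.map (opMat x)).prod

@[simp] theorem wordMat_nil (x : Tuple V W) : wordMat x [] = 1 := rfl

@[simp] theorem wordMat_cons (x : Tuple V W) (g : Gen I) (w : List (Gen I)) :
    wordMat x (g :: w) = opMat x g * wordMat x w := by simp [wordMat]

theorem wordMat_append (x : Tuple V W) (w w' : List (Gen I)) :
    wordMat x (w ++ w') = wordMat x w * wordMat x w' := by simp [wordMat]

theorem homog_opMat (x : Rep D V W) (g : Gen I) :
    Homog (totDeg V) (totDeg V) ((g.deg D : ℤ) : Λ) (opMat x.1 g) := by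
  have hx := mem_rep_iff.1 x.2
  cases g with
  | e i =>
    rw [show ((Gen.deg D (.e i) : ℤ) : Λ) = 0 from Int.cast_zero]
    exact homog_blk Homog.one
  | ε i => exact homog_blk (hx.2.1 i)
  | α i j => exact homog_blk (hx.1 i j).1

theorem homog_wordMat (x : Rep D V W) (w : List (Gen I)) :
    Homog (totDeg V) (totDeg V) (((w.map (Gen.deg D)).sum : ℤ) : Λ) (wordMat x.1 w) := by
  induction w with
  | nil => simpa using Homog.one
  | cons g w ih =>
    rw [wordMat_cons]
    exact (homog_opMat x g).mul ih (by simp)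

theorem polyMat_α (i j : I) : PolyMat fun x : Rep D V W => x.1.α i j :=
  .linear (fun _ _ => rfl) fun _ _ => rfl

theorem polyMat_ε (i : I) : PolyMat fun x : Rep D V W => x.1.ε i :=
  .linear (fun _ _ => rfl) fun _ _ => rfl

theorem polyMat_a (i : I) : PolyMat fun x : Rep D V W => x.1.a i :=
  .linear (fun _ _ => rfl) fun _ _ => rfl

theorem polyMat_a' (i : I) : PolyMat fun x : Rep D V W => x.1.a' i :=
  .linear (fun _ _ => rfl) fun _ _ => rfl

theorem PolyMat.blk {E : Type*} [AddCommGroup E] [Module ℂ E] (i j : I)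
    {F : E → Matrix (V.Basis i) (V.Basis j) ℂ} (hF : PolyMat F) :
    PolyMat fun x => blk i j (F x) :=
  ((PolyMat.const _).mul hF).mul (.const _)

theorem polyMat_opMat (g : Gen I) : PolyMat fun x : Rep D V W => opMat x.1 g := by
  cases g with
  | e i => exact .const _
  | ε i => exact (polyMat_ε i).blk i i
  | α i j => exact (polyMat_α i j).blk i j

theorem polyMat_wordMat (w : List (Gen I)) : PolyMat fun x : Rep D V W => wordMat x.1 w := by
  induction w with
  | nil => exact .const _
  | cons g w ih =>
    simp only [wordMat_cons]
    exact (polyMat_opMat g).mul ih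

/-- In a stable representation, a vector of `Vᵢ` which is killed by all paths from `i` to the
framing is zero. -/
theorem Stable.eq_zero {x : Rep D V W} (hx : Stable D x) {i : I} {u : V.Basis i → ℂ}
    (h : ∀ w j, (x.1.a j * ((inc V j).transpose * wordMat x.1 w * inc V i)).mulVec u = 0) :
    u = 0 := by
  let S : ∀ i, Submodule ℂ (V.Basis i → ℂ) := fun i => ⨅ (w : List (Gen I)) (j : I),
    LinearMap.ker (x.1.a j * ((inc V j).transpose * wordMat x.1 w * inc V i)).mulVecLin
  have hS : ∀ i u, u ∈ S i ↔ ∀ w j,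
      (x.1.a j * ((inc V j).transpose * wordMat x.1 w * inc V i)).mulVec u = 0 := by
    intro i u
    simp only [S, Submodule.mem_iInf, LinearMap.mem_ker, Matrix.mulVecLin_apply]
  have hgen : ∀ (g : Gen I) (i k : I) (A : Matrix (V.Basis i) (V.Basis k) ℂ),
      opMat x.1 g = blk i k A → ∀ u ∈ S k, A.mulVec u ∈ S i := by
    intro g i k A hg u hu
    rw [hS] at hu ⊢
    intro w j
    have := hu (w ++ [g]) j
    rw [wordMat_append, wordMat_cons, wordMat_nil, Matrix.mul_one, hg, Matrix.mul_assoc,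
      Matrix.mul_assoc, blk_mul_inc] at this
    rw [Matrix.mulVec_mulVec]
    simpa only [Matrix.mul_assoc] using this
  have key := hx S ?_ (fun i j u hu => hgen (.α i j) i j _ rfl u hu)
    (fun i u hu => hgen (.ε i) i i _ rfl u hu) ?_ i
  · have hu : u ∈ S i := (hS i u).2 h
    rw [key] at hu
    exact (Submodule.mem_bot ℂ).1 hu
  · intro i u hu k
    rw [hS] at hu ⊢
    intro w j
    have hom := (((mem_rep_iff.1 x.2).2.2.1 j).mul ((((homog_inc j).transpose).mul
      (homog_wordMat x w)  rfl).mul (homog_inc i) rfl) rfl).mulVec_component k u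
    rw [hu w j] at hom
    refine hom.trans ?_
    funext b
    simp [component]
  · intro i u hu
    have := (hS i u).1 hu [] i
    rwa [wordMat_nil, Matrix.mul_one, transpose_inc_mul_inc, Matrix.mul_one] at this

end Operators

end

section

variable {I : Type*} [Fintype I] [DecidableEq I] {D : CartanDatum I}
variable {Λ : Type} [AddCommGroupWithOne Λ] {V W : GradedSpace I Λ}

/-! ### The action of the gauge group -/

theorem homog_gauge {g : ∀ i, (Matrix (V.Basis i) (V.Basis i) ℂ)ˣ} (hg : g ∈ gaugeGroup V) (i : I) :
    Homog (V.deg i) (V.deg i) 0 (g i).val := by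
  intro b b' h
  rw [add_zero]
  by_contra h'
  exact h (hg i b b' h')

theorem homog_gauge_inv {g : ∀ i, (Matrix (V.Basis i) (V.Basis i) ℂ)ˣ} (hg : g ∈ gaugeGroup V)
    (i : I) : Homog (V.deg i) (V.deg i) 0 (g i)⁻¹.val :=
  homog_gauge (inv_mem hg) i

/-- The action of an automorphism of `V` on the representation space. -/
def gaugeAct (g : gaugeGroup V) : Rep D V W →ₗ[ℂ] Rep D V W where
  toFun x := ⟨(fun i j => (g.1 i).val * x.1.α i j * (g.1 j)⁻¹.val,
      fun i => (g.1 i).val * x.1.ε i * (g.1 i)⁻¹.val, fun i => x.1.a i * (g.1 i)⁻¹.val,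
      fun i => (g.1 i).val * x.1.a' i), by
    have hx := mem_rep_iff.1 x.2
    have h1 := homog_gauge g.2
    have h2 := homog_gauge_inv g.2
    refine mem_rep_iff.2 ⟨fun i j => ⟨?_, fun hc => ?_⟩, fun i => ?_, fun i => ?_, fun i => ?_⟩
    · exact ((h1 i).mul (hx.1 i j).1 (zero_add _)).mul (h2 j) (add_zero _)
    · simp [Tuple.α, show x.1.1 i j = 0 from (hx.1 i j).2 hc]
    · exact ((h1 i).mul (hx.2.1 i) (zero_add _)).mul (h2 i) (add_zero _)
    · exact (hx.2.2.1 i).mul (h2 i) (add_zero _)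
    · exact (h1 i).mul (hx.2.2.2 i) (zero_add _)⟩
  map_add' x y := by
    have h : ∀ {ι κ μ ν : Type} [Fintype κ] [Fintype μ] (A : Matrix ι κ ℂ) (X Y : Matrix κ μ ℂ)
        (B : Matrix μ ν ℂ), A * (X + Y) * B = A * X * B + A * Y * B := by
      intro ι κ μ ν _ _ A X Y B
      rw [Matrix.mul_add, Matrix.add_mul]
    exact Subtype.ext (Prod.ext (funext fun i => funext fun j => h _ (x.1.α i j) (y.1.α i j) _)
      (Prod.ext (funext fun i => h _ (x.1.ε i) (y.1.ε i) _) (Prod.ext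
        (funext fun i => Matrix.add_mul (x.1.a i) (y.1.a i) _)
        (funext fun i => Matrix.mul_add _ (x.1.a' i) (y.1.a' i)))))
  map_smul' c x := by
    have h : ∀ {ι κ μ ν : Type} [Fintype κ] [Fintype μ] (A : Matrix ι κ ℂ) (X : Matrix κ μ ℂ)
        (B : Matrix μ ν ℂ), A * (c • X) * B = c • (A * X * B) := by
      intro ι κ μ ν _ _ A X B
      rw [Matrix.mul_smul, Matrix.smul_mul]
    exact Subtype.ext (Prod.ext (funext fun i => funext fun j => h _ (x.1.α i j) _)
      (Prod.ext (funext fun i => h _ (x.1.ε i) _) (Prod.ext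
        (funext fun i => Matrix.smul_mul c (x.1.a i) _)
        (funext fun i => Matrix.mul_smul _ c (x.1.a' i)))))

theorem rep_ext {x y : Rep D V W} (h1 : ∀ i j, x.1.α i j = y.1.α i j)
    (h2 : ∀ i, x.1.ε i = y.1.ε i) (h3 : ∀ i, x.1.a i = y.1.a i)
    (h4 : ∀ i, x.1.a' i = y.1.a' i) : x = y :=
  Subtype.ext (Prod.ext (funext fun i => funext (h1 i)) (Prod.ext (funext h2)
    (Prod.ext (funext h3) (funext h4))))

theorem sameOrbit_iff {x y : Rep D V W} : SameOrbit D x y ↔ ∃ g : gaugeGroup V, gaugeAct g x = y := by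
  constructor
  · rintro ⟨g, hg, h1, h2, h3, h4⟩
    exact ⟨⟨g, hg⟩, rep_ext (fun i j => (h1 i j).symm) (fun i => (h2 i).symm)
      (fun i => (h3 i).symm) fun i => (h4 i).symm⟩
  · rintro ⟨g, rfl⟩
    exact ⟨g.1, g.2, fun _ _ => rfl, fun _ => rfl, fun _ => rfl, fun _ => rfl⟩

theorem sameOrbit_gaugeAct (g : gaugeGroup V) (x : Rep D V W) : SameOrbit D x (gaugeAct g x) :=
  sameOrbit_iff.2 ⟨g, rfl⟩

theorem diag_gauge_inv_mul (g : gaugeGroup V) :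
    diag (fun i => (g.1 i)⁻¹.val) * diag (fun i => (g.1 i).val) = 1 := by
  rw [diag_mul_diag, ← diag_one]
  congr 1
  funext i
  exact Units.inv_mul _

theorem opMat_gaugeAct (g : gaugeGroup V) (x : Rep D V W) (y : Gen I) :
    opMat (gaugeAct g x).1 y =
      diag (fun i => (g.1 i).val) * opMat x.1 y * diag (fun i => (g.1 i)⁻¹.val) := by
  cases y with
  | e i =>
    rw [opMat, opMat, diag_mul_blk, blk_mul_diag, Matrix.mul_one, Units.mul_inv]
  | ε i => rw [opMat, opMat, diag_mul_blk, blk_mul_diag]; rfl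
  | α i j => rw [opMat, opMat, diag_mul_blk, blk_mul_diag]; rfl

theorem wordMat_gaugeAct (g : gaugeGroup V) (x : Rep D V W) (w : List (Gen I)) :
    wordMat (gaugeAct g x).1 w =
      diag (fun i => (g.1 i).val) * wordMat x.1 w * diag (fun i => (g.1 i)⁻¹.val) := by
  induction w with
  | nil =>
    rw [wordMat_nil, wordMat_nil, Matrix.mul_one]
    have := diag_gauge_inv_mul g⁻¹
    simpa using this.symm
  | cons y w ih =>
    rw [wordMat_cons, wordMat_cons, ih, opMat_gaugeAct]
    simp only [Matrix.mul_assoc]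
    rw [← Matrix.mul_assoc (diag fun i => (g.1 i)⁻¹.val), diag_gauge_inv_mul, Matrix.one_mul]

/-! ### The central fiber -/

theorem mk_mem_centralFiber_iff {x : {x : Rep D V W // Stable D x}} :
    Quotient.mk (orbitSetoid D V W) x ∈ centralFiber D V W ↔
      ∀ p ∈ invariantPolynomials D V W, p x.1 = p 0 := by
  change Quotient.mk (affineSetoid D V W) x.1 = Quotient.mk (affineSetoid D V W) 0 ↔ _
  rw [Quotient.eq]
  rfl

/-- In the central fiber the maps `a*` vanish, since all the invariants `a w a*`, for paths `w`,
vanish there. -/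
theorem a'_eq_zero {x : Rep D V W} (hx : Stable D x)
    (h : ∀ p ∈ invariantPolynomials D V W, p x = p 0) (i : I) : x.1.a' i = 0 := by
  have key : ∀ w j, x.1.a j * ((inc V j).transpose * wordMat x.1 w * inc V i) * x.1.a' i = 0 := by
    intro w j
    ext c c'
    have hp := h (fun y => (y.1.a j * ((inc V j).transpose * wordMat y.1 w * inc V i) *
      y.1.a' i) c c') ⟨?_, ?_⟩
    · refine hp.trans ?_
      have : (0 : Rep D V W).1.a j = 0 := rfl
      rw [this, Matrix.zero_mul, Matrix.zero_mul]
    · exact (((polyMat_a j).mul (((PolyMat.const _).mul (polyMat_wordMat w)).mul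
        (.const _))).mul (polyMat_a' i)) c c'
    · intro y z hyz
      obtain ⟨g, rfl⟩ := sameOrbit_iff.1 hyz
      have e1 : (gaugeAct g y).1.a j = y.1.a j * (g.1 j)⁻¹.val := rfl
      have e2 : (gaugeAct g y).1.a' i = (g.1 i).val * y.1.a' i := rfl
      have e3 : (inc V j).transpose * wordMat (gaugeAct g y).1 w * inc V i =
          (g.1 j).val * ((inc V j).transpose * wordMat y.1 w * inc V i) * (g.1 i)⁻¹.val := by
        rw [wordMat_gaugeAct]
        simp only [← Matrix.mul_assoc]
        rw [transpose_inc_mul_diag]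
        simp only [Matrix.mul_assoc]
        rw [diag_mul_inc]
      change _ = ((gaugeAct g y).1.a j * ((inc V j).transpose * wordMat (gaugeAct g y).1 w *
        inc V i) * (gaugeAct g y).1.a' i) c c'
      rw [e1, e2, e3]
      have e4 : (g.1 i)⁻¹.val * ((g.1 i).val * y.1.a' i) = y.1.a' i := by
        rw [← Matrix.mul_assoc, Units.inv_mul, Matrix.one_mul]
      have e5 : ∀ M : Matrix (V.Basis j) (W.Basis i) ℂ,
          (g.1 j)⁻¹.val * ((g.1 j).val * M) = M := by
        intro M
        rw [← Matrix.mul_assoc, Units.inv_mul, Matrix.one_mul]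
      simp only [Matrix.mul_assoc]
      rw [e4, e5]
  ext b c
  refine congrFun (hx.eq_zero (u := fun b => x.1.a' i b c) fun w j => ?_) b
  funext c'
  exact congrFun (congrFun (key w j) c') c

/-- The representation with the given maps `α`, `ε` and with zero framing maps. -/
def unframed (x : Rep D V W) : Rep D V W :=
  ⟨(x.1.1, x.1.2.1, 0, 0), by
    have hx := mem_rep_iff.1 x.2
    exact mem_rep_iff.2 ⟨hx.1, hx.2.1, fun i => .zero _, fun i => .zero _⟩⟩

/-- Scaling by automorphisms of `V` contracts `a` to zero. -/
theorem apply_unframed {x : Rep D V W} (hx : ∀ i, x.1.a' i = 0) {p : Rep D V W → ℂ}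
    (hp : p ∈ invariantPolynomials D V W) : p (unframed x) = p x := by
  refine eq_of_forall_ne_zero hp.1 (y := x - unframed x) fun t ht => ?_
  let g : ∀ i, (Matrix (V.Basis i) (V.Basis i) ℂ)ˣ := fun i =>
    ⟨t⁻¹ • 1, t • 1, by simp [smul_smul, ht], by simp [smul_smul, ht]⟩
  have hg : g ∈ gaugeGroup V := by
    intro i b b' h
    have : b ≠ b' := fun h' => h (h' ▸ rfl)
    simp [g, this]
  refine (hp.2 _ _ (sameOrbit_iff.2 ⟨⟨g, hg⟩, rep_ext (fun i j => ?_) (fun i => ?_) (fun i => ?_)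
    fun i => ?_⟩)).symm
  · change (t⁻¹ • (1 : Matrix _ _ ℂ)) * x.1.α i j * (t • (1 : Matrix _ _ ℂ)) =
      x.1.α i j + t • (x.1.α i j - x.1.α i j)
    simp [smul_smul, ht]
  · change (t⁻¹ • (1 : Matrix _ _ ℂ)) * x.1.ε i * (t • (1 : Matrix _ _ ℂ)) =
      x.1.ε i + t • (x.1.ε i - x.1.ε i)
    simp [smul_smul, ht]
  · change x.1.a i * (t • (1 : Matrix (V.Basis i) (V.Basis i) ℂ)) = 0 + t • (x.1.a i - 0)
    rw [Matrix.mul_smul, Matrix.mul_one, sub_zero, zero_add]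
  · change (t⁻¹ • (1 : Matrix (V.Basis i) (V.Basis i) ℂ)) * x.1.a' i = 0 + t • (x.1.a' i - 0)
    rw [hx i, Matrix.mul_zero, sub_zero, smul_zero, add_zero]

/-- The representation obtained by composing the maps `α`, `ε` with endomorphisms of degree zero. -/
def mulLeft (A : ∀ i, Matrix (V.Basis i) (V.Basis i) ℂ)
    (hA : ∀ i, Homog (V.deg i) (V.deg i) 0 (A i)) (x : Rep D V W) : Rep D V W :=
  ⟨(fun i j => A i * x.1.α i j, fun i => A i * x.1.ε i, 0, 0), by
    have hx := mem_rep_iff.1 x.2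
    refine mem_rep_iff.2 ⟨fun i j => ⟨(hA i).mul (hx.1 i j).1 (zero_add _), fun hc => ?_⟩,
      fun i => (hA i).mul (hx.2.1 i) (zero_add _), fun i => .zero _, fun i => .zero _⟩
    change A i * x.1.α i j = 0
    rw [(hx.1 i j).2 hc, Matrix.mul_zero]⟩

theorem opMat_mulLeft (A : ∀ i, Matrix (V.Basis i) (V.Basis i) ℂ)
    (hA : ∀ i, Homog (V.deg i) (V.deg i) 0 (A i)) (x : Rep D V W) (y : I ⊕ I × I) :
    opMat (mulLeft A hA x).1 (arrow y) = diag A * opMat x.1 (arrow y) := by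
  rcases y with i | ⟨i, j⟩
  · exact (diag_mul_blk A i i (x.1.ε i)).symm
  · exact (diag_mul_blk A i j (x.1.α i j)).symm

/-- There is a projector of degree zero onto the common kernel of the maps `α`, `ε`. -/
theorem exists_projector (x : Rep D V W) : ∃ P : ∀ i, Matrix (V.Basis i) (V.Basis i) ℂ,
    (∀ i, Homog (V.deg i) (V.deg i) 0 (P i)) ∧ (∀ i, P i * P i = P i) ∧
    (∀ i, x.1.ε i * P i = 0) ∧ (∀ i j, x.1.α i j * P j = 0) ∧
    ∀ M : Matrix (Tot V) (Tot V) ℂ, (∀ y, opMat x.1 (arrow y) * M = 0) → diag P * M = M := by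
  have hx := mem_rep_iff.1 x.2
  let F : ∀ i, Submodule ℂ (V.Basis i → ℂ) := fun i =>
    LinearMap.ker (x.1.ε i).mulVecLin ⊓ ⨅ j, LinearMap.ker (x.1.α j i).mulVecLin
  have hF : ∀ i u, u ∈ F i ↔ (x.1.ε i).mulVec u = 0 ∧ ∀ j, (x.1.α j i).mulVec u = 0 := by
    intro i u
    simp only [F, Submodule.mem_inf, Submodule.mem_iInf, LinearMap.mem_ker,
      Matrix.mulVecLin_apply]
  have hgr : ∀ i, ∀ u ∈ F i, ∀ k, component (V.deg i) k u ∈ F i := by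
    intro i u hu k
    rw [hF] at hu ⊢
    have h0 : ∀ {j : I} (k : Λ), component (V.deg j) k (0 : V.Basis j → ℂ) = 0 := by
      intro j k
      funext b
      simp [component]
    refine ⟨?_, fun j => ?_⟩
    · rw [(hx.2.1 i).mulVec_component, hu.1, h0]
    · rw [(hx.1 j i).1.mulVec_component, hu.2 j, h0]
  choose P h1 h2 h3 using fun i => exists_homog_projector (s := V.deg i) (F i) (hgr i)
  have hcol : ∀ {ι κ : Type} [Fintype ι] {M N : Matrix κ ι ℂ},
      (∀ u, M.mulVec u = N.mulVec u) → M = N := by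
    classical
    intro ι κ _ M N h
    exact Matrix.toLin'.injective (LinearMap.ext h)
  refine ⟨P, h1, fun i => hcol fun u => ?_, fun i => hcol fun u => ?_,
    fun i j => hcol fun u => ?_, fun M hM => ?_⟩
  · rw [← Matrix.mulVec_mulVec, h3 i _ (h2 i u)]
  · rw [← Matrix.mulVec_mulVec, ((hF _ _).1 (h2 i u)).1, Matrix.zero_mulVec]
  · rw [← Matrix.mulVec_mulVec, ((hF _ _).1 (h2 j u)).2 i, Matrix.zero_mulVec]
  · have key : ∀ i, P i * ((inc V i).transpose * M) = (inc V i).transpose * M := by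
      intro i
      have hN : ∀ {j : I} (A : Matrix (V.Basis j) (V.Basis i) ℂ), blk j i A * M = 0 →
          A * ((inc V i).transpose * M) = 0 := by
        intro j A h
        have := congrArg ((inc V j).transpose * ·) h
        simp only [blk, ← Matrix.mul_assoc, transpose_inc_mul_inc, Matrix.one_mul,
          Matrix.mul_zero] at this
        rwa [← Matrix.mul_assoc]
      ext b c
      refine congrFun (h3 i (fun b => ((inc V i).transpose * M) b c) ((hF _ _).2 ⟨?_, ?_⟩)) b
      · funext b'
        exact congrFun (congrFun (hN _ (hM (.inl i))) b') c
      · intro j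
        funext b'
        exact congrFun (congrFun (hN _ (hM (.inr (j, i)))) b') c
    conv_rhs => rw [← Matrix.one_mul M, ← sum_inc_mul, Matrix.sum_mul]
    rw [diag, Matrix.sum_mul]
    refine Finset.sum_congr rfl fun i _ => ?_
    rw [blk, Matrix.mul_assoc, Matrix.mul_assoc, key, Matrix.mul_assoc]

theorem eq_zero_of_opMat {x : Rep D V W} (hx : ∀ y, opMat x.1 (arrow y) = 0)
    (ha : ∀ i, x.1.a i = 0) (ha' : ∀ i, x.1.a' i = 0) : x = 0 :=
  rep_ext (fun i j => blk_injective i j ((hx (.inr (i, j))).trans (blk_zero i j).symm))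
    (fun i => blk_injective i i ((hx (.inl i)).trans (blk_zero i i).symm)) ha ha'

/-- If `α` and `ε` are nilpotent, and the framing maps vanish, then the representation belongs to
the null-cone. By induction on the nilpotency index: if `P` is the projector onto the common
kernel, then the one-parameter group `t P + (1 - P)` contracts the representation to the
composition with `1 - P`, whose index is smaller. -/
theorem apply_eq_apply_zero_of_unframed {p : Rep D V W → ℂ}
    (hp : p ∈ invariantPolynomials D V W) (n : ℕ) : ∀ x : Rep D V W, (∀ i, x.1.a i = 0) →
    (∀ i, x.1.a' i = 0) →
    (∀ w : List (I ⊕ I × I), w.length = n + 1 → wordMat x.1 (w.map arrow) = 0) → p x = p 0 := by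
  induction n with
  | zero =>
    intro x ha ha' h
    rw [eq_zero_of_opMat (fun y => ?_) ha ha']
    simpa using h [y] rfl
  | succ n ih =>
    intro x ha ha' h
    obtain ⟨P, hP, hPP, hε, hα, hM⟩ := exists_projector x
    have hQ : ∀ i, Homog (V.deg i) (V.deg i) 0 (1 - P i) := fun i => Homog.one.sub (hP i)
    have hεQ : ∀ i (c : ℂ), x.1.ε i * (c • P i + (1 - P i)) = x.1.ε i := fun i c => by
      rw [Matrix.mul_add, Matrix.mul_smul, Matrix.mul_sub, hε]; simp
    have hαQ : ∀ i j (c : ℂ), x.1.α i j * (c • P j + (1 - P j)) = x.1.α i j := fun i j c => by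
      rw [Matrix.mul_add, Matrix.mul_smul, Matrix.mul_sub, hα]; simp
    have step : p (mulLeft (fun i => 1 - P i) hQ x) = p x := by
      refine eq_of_forall_ne_zero hp.1 (y := mulLeft P hP x) fun t ht => ?_
      have hinv : ∀ i (c c' : ℂ), c * c' = 1 →
          (c • P i + (1 - P i)) * (c' • P i + (1 - P i)) = 1 := by
        intro i c c' hc
        simp only [Matrix.add_mul, Matrix.mul_add, Matrix.mul_sub, Matrix.sub_mul, Matrix.mul_smul,
          Matrix.smul_mul, hPP, Matrix.mul_one, Matrix.one_mul]
        simp [smul_smul, mul_comm c', hc]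
      let g : ∀ i, (Matrix (V.Basis i) (V.Basis i) ℂ)ˣ := fun i =>
        ⟨t • P i + (1 - P i), t⁻¹ • P i + (1 - P i), hinv i _ _ (mul_inv_cancel₀ ht),
          hinv i _ _ (inv_mul_cancel₀ ht)⟩
      have hg : g ∈ gaugeGroup V := by
        intro i b b' hb
        by_contra h'
        exact hb (by simpa using ((hP i).smul t).add (hQ i) b b' h')
      refine (hp.2 _ _ (sameOrbit_iff.2 ⟨⟨g, hg⟩, rep_ext (fun i j => ?_) (fun i => ?_)
        (fun i => ?_) fun i => ?_⟩)).symm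
      · change (t • P i + (1 - P i)) * x.1.α i j * (t⁻¹ • P j + (1 - P j)) =
          (1 - P i) * x.1.α i j + t • (P i * x.1.α i j)
        rw [Matrix.mul_assoc, hαQ, Matrix.add_mul, Matrix.smul_mul, add_comm]
      · change (t • P i + (1 - P i)) * x.1.ε i * (t⁻¹ • P i + (1 - P i)) =
          (1 - P i) * x.1.ε i + t • (P i * x.1.ε i)
        rw [Matrix.mul_assoc, hεQ, Matrix.add_mul, Matrix.smul_mul, add_comm]
      · change x.1.a i * _ = 0 + t • 0
        rw [ha, Matrix.zero_mul, smul_zero, add_zero]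
      · change _ * x.1.a' i = 0 + t • 0
        rw [ha', Matrix.mul_zero, smul_zero, add_zero]
    rw [← step]
    refine ih _ (fun i => rfl) (fun i => rfl) fun w hw => ?_
    have hdiag : diag (fun i => 1 - P i) = 1 - diag P := by
      rw [← diag_one, diag, diag, diag, ← Finset.sum_sub_distrib]
      exact Finset.sum_congr rfl fun i _ => map_sub (blkLin V i i) _ _
    have hopQ : ∀ y, opMat x.1 (arrow y) * diag (fun i => 1 - P i) = opMat x.1 (arrow y) := by
      have h0 : ∀ y, opMat x.1 (arrow y) * diag P = 0 := by
        rintro (i | ⟨i, j⟩)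
        · exact (blk_mul_diag P i i _).trans (by rw [hε, blk_zero])
        · exact (blk_mul_diag P i j _).trans (by rw [hα, blk_zero])
      intro y
      rw [hdiag, mul_sub, mul_one, h0, sub_zero]
    have hword : ∀ (w : List (I ⊕ I × I)), w ≠ [] →
        wordMat (mulLeft (fun i => 1 - P i) hQ x).1 (w.map arrow) =
          diag (fun i => 1 - P i) * wordMat x.1 (w.map arrow) := by
      intro w hw
      induction w with
      | nil => exact absurd rfl hw
      | cons y w ihw =>
        rw [List.map_cons, wordMat_cons, wordMat_cons, opMat_mulLeft]
        by_cases hw' : w = []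
        · subst hw'
          simp
        · rw [ihw hw', mul_assoc, ← mul_assoc (opMat _ _), hopQ]
    rw [hword w (by rintro rfl; simp at hw), hdiag, sub_mul, one_mul, hM, sub_self]
    intro y
    have := h (y :: w) (by rw [List.length_cons, hw])
    rwa [List.map_cons, wordMat_cons] at this

theorem apply_eq_apply_zero {x : Rep D V W} (ha' : ∀ i, x.1.a' i = 0) {n : ℕ}
    (h : ∀ w : List (I ⊕ I × I), w.length = n → wordMat x.1 (w.map arrow) = 0)
    {p : Rep D V W → ℂ} (hp : p ∈ invariantPolynomials D V W) : p x = p 0 := by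
  rw [← apply_unframed ha' hp]
  have hop : ∀ w : List (I ⊕ I × I), wordMat (unframed x).1 (w.map arrow) =
      wordMat x.1 (w.map arrow) := by
    intro w
    induction w with
    | nil => rfl
    | cons y w ih =>
      rw [List.map_cons, wordMat_cons, wordMat_cons, ih]
      rcases y with i | ⟨i, j⟩ <;> rfl
  refine apply_eq_apply_zero_of_unframed hp n _ (fun _ => rfl) (fun _ => rfl) fun w hw => ?_
  rw [hop]
  cases w with
  | nil => simp at hw
  | cons y w =>
    rw [List.map_cons, wordMat_cons, h w (by simpa using hw), mul_zero]

end

/-! ### Derivatives of matrix valued functions -/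

section Derivatives

variable {ι κ μ : Type*}

/-- The entries of the function `F` of a complex variable have the entries of `F'` as derivatives
at zero. -/
def MatDeriv (F : ℂ → Matrix ι κ ℂ) (F' : Matrix ι κ ℂ) : Prop :=
  ∀ b b', HasDerivAt (fun t => F t b b') (F' b b') 0

theorem MatDeriv.const (A : Matrix ι κ ℂ) : MatDeriv (fun _ => A) 0 :=
  fun b b' => hasDerivAt_const 0 (A b b')

theorem MatDeriv.line (A B : Matrix ι κ ℂ) : MatDeriv (fun t => A + t • B) B := by
  intro b b'
  simpa using ((hasDerivAt_id (0 : ℂ)).mul_const (B b b')).const_add (A b b')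

theorem MatDeriv.mul [Fintype κ] {F : ℂ → Matrix ι κ ℂ} {F' : Matrix ι κ ℂ}
    {G : ℂ → Matrix κ μ ℂ} {G' : Matrix κ μ ℂ} (hF : MatDeriv F F') (hG : MatDeriv G G') :
    MatDeriv (fun t => F t * G t) (F' * G 0 + F 0 * G') := by
  intro b b'
  have := HasDerivAt.fun_sum (u := Finset.univ) fun c _ => (hF b c).mul (hG c b')
  rw [Finset.sum_add_distrib] at this
  exact this

theorem MatDeriv.pow [Fintype ι] [DecidableEq ι] {F : ℂ → Matrix ι ι ℂ} {F' : Matrix ι ι ℂ}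
    (hF : MatDeriv F F') (n : ℕ) : MatDeriv (fun t => F t ^ n)
      (∑ k ∈ Finset.range n, F 0 ^ (n - 1 - k) * F' * F 0 ^ k) := by
  induction n with
  | zero => simpa using MatDeriv.const (1 : Matrix ι ι ℂ)
  | succ n ih =>
    have := hF.mul ih
    simp only [← pow_succ'] at this
    convert this using 1
    rw [Finset.sum_range_succ, add_comm, Finset.mul_sum]
    congr 1
    · simp
    · refine Finset.sum_congr rfl fun k hk => ?_
      have : n + 1 - 1 - k = (n - 1 - k) + 1 := by
        have := Finset.mem_range.1 hk
        omega
      rw [this, pow_succ']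
      simp only [mul_assoc]

theorem MatDeriv.trace [Fintype ι] {F : ℂ → Matrix ι ι ℂ} {F' : Matrix ι ι ℂ}
    (hF : MatDeriv F F') : HasDerivAt (fun t => (F t).trace) F'.trace 0 :=
  HasDerivAt.fun_sum fun c _ => hF c c

end Derivatives

section

variable {I : Type*} [Fintype I] [DecidableEq I] {D : CartanDatum I}
variable {Λ : Type} [AddCommGroupWithOne Λ] {V W : GradedSpace I Λ}

/-! ### The critical locus of the potential -/

variable (D) in
/-- The cyclic derivative of the undeformed potential with respect to `εᵢ`. -/
def derivε (x : Tuple V W) (i : I) : Matrix (V.Basis i) (V.Basis i) ℂ :=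
  ∑ j, ∑ k ∈ Finset.range (D.n i j), D.sign i j •
    (x.ε i ^ k * x.α i j * x.α j i * x.ε i ^ (D.n i j - 1 - k))

variable (D) in
/-- The derivative of the undeformed potential with respect to `αⱼᵢ`. -/
def derivα (x : Tuple V W) (i j : I) : Matrix (V.Basis i) (V.Basis j) ℂ :=
  D.sign i j • (x.ε i ^ D.n i j * x.α i j - x.α i j * x.ε j ^ D.n j i)

theorem hasLineDerivAt_potential (γ : ∀ i, Matrix (W.Basis i) (W.Basis i) ℂ) (x y : Rep D V W) :
    HasLineDerivAt ℂ (potential D γ)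
      (∑ i, ∑ j, (derivα D x.1 i j * y.1.α j i).trace +
        ∑ i, ((derivε D x.1 i + x.1.a' i * x.1.a i) * y.1.ε i).trace +
        ∑ i, ((x.1.ε i * x.1.a' i - x.1.a' i * γ i) * y.1.a i).trace +
        ∑ i, ((x.1.a i * x.1.ε i - γ i * x.1.a i) * y.1.a' i).trace) x y := by
  have dε := fun i => MatDeriv.line (x.1.ε i) (y.1.ε i)
  have dα := fun i j => MatDeriv.line (x.1.α i j) (y.1.α i j)
  have da := fun i => MatDeriv.line (x.1.a i) (y.1.a i)
  have da' := fun i => MatDeriv.line (x.1.a' i) (y.1.a' i)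
  have key := ((HasDerivAt.fun_sum (u := Finset.univ) fun i _ => HasDerivAt.fun_sum
    (u := Finset.univ) fun j _ => ((((dε i).pow (D.n i j)).mul (dα i j)).mul
      (dα j i)).trace.const_mul (D.sign i j)).add (HasDerivAt.fun_sum (u := Finset.univ) fun i _ =>
    (((dε i).mul (da' i)).mul (da i)).trace)).sub (HasDerivAt.fun_sum (u := Finset.univ)
    fun i _ => (((MatDeriv.const (γ i)).mul (da i)).mul (da' i)).trace)
  refine HasDerivAt.congr_deriv key ?_
  simp only [zero_smul, add_zero, Matrix.zero_mul, zero_add]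
  have e1 : ∀ i, (derivε D x.1 i * y.1.ε i).trace = ∑ j, D.sign i j *
      ((∑ k ∈ Finset.range (D.n i j), x.1.ε i ^ (D.n i j - 1 - k) * y.1.ε i * x.1.ε i ^ k) *
        x.1.α i j * x.1.α j i).trace := by
    intro i
    rw [derivε, Finset.sum_mul, Matrix.trace_sum]
    refine Finset.sum_congr rfl fun j _ => ?_
    rw [← Finset.smul_sum, Matrix.smul_mul, Matrix.trace_smul, smul_eq_mul]
    congr 1
    rw [Finset.sum_mul, Matrix.sum_mul, Matrix.sum_mul, Matrix.trace_sum, Matrix.trace_sum]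
    refine Finset.sum_congr rfl fun k _ => ?_
    rw [Matrix.trace_mul_comm, ← Matrix.mul_assoc, Matrix.trace_mul_comm]
    simp only [Matrix.mul_assoc]
  have e2 : ∑ i, ∑ j, (derivα D x.1 i j * y.1.α j i).trace = ∑ i, ∑ j, D.sign i j *
      ((x.1.ε i ^ D.n i j * y.1.α i j * x.1.α j i).trace +
        (x.1.ε i ^ D.n i j * x.1.α i j * y.1.α j i).trace) := by
    have : ∀ i j, (derivα D x.1 i j * y.1.α j i).trace =
        D.sign j i * (x.1.ε j ^ D.n j i * y.1.α j i * x.1.α i j).trace +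
        D.sign i j * (x.1.ε i ^ D.n i j * x.1.α i j * y.1.α j i).trace := by
      intro i j
      rw [derivα, Matrix.smul_mul, Matrix.trace_smul, Matrix.sub_mul, Matrix.trace_sub,
        D.sign_swap i j, smul_eq_mul, Matrix.mul_assoc (x.1.α i j),
        Matrix.trace_mul_comm (x.1.α i j)]
      ring
    simp only [this, mul_add, Finset.sum_add_distrib]
    congr 1
    exact Finset.sum_comm
  rw [e2]
  simp only [Matrix.add_mul, Matrix.sub_mul, Matrix.trace_add, Matrix.trace_sub, e1, mul_add,
    Finset.sum_add_distrib, Finset.sum_sub_distrib]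
  have f1 : ∀ i, (x.1.a' i * x.1.a i * y.1.ε i).trace = (y.1.ε i * x.1.a' i * x.1.a i).trace :=
    fun i => by rw [Matrix.trace_mul_comm, Matrix.mul_assoc]
  have f2 : ∀ i, (x.1.a i * x.1.ε i * y.1.a' i).trace = (x.1.ε i * y.1.a' i * x.1.a i).trace :=
    fun i => by rw [Matrix.mul_assoc, Matrix.trace_mul_comm]
  have f3 : ∀ i, (x.1.a' i * γ i * y.1.a i).trace = (γ i * y.1.a i * x.1.a' i).trace :=
    fun i => by rw [Matrix.mul_assoc, Matrix.trace_mul_comm]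
  simp only [f1, f2, f3]
  ring

theorem nsmul_intCast (n : ℕ) (z : ℤ) : n • (z : Λ) = ((n * z : ℤ) : Λ) := by
  simpa using (map_nsmul (Int.castAddHom Λ) n z).symm

theorem homog_derivα (x : Rep D V W) (i j : I) :
    Homog (V.deg i) (V.deg j) (-((D.d j * D.c j i : ℤ) : Λ)) (derivα D x.1 i j) := by
  have hx := mem_rep_iff.1 x.2
  by_cases hc : D.c i j < 0
  · have hc' : D.c j i < 0 := (Preproj.neg_swap D i j).1 hc
    refine Homog.smul _ (Homog.sub ?_ ?_)
    · refine ((hx.2.1 i).pow (D.n i j)).mul (hx.1 i j).1 ?_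
      rw [nsmul_intCast, ← Int.cast_add, ← Int.cast_neg, D.n_cast hc, ← D.symm i j]
      congr 1
      ring
    · refine (hx.1 i j).1.mul ((hx.2.1 j).pow (D.n j i)) ?_
      rw [nsmul_intCast, ← Int.cast_add, ← Int.cast_neg, D.n_cast hc', D.symm i j]
      congr 1
      ring
  · rw [derivα, (hx.1 i j).2 hc, Matrix.mul_zero, Matrix.zero_mul, sub_zero, smul_zero]
    exact .zero _

theorem homog_derivε (x : Rep D V W) (i : I) :
    Homog (V.deg i) (V.deg i) (-((2 * D.d i : ℤ) : Λ)) (derivε D x.1 i) := by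
  have hx := mem_rep_iff.1 x.2
  refine Homog.sum fun j _ => Homog.sum fun k hk => Homog.smul _ ?_
  have hk' := Finset.mem_range.1 hk
  have hc : D.c i j < 0 := by
    by_contra hc
    rw [D.n_eq_zero hc] at hk'
    omega
  refine ((((hx.2.1 i).pow k).mul (hx.1 i j).1 rfl).mul (hx.1 j i).1 rfl).mul
    ((hx.2.1 i).pow _) ?_
  rw [nsmul_intCast, nsmul_intCast, ← Int.cast_add, ← Int.cast_add, ← Int.cast_add,
    ← Int.cast_neg, ← D.symm i j]
  congr 1
  have h1 : ((D.n i j - 1 - k : ℕ) : ℤ) = -D.c i j - 1 - k := by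
    have := D.n_cast hc
    omega
  rw [h1]
  ring

open scoped ComplexOrder in
/-- The critical points of the potential are the solutions of the equations which are obtained by
putting the cyclic derivatives to zero. If the differential vanishes, then it vanishes on the
conjugate transpose of the gradient, where its value is a sum of squares. -/
theorem critical_iff {γ : ∀ i, Matrix (W.Basis i) (W.Basis i) ℂ}
    (hγ : ∀ i, Homog (W.deg i) (W.deg i) ((2 * D.d i : ℤ) : Λ) (γ i)) (x : Rep D V W) :
    (∀ y : Rep D V W, HasLineDerivAt ℂ (potential D γ) 0 x y) ↔
      (∀ i j, derivα D x.1 i j = 0) ∧ (∀ i, derivε D x.1 i + x.1.a' i * x.1.a i = 0) ∧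
      (∀ i, x.1.ε i * x.1.a' i - x.1.a' i * γ i = 0) ∧
      ∀ i, x.1.a i * x.1.ε i - γ i * x.1.a i = 0 := by
  constructor
  · intro h
    have hx := mem_rep_iff.1 x.2
    let y : Rep D V W := ⟨(fun i j => (derivα D x.1 j i).conjTranspose,
      fun i => (derivε D x.1 i + x.1.a' i * x.1.a i).conjTranspose,
      fun i => (x.1.ε i * x.1.a' i - x.1.a' i * γ i).conjTranspose,
      fun i => (x.1.a i * x.1.ε i - γ i * x.1.a i).conjTranspose), by
        refine mem_rep_iff.2 ⟨fun i j => ⟨?_, fun hc => ?_⟩, fun i => ?_, fun i => ?_,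
          fun i => ?_⟩
        · simpa using (homog_derivα x j i).conjTranspose
        · change (derivα D x.1 j i).conjTranspose = 0
          rw [derivα, (hx.1 j i).2 (by rwa [Preproj.neg_swap])]
          simp
        · simpa using ((homog_derivε x i).add ((hx.2.2.2 i).mul (hx.2.2.1 i) (by
            rw [← Int.cast_add, ← Int.cast_neg]; congr 1; ring))).conjTranspose
        · simpa using (((hx.2.1 i).mul (hx.2.2.2 i) (δ'' := -((-D.d i : ℤ) : Λ)) (by
            rw [← Int.cast_add, ← Int.cast_neg]; congr 1; ring)).sub ((hx.2.2.2 i).mul (hγ i) (by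
            rw [← Int.cast_add, ← Int.cast_neg]; congr 1; ring))).conjTranspose
        · simpa using (((hx.2.2.1 i).mul (hx.2.1 i) (δ'' := -((-D.d i : ℤ) : Λ)) (by
            rw [← Int.cast_add, ← Int.cast_neg]; congr 1; ring)).sub ((hγ i).mul (hx.2.2.1 i) (by
            rw [← Int.cast_add, ← Int.cast_neg]; congr 1; ring))).conjTranspose⟩
    have h0 := (hasLineDerivAt_potential γ x y).unique (h y)
    have nn : ∀ {ι κ : Type} [Fintype ι] [Fintype κ] (A : Matrix ι κ ℂ),
        0 ≤ (A * A.conjTranspose).trace := fun A =>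
      (Matrix.posSemidef_self_mul_conjTranspose A).trace_nonneg
    have n1 := Finset.sum_nonneg fun i (_ : i ∈ Finset.univ) =>
      Finset.sum_nonneg fun j (_ : j ∈ Finset.univ) => nn (derivα D x.1 i j)
    have n2 := Finset.sum_nonneg fun i (_ : i ∈ Finset.univ) =>
      nn (derivε D x.1 i + x.1.a' i * x.1.a i)
    have n3 := Finset.sum_nonneg fun i (_ : i ∈ Finset.univ) =>
      nn (x.1.ε i * x.1.a' i - x.1.a' i * γ i)
    have n4 := Finset.sum_nonneg fun i (_ : i ∈ Finset.univ) =>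
      nn (x.1.a i * x.1.ε i - γ i * x.1.a i)
    obtain ⟨h', h4⟩ := (add_eq_zero_iff_of_nonneg (add_nonneg (add_nonneg n1 n2) n3) n4).1 h0
    obtain ⟨h', h3⟩ := (add_eq_zero_iff_of_nonneg (add_nonneg n1 n2) n3).1 h'
    obtain ⟨h1, h2⟩ := (add_eq_zero_iff_of_nonneg n1 n2).1 h'
    refine ⟨fun i j => ?_, fun i => ?_, fun i => ?_, fun i => ?_⟩
    · have := (Finset.sum_eq_zero_iff_of_nonneg fun i (_ : i ∈ Finset.univ) =>
        Finset.sum_nonneg fun j (_ : j ∈ Finset.univ) => nn (derivα D x.1 i j)).1 h1 i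
        (Finset.mem_univ i)
      exact Matrix.trace_mul_conjTranspose_self_eq_zero_iff.1 ((Finset.sum_eq_zero_iff_of_nonneg
        fun j (_ : j ∈ Finset.univ) => nn (derivα D x.1 i j)).1 this j (Finset.mem_univ j))
    · exact Matrix.trace_mul_conjTranspose_self_eq_zero_iff.1 ((Finset.sum_eq_zero_iff_of_nonneg
        fun i (_ : i ∈ Finset.univ) => nn _).1 h2 i (Finset.mem_univ i))
    · exact Matrix.trace_mul_conjTranspose_self_eq_zero_iff.1 ((Finset.sum_eq_zero_iff_of_nonneg
        fun i (_ : i ∈ Finset.univ) => nn _).1 h3 i (Finset.mem_univ i))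
    · exact Matrix.trace_mul_conjTranspose_self_eq_zero_iff.1 ((Finset.sum_eq_zero_iff_of_nonneg
        fun i (_ : i ∈ Finset.univ) => nn _).1 h4 i (Finset.mem_univ i))
  · rintro ⟨h1, h2, h3, h4⟩ y
    have := hasLineDerivAt_potential γ x y
    simpa [h1, h2, h3, h4] using this

/-- Criticality does not depend on the representative of an orbit. -/
theorem mk_mem_criticalLocus_iff {γ : ∀ i, Matrix (W.Basis i) (W.Basis i) ℂ}
    {x : {x : Rep D V W // Stable D x}} :
    Quotient.mk (orbitSetoid D V W) x ∈ criticalLocus D γ ↔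
      ∀ y : Rep D V W, HasLineDerivAt ℂ (potential D γ) 0 x.1 y := by
  refine ⟨?_, fun h => ⟨x, rfl, h⟩⟩
  rintro ⟨z, hz, h⟩ y
  have hzx : SameOrbit D z.1 x.1 := Quotient.exact hz
  obtain ⟨g, hg⟩ := sameOrbit_iff.1 ((sameOrbit_equivalence D V W).symm hzx)
  have := h (gaugeAct g y)
  refine HasDerivAt.congr_of_eventuallyEq this (Filter.Eventually.of_forall fun t => ?_)
  change potential D γ (x.1 + t • y) = potential D γ (z.1 + t • gaugeAct g y)
  rw [← hg, ← map_smul, ← map_add]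
  exact potential_eq_of_sameOrbit D γ _ _ (sameOrbit_gaugeAct g _)

end

/-! ### Matrices acting on families of vectors -/

section Comb

variable {E ι κ μ : Type*} [AddCommGroup E] [Module ℂ E] [Fintype ι] [Fintype κ]

/-- The family of linear combinations of the vectors `f c`, with the columns of `M` as
coefficients. -/
def comb (f : ι → E) (M : Matrix ι κ ℂ) : κ → E := fun b => ∑ c, M c b • f c

theorem comb_one [DecidableEq ι] (f : ι → E) : comb f (1 : Matrix ι ι ℂ) = f := by
  funext b
  simp [comb, Matrix.one_apply]

theorem comb_comb (f : ι → E) (M : Matrix ι κ ℂ) (N : Matrix κ μ ℂ) :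
    comb (comb f M) N = comb f (M * N) := by
  funext b
  simp only [comb, Matrix.mul_apply, Finset.smul_sum, Finset.sum_smul, smul_smul]
  rw [Finset.sum_comm]
  exact Finset.sum_congr rfl fun c _ => Finset.sum_congr rfl fun c' _ => by rw [mul_comm]

theorem comb_add (f : ι → E) (M N : Matrix ι κ ℂ) : comb f (M + N) = comb f M + comb f N := by
  funext b
  simp [comb, add_smul, Finset.sum_add_distrib]

theorem comb_smul (f : ι → E) (c : ℂ) (M : Matrix ι κ ℂ) : comb f (c • M) = c • comb f M := by
  funext b
  simp [comb, Finset.smul_sum, smul_smul]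

theorem comb_zero (f : ι → E) : comb f (0 : Matrix ι κ ℂ) = 0 := by
  funext b
  simp [comb]

theorem comb_injective {f : ι → E} (hf : LinearIndependent ℂ f) :
    Function.Injective (comb (κ := κ) f) := by
  intro M N h
  ext c b
  have h' := congrFun h b
  simp only [comb] at h'
  rw [← sub_eq_zero, ← Finset.sum_sub_distrib] at h'
  simp only [← sub_smul] at h'
  exact sub_eq_zero.1 (Fintype.linearIndependent_iff.1 hf _ h' c)

theorem comb_mem_span (f : ι → E) (M : Matrix ι κ ℂ) (b : κ) :
    comb f M b ∈ Submodule.span ℂ (Set.range f) :=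
  Submodule.sum_mem _ fun c _ => Submodule.smul_mem _ _ (Submodule.subset_span ⟨c, rfl⟩)

theorem exists_comb_eq {f : ι → E} {u : κ → E}
    (h : ∀ b, u b ∈ Submodule.span ℂ (Set.range f)) : ∃ M : Matrix ι κ ℂ, comb f M = u := by
  choose M hM using fun b => Submodule.mem_span_range_iff_exists_fun ℂ |>.1 (h b)
  exact ⟨fun c b => M b c, funext hM⟩

theorem map_comb {E' : Type*} [AddCommGroup E'] [Module ℂ E'] (φ : E →ₗ[ℂ] E') (f : ι → E)
    (M : Matrix ι κ ℂ) (b : κ) : φ (comb f M b) = ∑ c, M c b • φ (f c) := by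
  simp [comb, map_sum]

end Comb

section

variable {I : Type*} [Fintype I] [DecidableEq I] {D : CartanDatum I}
variable {Λ : Type} [AddCommGroupWithOne Λ] {V W : GradedSpace I Λ}

open Preproj

/-! ### The regular nilpotent operator -/

namespace KRDatum

variable (K : KRDatum D)

/-- The index of the basis vector of `W_r` of highest degree. -/
def last (r : Fin K.s) : Fin (K.l r) := ⟨K.l r - 1, by have := K.l_pos r; omega⟩

variable {K} in
theorem γ_pow_index {r : Fin K.s} (k : ℕ) {m m' : Fin (K.l r)} (h : (K.γ r ^ k) m m' ≠ 0) :
    (m : ℕ) = m' + k := by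
  induction k generalizing m with
  | zero =>
    by_contra h'
    rw [pow_zero] at h
    exact h (Matrix.one_apply_ne fun e => h' (by rw [e, add_zero]))
  | succ k ih =>
    rw [pow_succ', Matrix.mul_apply] at h
    obtain ⟨c, -, hc⟩ := Finset.exists_ne_zero_of_sum_ne_zero h
    have h1 := ih (right_ne_zero_of_mul hc)
    have h2 := K.γ_homogeneous r m c (left_ne_zero_of_mul hc)
    have hd := D.d_pos (K.i r)
    have h3 : (2 * D.d (K.i r) : ℤ) * (m - c - 1) = 0 := by
      unfold blockDeg at h2
      linarith
    have h4 : (m : ℤ) - c - 1 = 0 := by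
      rcases mul_eq_zero.1 h3 with h | h
      · omega
      · exact h
    omega

theorem γ_pow_l (r : Fin K.s) : K.γ r ^ K.l r = 0 := by
  ext m m'
  by_contra h
  have := γ_pow_index _ h
  have := m.2
  omega

/-- The basis vector of index `m` of `W_r`, as a basis vector of `W`. -/
def idx {i : I} (r : {r : Fin K.s // K.i r = i}) (m : Fin (K.l r)) : (K.W Λ).Basis i := ⟨r, m⟩

/-- The entry by which a power of `γ_r` maps the basis vector of index `m` of `W_r` to the one of
highest degree. -/
def coef (r : Fin K.s) (m : Fin (K.l r)) : ℂ := (K.γ r ^ (m.rev : ℕ)) (K.last r) m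

theorem coef_last (r : Fin K.s) : K.coef r (K.last r) = 1 := by
  have : ((K.last r).rev : ℕ) = 0 := by
    have := K.l_pos r
    rw [Fin.val_rev]
    simp only [last]
    omega
  rw [coef, this, pow_zero, Matrix.one_apply_eq]

/-- As `γ_r` is a single Jordan block, it moves each basis vector to the next one. -/
theorem coef_ne_zero (r : Fin K.s) (m : Fin (K.l r)) : K.coef r m ≠ 0 := by
  intro h0
  refine K.γ_regular r ?_
  have hm := m.2
  have e : K.l r - 1 = (m.rev : ℕ) + m := by
    rw [Fin.val_rev]
    omega
  ext a b
  rw [e, pow_add, Matrix.mul_apply]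
  refine Finset.sum_eq_zero fun c _ => ?_
  by_contra h
  have h1 := γ_pow_index _ (left_ne_zero_of_mul h)
  have h2 := γ_pow_index _ (right_ne_zero_of_mul h)
  have ha := a.2
  rw [Fin.val_rev] at h1
  have e1 : a = K.last r := Fin.ext (by simp only [last]; omega)
  have e2 : c = m := Fin.ext (by omega)
  rw [e1, e2] at h
  exact left_ne_zero_of_mul h h0

theorem gamma_pow_mul {i : I} {κ : Type*} (k : ℕ) (M : Matrix ((K.W Λ).Basis i) κ ℂ)
    (r : {r : Fin K.s // K.i r = i}) (m : Fin (K.l r)) (c : κ) :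
    (K.gamma Λ i ^ k * M) (K.idx r m) c = ∑ m', (K.γ r ^ k) m m' * M (K.idx r m') c := by
  have hp : K.gamma Λ i ^ k = Matrix.blockDiagonal'
      fun r : {r : Fin K.s // K.i r = i} => K.γ r ^ k :=
    (Matrix.blockDiagonal'_pow (fun r : {r : Fin K.s // K.i r = i} => K.γ r) k).symm
  rw [Matrix.mul_apply, hp]
  refine (Fintype.sum_sigma _).trans ((Finset.sum_eq_single r ?_ ?_).trans ?_)
  · intro r' _ hr
    refine Finset.sum_eq_zero fun m' _ => ?_
    refine mul_eq_zero_of_left ?_ _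
    exact Matrix.blockDiagonal'_apply_ne _ _ _ (Ne.symm hr)
  · simp
  · refine Finset.sum_congr rfl fun m' _ => ?_
    refine congrArg (· * _) ?_
    exact Matrix.blockDiagonal'_apply_eq _ _ _ _

theorem gamma_pow_rev_mul {i : I} {κ : Type*} (M : Matrix ((K.W Λ).Basis i) κ ℂ)
    (r : {r : Fin K.s // K.i r = i}) (m : Fin (K.l r)) (c : κ) :
    (K.gamma Λ i ^ (m.rev : ℕ) * M) (K.idx r (K.last r)) c = K.coef r m * M (K.idx r m) c := by
  rw [gamma_pow_mul, Finset.sum_eq_single m]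
  · rfl
  · intro m' _ hm'
    by_contra h
    have h1 := γ_pow_index _ (left_ne_zero_of_mul h)
    refine hm' (Fin.ext ?_)
    have := m.2
    rw [Fin.val_rev, last] at h1
    simp only at h1
    omega
  · simp

theorem gamma_pow_l_mul {i : I} {κ : Type*} (M : Matrix ((K.W Λ).Basis i) κ ℂ)
    (r : {r : Fin K.s // K.i r = i}) (m : Fin (K.l r)) (c : κ) :
    (K.gamma Λ i ^ K.l r * M) (K.idx r m) c = 0 := by
  rw [gamma_pow_mul, γ_pow_l]
  simp

theorem homog_gamma (i : I) :
    Homog ((K.W Λ).deg i) ((K.W Λ).deg i) ((2 * D.d i : ℤ) : Λ) (K.gamma Λ i) := by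
  rintro ⟨r, m⟩ ⟨r', m'⟩ h
  by_cases hr : r = r'
  · subst hr
    rw [gamma, Matrix.blockDiagonal'_apply_eq] at h
    change ((blockDeg D _ _ _ m : ℤ) : Λ) = (blockDeg D _ _ _ m' : ℤ) + _
    rw [K.γ_homogeneous _ _ _ h, r.2, Int.cast_add]
  · exact absurd (Matrix.blockDiagonal'_apply_ne _ _ _ hr) h

/-- The degree of the basis vector of highest degree. -/
theorem deg_last {i : I} (r : {r : Fin K.s // K.i r = i}) :
    (K.W Λ).deg i (K.idx r (K.last r)) = ((K.k r + K.l r * D.d i - D.d i : ℤ) : Λ) := by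
  change ((blockDeg D (K.i r) (K.k r) (K.l r) (K.last r) : ℤ) : Λ) = _
  congr 1
  have hl : ((K.last r : ℕ) : ℤ) = K.l r - 1 := by
    have := K.l_pos r
    rw [last]
    simp only
    omega
  rw [blockDeg, hl, r.2]
  ring

end KRDatum

/-! ### The action of the preprojective algebra on a representation -/

theorem blk_pow (i : I) (A : Matrix (V.Basis i) (V.Basis i) ℂ) (n : ℕ) (j : I)
    (B : Matrix (V.Basis i) (V.Basis j) ℂ) : blk i i A ^ n * blk i j B = blk i j (A ^ n * B) := by
  induction n with
  | zero => simp
  | succ n ih => rw [pow_succ', Matrix.mul_assoc, ih, blk_mul_blk, pow_succ', Matrix.mul_assoc]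

theorem mul_blk_pow (i : I) (A : Matrix (V.Basis i) (V.Basis i) ℂ) (n : ℕ) (j : I)
    (B : Matrix (V.Basis j) (V.Basis i) ℂ) : blk j i B * blk i i A ^ n = blk j i (B * A ^ n) := by
  induction n with
  | zero => simp
  | succ n ih => rw [pow_succ, ← Matrix.mul_assoc, ih, blk_mul_blk, pow_succ, Matrix.mul_assoc]

/-- If the cyclic derivatives vanish, then the relations of the preprojective algebra hold. -/
theorem exists_algHom {x : Rep D V W} (h1 : ∀ i j, derivα D x.1 i j = 0)
    (h2 : ∀ i, derivε D x.1 i = 0) :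
    ∃ ρ : Preproj D →ₐ[ℂ] Matrix (Tot V) (Tot V) ℂ, ∀ w, ρ (word w) = wordMat x.1 w := by
  have hx := mem_rep_iff.1 x.2
  have hL : ∀ g : Gen I, FreeAlgebra.lift ℂ (opMat x.1) g.free = opMat x.1 g :=
    fun g => FreeAlgebra.lift_ι_apply _ _
  have hrel : ∀ ⦃p q⦄, Relation D p q →
      FreeAlgebra.lift ℂ (opMat x.1) p = FreeAlgebra.lift ℂ (opMat x.1) q := by
    generalize FreeAlgebra.lift ℂ (opMat x.1) = L at hL
    intro p q h
    cases h with
    | e_mul_self i => simp only [map_mul, hL, opMat, blk_mul_blk, Matrix.one_mul]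
    | e_mul_of_ne i j h => simp only [map_mul, hL, opMat, map_zero, blk_mul_blk_of_ne h]
    | sum_e => simp only [map_sum, hL, opMat, map_one]; exact diag_one
    | e_mul_ε i => simp only [map_mul, hL, opMat, blk_mul_blk, Matrix.one_mul]
    | ε_mul_e i => simp only [map_mul, hL, opMat, blk_mul_blk, Matrix.mul_one]
    | e_mul_α i j => simp only [map_mul, hL, opMat, blk_mul_blk, Matrix.one_mul]
    | α_mul_e i j => simp only [map_mul, hL, opMat, blk_mul_blk, Matrix.mul_one]
    | no_arrow i j h => simp only [hL, opMat, map_zero, (hx.1 i j).2 h, blk_zero]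
    | deriv_α i j h =>
      simp only [map_mul, map_pow, hL, opMat, blk_pow, mul_blk_pow]
      congr 1
      exact sub_eq_zero.1 ((smul_eq_zero.1 (h1 i j)).resolve_left (D.sign_ne_zero h))
    | deriv_ε i =>
      simp only [map_sum, map_smul, map_mul, map_pow, map_zero, hL, opMat, blk_pow, mul_blk_pow,
        blk_mul_blk, ← blk_smul, ← blk_sum]
      rw [← blk_zero, ← h2 i]
      rfl
  let ρ : Preproj D →ₐ[ℂ] Matrix (Tot V) (Tot V) ℂ :=
    RingQuot.liftAlgHom ℂ ⟨FreeAlgebra.lift ℂ (opMat x.1), hrel⟩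
  have hρ : ∀ g, ρ (gen D g) = opMat x.1 g := by
    intro g
    change RingQuot.liftAlgHom ℂ _ (RingQuot.mkAlgHom ℂ (Relation D) g.free) = _
    rw [RingQuot.liftAlgHom_mkAlgHom_apply]
    exact hL g
  refine ⟨ρ, fun w => ?_⟩
  rw [word, map_list_prod, List.map_map, wordMat]
  congr 2
  exact funext hρ

namespace KRDatum

variable (K : KRDatum D)

/-- The stable representations which solve the equations of the critical points with `a* = 0`. These
are the representatives of the points of the critical locus in the central fiber. -/
structure IsPoint (x : Rep D V (K.W Λ)) : Prop where
  stable : Stable D x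
  a' : ∀ i, x.1.a' i = 0
  derivα : ∀ i j, derivα D x.1 i j = 0
  derivε : ∀ i, derivε D x.1 i = 0
  a_mul_ε : ∀ i, x.1.a i * x.1.ε i = K.gamma Λ i * x.1.a i

/-- The framing maps, on the total space. -/
def framing (x : Tuple V W) (i : I) : Matrix (W.Basis i) (Tot V) ℂ :=
  x.a i * (inc V i).transpose

namespace IsPoint

variable {K} {x : Rep D V (K.W Λ)} (hx : K.IsPoint x)

/-- The action of the preprojective algebra on the total space of a critical point. -/
def rho : Preproj D →ₐ[ℂ] Matrix (Tot V) (Tot V) ℂ := (exists_algHom hx.derivα hx.derivε).choose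

theorem rho_word (w : List (Gen I)) : hx.rho (word w) = wordMat x.1 w :=
  (exists_algHom hx.derivα hx.derivε).choose_spec w

theorem rho_gen (g : Gen I) : hx.rho (gen D g) = opMat x.1 g := by
  simpa [word, wordMat] using hx.rho_word [g]

theorem framing_mul_ε_pow (i : I) (k : ℕ) :
    framing x.1 i * hx.rho (gen D (.ε i) ^ k) = K.gamma Λ i ^ k * framing x.1 i := by
  induction k with
  | zero => simp
  | succ k ih =>
    rw [pow_succ, map_mul, ← Matrix.mul_assoc, ih, hx.rho_gen, Matrix.mul_assoc, pow_succ,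
      Matrix.mul_assoc (K.gamma Λ i ^ k)]
    congr 1
    rw [framing, opMat, blk, Matrix.mul_assoc, ← Matrix.mul_assoc (inc V i).transpose,
      ← Matrix.mul_assoc (inc V i).transpose, transpose_inc_mul_inc, Matrix.one_mul,
      ← Matrix.mul_assoc, hx.a_mul_ε, Matrix.mul_assoc]

theorem framing_mul_e (i : I) : framing x.1 i * hx.rho (gen D (.e i)) = framing x.1 i := by
  rw [hx.rho_gen, framing, opMat, blk, Matrix.mul_one, Matrix.mul_assoc, ← Matrix.mul_assoc
    (inc V i).transpose, transpose_inc_mul_inc, Matrix.one_mul]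

theorem coef_mul_framing {i : I} (r : {r : Fin K.s // K.i r = i}) (m : Fin (K.l r))
    (M : Matrix (Tot V) (Tot V) ℂ) (b : Tot V) :
    K.coef r m * (framing x.1 i * M) (K.idx r m) b =
      (framing x.1 i * (hx.rho (gen D (.ε i) ^ (m.rev : ℕ)) * M)) (K.idx r (K.last r)) b := by
  rw [← K.gamma_pow_rev_mul, ← Matrix.mul_assoc, ← Matrix.mul_assoc, framing_mul_ε_pow]

/-- The linear forms on `Π` which are the matrix coefficients of the action on a critical point,
with respect to the components of highest degree of the framing. The `r`-th one vanishes on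
`Π ε ^ l`, since `a ε = γ a` and `γ_r ^ l = 0`. Hence it belongs to the `r`-th summand of `K_γ`. -/
theorem exists_frame : ∃ f : Tot V → K.KGamma, ∀ b r p, K.ev r (f b) p =
    (framing x.1 (K.i r) * hx.rho (transp p)) (K.idx ⟨r, rfl⟩ (K.last r)) b := by
  have key : ∀ b r, ∃ φ : DualModule D (K.i r) (K.l r), ∀ p, DualModule.ev D (K.i r) (K.l r) φ p =
      (framing x.1 (K.i r) * hx.rho (transp p)) (K.idx ⟨r, rfl⟩ (K.last r)) b := by
    intro b r
    let ξ : Preproj D →ₗ[ℂ] ℂ :=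
      { toFun := fun p => (framing x.1 (K.i r) * hx.rho (transp p)) (K.idx ⟨r, rfl⟩ (K.last r)) b
        map_add' := fun p q => by rw [map_add, map_add, Matrix.mul_add]; rfl
        map_smul' := fun c p => by rw [map_smul, map_smul, Matrix.mul_smul]; rfl }
    have h1 : ∀ p, ξ (p * gen D (.ε (K.i r)) ^ K.l r) = 0 := by
      intro p
      change (framing x.1 (K.i r) * hx.rho (transp (p * gen D (.ε (K.i r)) ^ K.l r)))
        (K.idx ⟨r, rfl⟩ (K.last r)) b = 0
      rw [transp_mul, transp_pow, transp_gen, Gen.swap, map_mul, ← Matrix.mul_assoc,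
        framing_mul_ε_pow, Matrix.mul_assoc]
      exact K.gamma_pow_l_mul _ ⟨r, rfl⟩ _ _
    have h2 : ∀ p, ξ (p * gen D (.e (K.i r))) = ξ p := by
      intro p
      change (framing x.1 (K.i r) * hx.rho (transp (p * gen D (.e (K.i r)))))
        (K.idx ⟨r, rfl⟩ (K.last r)) b = _
      rw [transp_mul, transp_gen, Gen.swap, map_mul, ← Matrix.mul_assoc, framing_mul_e]
      rfl
    obtain ⟨φ, hφ⟩ := DualModule.exists_ev_eq ξ h1 h2
    exact ⟨φ, fun p => LinearMap.congr_fun hφ p⟩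
  choose f hf using key
  exact ⟨f, hf⟩

/-- The frame of `K_γ` attached to a critical point. -/
def frame : Tot V → K.KGamma := hx.exists_frame.choose

theorem ev_frame (b : Tot V) (r : Fin K.s) (p : Preproj D) : K.ev r (hx.frame b) p =
    (framing x.1 (K.i r) * hx.rho (transp p)) (K.idx ⟨r, rfl⟩ (K.last r)) b :=
  hx.exists_frame.choose_spec b r p

end IsPoint

theorem ext_ev {φ ψ : K.KGamma} (h : ∀ r p, K.ev r φ p = K.ev r ψ p) : φ = ψ :=
  funext fun r => DualModule.ext_ev (h r)

theorem ev_smul (r : Fin K.s) (p q : Preproj D) (φ : K.KGamma) :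
    K.ev r (p • φ) q = K.ev r φ (transp p * q) :=
  DualModule.ev_smul p (φ r) q

theorem ev_mul_e (r : Fin K.s) (φ : K.KGamma) (p : Preproj D) :
    K.ev r φ (p * gen D (.e (K.i r))) = K.ev r φ p :=
  DualModule.ev_mul_e (φ r) p

theorem ev_comb {κ : Type*} [Fintype κ] (r : Fin K.s) (f : Tot V → K.KGamma) (M : Matrix (Tot V) κ ℂ) (b : κ)
    (p : Preproj D) : K.ev r (comb f M b) p = ∑ c, M c b * K.ev r (f c) p := by
  rw [map_comb, LinearMap.sum_apply]
  rfl

theorem mem_component_iff {j : I} {k : Λ} {φ : K.KGamma} : φ ∈ K.component j k ↔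
    gen D (.e j) • φ = φ ∧ ∀ r (w : List (Gen I)), (((w.map (Gen.deg D)).sum : ℤ) : Λ) ≠
      ((K.k r + K.l r * D.d (K.i r) : ℤ) : Λ) - k → K.ev r φ (word w) = 0 := by
  simp only [component, Submodule.mem_pi, Set.mem_univ, true_imp_iff, DualModule.mem_component_iff]
  exact ⟨fun h => ⟨funext fun r => (h r).1, fun r => (h r).2⟩,
    fun h r => ⟨congrFun h.1 r, h.2 r⟩⟩

namespace IsPoint

variable {K} {x : Rep D V (K.W Λ)} (hx : K.IsPoint x)

theorem smul_frame (p : Preproj D) (b : Tot V) :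
    p • hx.frame b = comb hx.frame (hx.rho p) b := by
  refine K.ext_ev fun r q => ?_
  rw [K.ev_smul, hx.ev_frame, transp_mul, transp_transp, map_mul, ← Matrix.mul_assoc,
    Matrix.mul_apply, K.ev_comb]
  exact Finset.sum_congr rfl fun c _ => by rw [hx.ev_frame, mul_comm]

theorem frame_mem_component (b : Tot V) : hx.frame b ∈ K.component b.1 (totDeg V b) := by
  refine K.mem_component_iff.2 ⟨?_, fun r w hw => ?_⟩
  · rw [hx.smul_frame, hx.rho_gen, opMat, blk, Matrix.mul_one]
    conv_rhs => rw [← comb_one hx.frame]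
    simp only [comb]
    refine Finset.sum_congr rfl fun c _ => ?_
    congr 1
    rw [← sum_inc_mul, Matrix.sum_apply, Finset.sum_eq_single b.1]
    · intro j _ hj
      rw [Matrix.mul_apply]
      refine Finset.sum_eq_zero fun b' _ => ?_
      have : (inc V j).transpose b' b = 0 :=
        Matrix.one_apply_ne fun h => hj (congrArg Sigma.fst h).symm
      rw [this, mul_zero]
    · simp
  · rw [hx.ev_frame, transp_word, hx.rho_word]
    by_contra h
    refine hw ?_
    have hom := ((((mem_rep_iff.1 x.2).2.2.1 (K.i r)).mul (homog_inc (K.i r)).transpose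
      rfl).mul (homog_wordMat x (w.map Gen.swap).reverse) rfl) _ _ h
    rw [K.deg_last, List.map_reverse, List.sum_reverse, List.map_map] at hom
    have e : (w.map (Gen.deg D ∘ Gen.swap)) = w.map (Gen.deg D) :=
      List.map_congr_left fun g _ => deg_swap g
    rw [e, neg_zero, add_zero, Int.cast_sub, Int.cast_neg] at hom
    rw [eq_sub_iff_add_eq, ← sub_left_inj (a := ((D.d (K.i r) : ℤ) : Λ)), hom]
    abel

/-- A linear relation between the vectors of the frame gives a vector of `V` which is killed by all
paths to the framing, since the components of `a` of highest degree determine the other ones. -/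
theorem linearIndependent_frame : LinearIndependent ℂ hx.frame := by
  refine Fintype.linearIndependent_iff.2 fun u hu => ?_
  have key : ∀ r p, (framing x.1 (K.i r) * hx.rho p).mulVec u (K.idx ⟨r, rfl⟩ (K.last r)) = 0 := by
    intro r p
    have h := congrArg (fun φ => K.ev r φ (transp p)) hu
    simp only [map_sum, map_smul, LinearMap.sum_apply, LinearMap.smul_apply, hx.ev_frame,
      transp_transp, map_zero, LinearMap.zero_apply, smul_eq_mul] at h
    refine Eq.trans ?_ h
    exact Finset.sum_congr rfl fun c _ => mul_comm _ _
  have hrow : ∀ j p, (framing x.1 j * hx.rho p).mulVec u = 0 := by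
    intro j p
    funext ⟨⟨r, hr⟩, m⟩
    subst hr
    have h := key r (gen D (.ε (K.i r)) ^ (m.rev : ℕ) * p)
    rw [map_mul] at h
    replace h : ∑ c, _ * u c = 0 := h
    simp only [← hx.coef_mul_framing ⟨r, rfl⟩ m, mul_assoc] at h
    rw [← Finset.mul_sum] at h
    exact (mul_eq_zero.1 h).resolve_left (K.coef_ne_zero r m)
  have hzero : ∀ i, (inc V i).transpose.mulVec u = 0 := by
    intro i
    refine hx.stable.eq_zero fun w j => ?_
    have h := hrow j (word w * gen D (.e i))
    rw [map_mul, hx.rho_word, hx.rho_gen, opMat, blk, Matrix.mul_one, framing] at h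
    rw [Matrix.mulVec_mulVec]
    simpa only [Matrix.mul_assoc] using h
  rintro ⟨i, b⟩
  have h := congrFun (hzero i) b
  have e := transpose_inc_mul i (Matrix.replicateCol Unit u)
  rw [← Matrix.replicateCol_mulVec] at e
  have := congrFun (congrFun e b) ()
  simp only [Matrix.replicateCol_apply, Matrix.submatrix_apply, id] at this
  rw [← this, h]
  rfl

end IsPoint

end KRDatum

end

section

variable {I : Type*} [Fintype I] [DecidableEq I] {D : CartanDatum I}
variable {Λ : Type} [AddCommGroupWithOne Λ] {V : GradedSpace I Λ}

open Preproj

namespace KRDatum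

variable (K : KRDatum D)

/-! ### The grading of `K_γ` -/

/-- The elements of degree `k` of `K_γ`, without a condition on the vertex. -/
def HasDeg (k : Λ) (φ : K.KGamma) : Prop :=
  ∀ r (w : List (Gen I)), (((w.map (Gen.deg D)).sum : ℤ) : Λ) ≠
    ((K.k r + K.l r * D.d (K.i r) : ℤ) : Λ) - k → K.ev r φ (word w) = 0

variable {K}

theorem HasDeg.gen_smul {k : Λ} {φ : K.KGamma} (h : K.HasDeg k φ) (g : Gen I) :
    K.HasDeg (k + (g.deg D : ℤ)) (gen D g • φ) := by
  intro r w hw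
  rw [K.ev_smul, transp_gen, ← word_cons]
  refine h r _ fun h' => hw ?_
  rw [List.map_cons, List.sum_cons, deg_swap, Int.cast_add] at h'
  rw [← sub_sub, ← h', add_sub_cancel_left]

/-- The components of the grading are independent: a sum of homogeneous elements, which is
homogeneous of degree `k`, is the sum of its terms of degree `k`. -/
theorem HasDeg.sum_eq {ι : Type*} [Fintype ι] {φ : ι → K.KGamma} {s : ι → Λ}
    (h : ∀ c, K.HasDeg (s c) (φ c)) {ψ : K.KGamma} {k : Λ} (hψ : K.HasDeg k ψ)
    (hsum : ∑ c, φ c = ψ) : (open Classical in ∑ c, if s c = k then φ c else 0) = ψ := by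
  classical
  refine K.ext_ev fun r p => ?_
  refine LinearMap.congr_fun (linearMap_ext (f := K.ev r _) (g := K.ev r ψ) fun w => ?_) p
  rw [map_sum, LinearMap.sum_apply]
  by_cases hw : (((w.map (Gen.deg D)).sum : ℤ) : Λ) =
      ((K.k r + K.l r * D.d (K.i r) : ℤ) : Λ) - k
  · rw [← hsum, map_sum, LinearMap.sum_apply]
    refine Finset.sum_congr rfl fun c _ => ?_
    split_ifs with hc
    · rfl
    · rw [map_zero, LinearMap.zero_apply, h c r w]
      rw [hw]
      exact fun h' => hc (sub_right_inj.1 h').symm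
  · rw [hψ r w hw]
    refine Finset.sum_eq_zero fun c _ => ?_
    split_ifs with hc
    · exact h c r w (hc ▸ hw)
    · rw [map_zero, LinearMap.zero_apply]

theorem mem_component_iff_hasDeg {j : I} {k : Λ} {φ : K.KGamma} :
    φ ∈ K.component j k ↔ gen D (.e j) • φ = φ ∧ K.HasDeg k φ :=
  K.mem_component_iff

/-- The matrix of a family of homogeneous vectors with respect to linearly independent homogeneous
vectors is homogeneous. -/
theorem homog_of_comb_eq {ι κ : Type*} [Fintype ι] [Fintype κ] {s : ι → Λ} {t : κ → Λ} {δ : Λ}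
    {f : ι → K.KGamma} (hf : LinearIndependent ℂ f) (hs : ∀ c, K.HasDeg (s c) (f c))
    {u : κ → K.KGamma} (hu : ∀ b, K.HasDeg (t b + δ) (u b)) {M : Matrix ι κ ℂ}
    (hM : comb f M = u) : Homog s t δ M := by
  classical
  intro c b hcb
  by_contra hne
  have h1 := HasDeg.sum_eq (φ := fun c => M c b • f c) (s := s) (fun c r w hw => by
    rw [map_smul, LinearMap.smul_apply, hs c r w hw, smul_zero]) (hu b) (congrFun hM b)
  let M' : Matrix ι Unit ℂ := fun c _ => if s c = t b + δ then M c b else 0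
  let M'' : Matrix ι Unit ℂ := fun c _ => M c b
  have h2 : comb f M' = comb f M'' := by
    funext _
    change ∑ c, (if s c = t b + δ then M c b else 0) • f c = ∑ c, M c b • f c
    refine Eq.trans (Finset.sum_congr rfl fun c _ => ?_) (h1.trans (congrFun hM b).symm)
    split_ifs <;> simp
  have h3 : M' c () = M'' c () := congrFun (congrFun (comb_injective hf h2) c) ()
  change (if s c = t b + δ then M c b else 0) = M c b at h3
  rw [if_neg hne] at h3
  exact hcb h3.symm

/-! ### Frames -/

variable (K) in
/-- The frames of `K_γ`, as families indexed by the basis of the total space. -/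
structure IsFrame (f : Tot V → K.KGamma) : Prop where
  mem : ∀ b, f b ∈ K.component b.1 (totDeg V b)
  linearIndependent : LinearIndependent ℂ f
  smul_mem : ∀ (p : Preproj D), ∀ u ∈ Submodule.span ℂ (Set.range f),
    p • u ∈ Submodule.span ℂ (Set.range f)

theorem mem_frames_iff {f : ∀ i, V.Basis i → K.KGamma} :
    f ∈ K.frames V ↔ K.IsFrame (fun b : Tot V => f b.1 b.2) :=
  ⟨fun h => ⟨fun b => h.1 b.1 b.2, h.2.1, h.2.2⟩,
    fun h => ⟨fun i b => h.mem ⟨i, b⟩, h.linearIndependent, h.smul_mem⟩⟩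

theorem IsPoint.isFrame_frame {x : Rep D V (K.W Λ)} (hx : K.IsPoint x) : K.IsFrame hx.frame where
  mem := hx.frame_mem_component
  linearIndependent := hx.linearIndependent_frame
  smul_mem p u hu := by
    induction hu using Submodule.span_induction with
    | mem u hu =>
      obtain ⟨b, rfl⟩ := hu
      rw [hx.smul_frame]
      exact comb_mem_span _ _ _
    | zero => simp
    | add u v _ _ h h' => rw [smul_add]; exact add_mem h h'
    | smul c u _ h => rw [smul_comm]; exact Submodule.smul_mem _ c h

theorem e_smul_of_ne {i j : I} (h : i ≠ j) {k : Λ} {φ : K.KGamma} (hφ : φ ∈ K.component j k) :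
    gen D (.e i) • φ = 0 := by
  rw [← (mem_component_iff_hasDeg.1 hφ).1, smul_smul, e_mul_of_ne h, zero_smul]

theorem comb_blk_one {f : Tot V → K.KGamma} (hf : ∀ b, f b ∈ K.component b.1 (totDeg V b))
    (i : I) (b : Tot V) : comb f (blk i i 1) b = gen D (.e i) • f b := by
  obtain ⟨j, b⟩ := b
  have h1 : ∀ c, blk (V := V) i i 1 c ⟨j, b⟩ = (blk (V := V) i i 1 * inc V j) c b := by
    intro c
    rw [mul_inc]
    rfl
  simp only [comb, h1]
  by_cases h : i = j
  · subst h
    rw [blk_mul_inc, Matrix.mul_one, (mem_component_iff_hasDeg.1 (hf ⟨i, b⟩)).1]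
    simp [inc, Matrix.one_apply]
  · rw [blk_mul_inc_of_ne h, e_smul_of_ne h (hf ⟨j, b⟩)]
    simp

namespace IsFrame

variable {f : Tot V → K.KGamma}

theorem hasDeg (hf : K.IsFrame f) (b : Tot V) : K.HasDeg (totDeg V b) (f b) :=
  (mem_component_iff_hasDeg.1 (hf.mem b)).2

theorem exists_action (hf : K.IsFrame f) (p : Preproj D) : ∃ M : Matrix (Tot V) (Tot V) ℂ,
    comb f M = fun b => p • f b :=
  exists_comb_eq fun b => hf.smul_mem p _ (Submodule.subset_span ⟨b, rfl⟩)

theorem smul_comb {κ : Type*} [Fintype κ] {p : Preproj D} {M : Matrix (Tot V) (Tot V) ℂ}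
    (hM : comb f M = fun b => p • f b) (N : Matrix (Tot V) κ ℂ) (b : κ) :
    p • comb f N b = comb f (M * N) b := by
  rw [← comb_comb, hM]
  simp only [comb, Finset.smul_sum]
  exact Finset.sum_congr rfl fun c _ => smul_comm _ _ _

/-- The action of the preprojective algebra on the span of a frame. -/
def action (hf : K.IsFrame f) : Preproj D →ₐ[ℂ] Matrix (Tot V) (Tot V) ℂ :=
  AlgHom.ofLinearMap
    { toFun := fun p => (hf.exists_action p).choose
      map_add' := fun p q => comb_injective hf.linearIndependent (by
        rw [comb_add, (hf.exists_action _).choose_spec, (hf.exists_action _).choose_spec,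
          (hf.exists_action _).choose_spec]
        exact funext fun b => add_smul p q (f b))
      map_smul' := fun c p => comb_injective hf.linearIndependent (by
        rw [RingHom.id_apply, comb_smul, (hf.exists_action _).choose_spec,
          (hf.exists_action _).choose_spec]
        exact funext fun b => smul_assoc c p (f b)) }
    (comb_injective hf.linearIndependent (by
      refine (hf.exists_action _).choose_spec.trans ?_
      rw [comb_one]
      exact funext fun b => one_smul _ (f b)))
    fun p q => comb_injective hf.linearIndependent (by
      refine (hf.exists_action _).choose_spec.trans (funext fun b => ?_)
      refine Eq.trans ?_ (smul_comb (hf.exists_action p).choose_spec _ b)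
      exact (mul_smul p q (f b)).trans
        (congrArg (p • ·) (congrFun (hf.exists_action q).choose_spec b).symm))

theorem comb_action (hf : K.IsFrame f) (p : Preproj D) :
    comb f (hf.action p) = fun b => p • f b :=
  (hf.exists_action p).choose_spec

theorem action_e (hf : K.IsFrame f) (i : I) : hf.action (gen D (.e i)) = blk i i 1 := by
  refine comb_injective hf.linearIndependent ?_
  rw [comb_action]
  exact (funext fun b => (comb_blk_one hf.mem i b).symm)

theorem homog_action (hf : K.IsFrame f) (g : Gen I) :
    Homog (totDeg V) (totDeg V) ((g.deg D : ℤ) : Λ) (hf.action (gen D g)) :=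
  homog_of_comb_eq hf.linearIndependent hf.hasDeg (fun b => (hf.hasDeg b).gen_smul g)
    (hf.comb_action _)

/-! ### The representation attached to a frame -/

/-- The maps of the representation attached to a frame. The component of index `m` of `W_r` of the
map `a` is given by the value at `ε ^ (l - 1 - m)` of the linear form of index `r`. -/
def tuple (hf : K.IsFrame f) : Tuple V (K.W Λ) :=
  (fun i j => (inc V i).transpose * hf.action (gen D (.α i j)) * inc V j,
    fun i => (inc V i).transpose * hf.action (gen D (.ε i)) * inc V i,
    fun i (w : Σ r : {r : Fin K.s // K.i r = i}, Fin (K.l r)) b =>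
      (K.coef w.1 w.2)⁻¹ * K.ev w.1 (f ⟨i, b⟩) (gen D (.ε i) ^ (w.2.rev : ℕ)),
    fun _ => 0)

theorem action_α (hf : K.IsFrame f) (i j : I) :
    hf.action (gen D (.α i j)) = blk i j (hf.tuple.α i j) := by
  refine eq_blk ?_ ?_
  · rw [← hf.action_e, ← map_mul, e_mul_α]
  · rw [← hf.action_e, ← map_mul, α_mul_e]

theorem action_ε (hf : K.IsFrame f) (i : I) :
    hf.action (gen D (.ε i)) = blk i i (hf.tuple.ε i) := by
  refine eq_blk ?_ ?_
  · rw [← hf.action_e, ← map_mul, e_mul_ε]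
  · rw [← hf.action_e, ← map_mul, ε_mul_e]

theorem action_gen (hf : K.IsFrame f) (g : Gen I) :
    hf.action (gen D g) = opMat hf.tuple g := by
  cases g with
  | e i => exact hf.action_e i
  | ε i => exact hf.action_ε i
  | α i j => exact hf.action_α i j

theorem action_word (hf : K.IsFrame f) (w : List (Gen I)) :
    hf.action (word w) = wordMat hf.tuple w := by
  rw [word, map_list_prod, List.map_map, wordMat]
  congr 2
  exact funext hf.action_gen

theorem tuple_mem (hf : K.IsFrame f) : hf.tuple ∈ Rep D V (K.W Λ) := by
  refine mem_rep_iff.2 ⟨fun i j => ⟨?_, fun hc => ?_⟩, fun i => ?_, fun i => ?_, fun i => .zero _⟩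
  · exact ((homog_inc i).transpose.mul (hf.homog_action (.α i j)) rfl).mul (homog_inc j)
      (by rw [neg_zero, zero_add, add_zero]; rfl)
  · change (inc V i).transpose * hf.action (gen D (.α i j)) * inc V j = 0
    rw [no_arrow hc, map_zero, Matrix.mul_zero, Matrix.zero_mul]
  · exact ((homog_inc i).transpose.mul (hf.homog_action (.ε i)) rfl).mul (homog_inc i)
      (by rw [neg_zero, zero_add, add_zero]; rfl)
  · rintro ⟨r, m⟩ b h
    have h1 : K.ev r (f ⟨i, b⟩) (gen D (.ε i) ^ (m.rev : ℕ)) ≠ 0 := right_ne_zero_of_mul h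
    rw [← word_replicate] at h1
    have h2 := not_imp_comm.1 (hf.hasDeg ⟨i, b⟩ r _) h1
    rw [eq_sub_iff_add_eq, ← eq_sub_iff_add_eq', ← Int.cast_sub] at h2
    change ((blockDeg D (K.i r) (K.k r) (K.l r) m : ℤ) : Λ) = V.deg i b + _
    change V.deg i b = _ at h2
    rw [h2, ← Int.cast_add]
    congr 1
    have hm := m.2
    have h3 : ((m.rev : ℕ) : ℤ) = K.l r - 1 - m := by
      rw [Fin.val_rev]
      omega
    rw [blockDeg, List.map_replicate, List.sum_replicate, nsmul_eq_mul, h3, r.2, Gen.deg]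
    ring

/-- The representation attached to a frame. -/
def point (hf : K.IsFrame f) : Rep D V (K.W Λ) := ⟨hf.tuple, hf.tuple_mem⟩

theorem framing_idx (hf : K.IsFrame f) {i : I} (r : {r : Fin K.s // K.i r = i})
    (m : Fin (K.l r)) (b : Tot V) : K.coef r m * framing hf.tuple i (K.idx r m) b =
      K.ev r (f b) (gen D (.ε i) ^ (m.rev : ℕ) * gen D (.e i)) := by
  obtain ⟨j, b⟩ := b
  have h1 : framing hf.tuple i (K.idx r m) ⟨j, b⟩ =
      (hf.tuple.a i * ((inc V i).transpose * inc V j)) (K.idx r m) b := by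
    rw [← Matrix.mul_assoc, mul_inc]
    rfl
  rw [h1]
  by_cases h : i = j
  · subst h
    obtain ⟨r, rfl⟩ := r
    rw [transpose_inc_mul_inc, Matrix.mul_one, K.ev_mul_e]
    exact mul_inv_cancel_left₀ (K.coef_ne_zero _ _) _
  · rw [transpose_inc_mul_inc_of_ne h, Matrix.mul_zero, Matrix.zero_apply, mul_zero]
    have h2 := K.ev_smul r (gen D (.e i) * gen D (.ε i) ^ (m.rev : ℕ)) 1 (f ⟨j, b⟩)
    rw [mul_one, transp_mul, transp_pow, transp_gen, transp_gen, Gen.swap, Gen.swap] at h2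
    rw [← h2, e_mul_ε_pow, mul_smul, e_smul_of_ne h (hf.mem ⟨j, b⟩), smul_zero, map_zero,
      LinearMap.zero_apply]

/-- The framing maps, in the components of highest degree, are the values at `1` of the linear forms
in `K_γ`. -/
theorem framing_mul_last (hf : K.IsFrame f) {κ : Type*} [Fintype κ] (r : Fin K.s)
    (M : Matrix (Tot V) κ ℂ) (b : κ) :
    (framing hf.tuple (K.i r) * M) (K.idx ⟨r, rfl⟩ (K.last r)) b = K.ev r (comb f M b) 1 := by
  rw [Matrix.mul_apply, K.ev_comb]
  refine Finset.sum_congr rfl fun c _ => ?_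
  have h := hf.framing_idx ⟨r, rfl⟩ (K.last r) c
  have h0 : ((K.last r).rev : ℕ) = 0 := by
    have := K.l_pos r
    rw [Fin.val_rev]
    simp only [last]
    omega
  rw [K.coef_last, one_mul, h0, pow_zero, K.ev_mul_e] at h
  rw [h, mul_comm]

end IsFrame

end KRDatum

end

section

variable {I : Type*} [Fintype I] [DecidableEq I] {D : CartanDatum I}
variable {Λ : Type} [AddCommGroupWithOne Λ] {V : GradedSpace I Λ}

open Preproj

namespace KRDatum

variable {K : KRDatum D}

/-! ### The correspondence between critical points and frames -/

namespace IsFrame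

variable {f : Tot V → K.KGamma}

theorem derivα_point (hf : K.IsFrame f) (i j : I) : derivα D hf.point.1 i j = 0 := by
  by_cases hc : D.c i j < 0
  · have h := congrArg hf.action (deriv_α hc)
    simp only [map_mul, map_pow, hf.action_α, hf.action_ε, blk_pow, mul_blk_pow] at h
    rw [derivα]
    refine smul_eq_zero_of_right _ (sub_eq_zero.2 (blk_injective i j h))
  · rw [derivα, D.sign_eq_zero hc, zero_smul]

theorem derivε_point (hf : K.IsFrame f) (i : I) : derivε D hf.point.1 i = 0 := by
  have h := congrArg hf.action (deriv_ε i)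
  simp only [map_sum, map_smul, map_mul, map_pow, map_zero, hf.action_α, hf.action_ε, blk_pow,
    mul_blk_pow, blk_mul_blk, ← blk_smul, ← blk_sum] at h
  exact blk_injective i i (h.trans (blk_zero i i).symm)

theorem gamma_pow_mul_framing (hf : K.IsFrame f) {i : I} (r : {r : Fin K.s // K.i r = i}) (k : ℕ)
    (b : Tot V) : (K.gamma Λ i ^ k * framing hf.tuple i) (K.idx r (K.last r)) b =
      K.ev r (f b) (gen D (.ε i) ^ k * gen D (.e i)) := by
  by_cases hk : k < K.l r
  · obtain ⟨m, rfl⟩ : ∃ m : Fin (K.l r), (m.rev : ℕ) = k :=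
      ⟨(⟨k, hk⟩ : Fin (K.l r)).rev, by rw [Fin.rev_rev]⟩
    rw [K.gamma_pow_rev_mul, hf.framing_idx]
  · obtain ⟨r, rfl⟩ := r
    obtain ⟨n, rfl⟩ := Nat.exists_eq_add_of_le (not_lt.1 hk)
    rw [pow_add, Matrix.mul_assoc, K.gamma_pow_l_mul, K.ev_mul_e]
    have := DualModule.ev_mul_ε_pow_of_le (f b r) 1 (not_lt.1 hk)
    rw [one_mul] at this
    exact this.symm

/-- Multiplying the row of index `m` by the non-zero entry `coef r m` turns both sides into values of
linear forms at `ε ^ (l - m)`. -/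
theorem a_mul_ε_point (hf : K.IsFrame f) (i : I) :
    hf.point.1.a i * hf.point.1.ε i = K.gamma Λ i * hf.point.1.a i := by
  have key : framing hf.tuple i * hf.action (gen D (.ε i)) =
      K.gamma Λ i * framing hf.tuple i := by
    ext ⟨r, m⟩ b
    refine mul_left_cancel₀ (K.coef_ne_zero r m) ?_
    refine Eq.trans ?_ (K.gamma_pow_rev_mul (K.gamma Λ i * framing hf.tuple i) r m b)
    rw [← Matrix.mul_assoc, ← pow_succ, hf.gamma_pow_mul_framing]
    change K.coef r m * (framing hf.tuple i * hf.action (gen D (.ε i))) (K.idx r m) b = _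
    rw [Matrix.mul_apply, Finset.mul_sum]
    simp only [← mul_assoc, hf.framing_idx r m]
    obtain ⟨r, rfl⟩ := r
    simp only [K.ev_mul_e]
    have h := K.ev_comb r f (hf.action (gen D (.ε (K.i r)))) b (gen D (.ε (K.i r)) ^ (m.rev : ℕ))
    rw [hf.comb_action, K.ev_smul, transp_gen, Gen.swap, ← pow_succ'] at h
    rw [h]
    exact Finset.sum_congr rfl fun c _ => mul_comm _ _
  rw [framing, action_ε, Matrix.mul_assoc, blk, ← Matrix.mul_assoc (inc V i).transpose,
    ← Matrix.mul_assoc (inc V i).transpose, transpose_inc_mul_inc, Matrix.one_mul] at key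
  have h := congrArg (· * inc V i) key
  simp only [Matrix.mul_assoc, transpose_inc_mul_inc, Matrix.mul_one] at h
  exact h

/-- A subrepresentation which is killed by `a` gives a `Π`-submodule of the span of the frame, whose
linear forms vanish at `1`; so it is zero. -/
theorem stable_point (hf : K.IsFrame f) : Stable D hf.point := by
  intro S _ hα hε ha i
  have key : ∀ (w : List (Gen I)) (r : Fin K.s) (i : I), ∀ u ∈ S i,
      K.ev r (comb f (inc V i * Matrix.replicateCol Unit u) ()) (word w) = 0 := by
    intro w r
    induction w with
    | nil =>
      intro i u hu
      rw [word_nil, ← hf.framing_mul_last, framing]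
      by_cases h : K.i r = i
      · subst h
        rw [Matrix.mul_assoc, ← Matrix.mul_assoc _ (inc V _), transpose_inc_mul_inc,
          Matrix.one_mul, ← Matrix.replicateCol_mulVec]
        exact congrFun (ha _ u hu) _
      · rw [Matrix.mul_assoc, ← Matrix.mul_assoc _ (inc V _), transpose_inc_mul_inc_of_ne h,
          Matrix.zero_mul, Matrix.mul_zero, Matrix.zero_apply]
    | cons g w ih =>
      intro i u hu
      have hstep : ∀ (j : I) (k : I) (A : Matrix (V.Basis j) (V.Basis k) ℂ),
          hf.action (gen D g.swap) = blk j k A → (∀ u ∈ S k, A.mulVec u ∈ S j) →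
          K.ev r (comb f (inc V i * Matrix.replicateCol Unit u) ()) (word (g :: w)) = 0 := by
        intro j k A hA hS
        have h := K.ev_smul r (gen D g.swap) (word w)
          (comb f (inc V i * Matrix.replicateCol Unit u) ())
        rw [transp_gen, Gen.swap_swap, ← word_cons] at h
        rw [← h, smul_comb (hf.comb_action _), hA, ← Matrix.mul_assoc]
        by_cases hk : k = i
        · subst hk
          rw [blk_mul_inc, Matrix.mul_assoc, ← Matrix.replicateCol_mulVec]
          exact ih j _ (hS u hu)
        · rw [blk_mul_inc_of_ne hk, Matrix.zero_mul, comb_zero]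
          simp
      cases g with
      | e j => exact hstep j j 1 (hf.action_e j) fun u hu => by rwa [Matrix.one_mulVec]
      | ε j => exact hstep j j _ (hf.action_ε j) (hε j)
      | α j k => exact hstep k j _ (hf.action_α k j) (hα k j)
  refine (Submodule.eq_bot_iff _).2 fun u hu => ?_
  have h0 : comb f (inc V i * Matrix.replicateCol Unit u) () = 0 := by
    refine K.ext_ev fun r p => ?_
    refine LinearMap.congr_fun (linearMap_ext (f := K.ev r _) (g := K.ev r 0) fun w => ?_) p
    rw [key w r i u hu, map_zero, LinearMap.zero_apply]
  have h1 : inc V i * Matrix.replicateCol Unit u = 0 := by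
    refine comb_injective hf.linearIndependent ?_
    rw [comb_zero]
    exact funext fun _ => h0
  have h2 := congrArg ((inc V i).transpose * ·) h1
  simp only [← Matrix.mul_assoc, transpose_inc_mul_inc, Matrix.one_mul, Matrix.mul_zero] at h2
  funext b
  exact congrFun (congrFun h2 b) ()

theorem isPoint (hf : K.IsFrame f) : K.IsPoint hf.point where
  stable := hf.stable_point
  a' _ := rfl
  derivα := hf.derivα_point
  derivε := hf.derivε_point
  a_mul_ε := hf.a_mul_ε_point

theorem frame_isPoint (hf : K.IsFrame f) : hf.isPoint.frame = f := by
  have hρ : ∀ p, hf.isPoint.rho p = hf.action p := by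
    intro p
    refine LinearMap.congr_fun (linearMap_ext (f := hf.isPoint.rho.toLinearMap)
      (g := hf.action.toLinearMap) fun w => ?_) p
    exact (hf.isPoint.rho_word w).trans (hf.action_word w).symm
  funext b
  refine K.ext_ev fun r p => ?_
  rw [hf.isPoint.ev_frame, hρ]
  refine (hf.framing_mul_last r _ b).trans ?_
  rw [hf.comb_action, K.ev_smul, transp_transp, mul_one]

end IsFrame

namespace IsPoint

variable {x y : Rep D V (K.W Λ)}

/-- A critical point is determined by its frame. -/
theorem eq_of_frame_eq (hx : K.IsPoint x) (hy : K.IsPoint y) (h : hx.frame = hy.frame) :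
    x = y := by
  have hρ : ∀ p, hx.rho p = hy.rho p := by
    intro p
    refine comb_injective hx.linearIndependent_frame (funext fun b => ?_)
    rw [← hx.smul_frame, h, hy.smul_frame]
  have hop : ∀ g, opMat x.1 g = opMat y.1 g := by
    intro g
    rw [← hx.rho_gen, ← hy.rho_gen, hρ]
  have hF : ∀ i, framing x.1 i = framing y.1 i := by
    intro i
    ext ⟨r, m⟩ b
    obtain ⟨r, rfl⟩ := r
    refine mul_left_cancel₀ (K.coef_ne_zero r m) ?_
    have h1 := hx.coef_mul_framing ⟨r, rfl⟩ m 1 b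
    have h2 := hy.coef_mul_framing ⟨r, rfl⟩ m 1 b
    have h3 := hx.ev_frame b r (transp (gen D (.ε (K.i r)) ^ (m.rev : ℕ)))
    rw [h, hy.ev_frame, transp_transp] at h3
    rw [Matrix.mul_one, Matrix.mul_one] at h1 h2
    exact (h1.trans h3.symm).trans h2.symm
  refine rep_ext (fun i j => blk_injective i j (hop (.α i j)))
    (fun i => blk_injective i i (hop (.ε i))) (fun i => ?_) fun i => (hx.a' i).trans (hy.a' i).symm
  have h4 := congrArg (· * inc V i) (hF i)
  simpa only [framing, Matrix.mul_assoc, transpose_inc_mul_inc, Matrix.mul_one] using h4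

theorem frame_gaugeAct (hx : K.IsPoint x) (g : gaugeGroup V) (hy : K.IsPoint (gaugeAct g x)) :
    hy.frame = comb hx.frame (diag fun i => (g.1 i)⁻¹.val) := by
  funext b
  refine K.ext_ev fun r p => ?_
  have hρ : hy.rho (transp p) = diag (fun i => (g.1 i).val) * hx.rho (transp p) *
      diag (fun i => (g.1 i)⁻¹.val) := by
    refine word_induction (P := fun p => hy.rho p = diag (fun i => (g.1 i).val) * hx.rho p *
      diag (fun i => (g.1 i)⁻¹.val)) (transp p) (fun w => ?_) ?_ (fun p q hp hq => ?_)
      fun c p hp => ?_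
    · rw [hy.rho_word, hx.rho_word, wordMat_gaugeAct]
    · simp
    · rw [map_add, map_add, hp, hq, mul_add, add_mul]
    · rw [map_smul, map_smul, hp, Matrix.mul_smul, Matrix.smul_mul]
  have hF : framing (gaugeAct g x).1 (K.i r) * diag (fun i => (g.1 i).val) =
      framing x.1 (K.i r) := by
    rw [framing, Matrix.mul_assoc, transpose_inc_mul_diag, ← Matrix.mul_assoc]
    change x.1.a _ * (g.1 _)⁻¹.val * (g.1 _).val * _ = _
    rw [Matrix.mul_assoc (x.1.a _), Units.inv_mul, Matrix.mul_one]
    rfl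
  rw [hy.ev_frame, hρ, ← Matrix.mul_assoc, ← Matrix.mul_assoc, hF, Matrix.mul_apply, K.ev_comb]
  exact Finset.sum_congr rfl fun c _ => by rw [hx.ev_frame, mul_comm]

end IsPoint

/-- The solutions are in the central fiber, since the action of `Π` on `K_γ`, hence on the span of the
frame of a solution, is nilpotent. -/
theorem mk_mem_criticalFiber_iff {x : {x : Rep D V (K.W Λ) // Stable D x}} :
    Quotient.mk (orbitSetoid D V (K.W Λ)) x ∈ K.criticalFiber V ↔ K.IsPoint x.1 := by
  refine (and_congr (mk_mem_criticalLocus_iff.trans (critical_iff K.homog_gamma x.1))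
    mk_mem_centralFiber_iff).trans ?_
  constructor
  · rintro ⟨⟨h1, h2, -, h4⟩, h⟩
    have ha' := a'_eq_zero x.2 h
    refine ⟨x.2, ha', h1, fun i => ?_, fun i => sub_eq_zero.1 (h4 i)⟩
    have := h2 i
    rwa [ha', Matrix.zero_mul, add_zero] at this
  · intro hx
    refine ⟨⟨hx.derivα, fun i => ?_, fun i => ?_, fun i => sub_eq_zero.2 (hx.a_mul_ε i)⟩, ?_⟩
    · rw [hx.derivε, hx.a', Matrix.zero_mul, add_zero]
    · rw [hx.a', Matrix.mul_zero, Matrix.zero_mul, sub_zero]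
    · obtain ⟨n, hn⟩ := K.exists_word_smul_eq_zero
      refine fun p hp => apply_eq_apply_zero hx.a' (n := n) (fun w hw => ?_) hp
      rw [← hx.rho_word]
      refine comb_injective hx.linearIndependent_frame (funext fun b => ?_)
      rw [← hx.smul_frame, hn w hw, comb_zero, Pi.zero_apply]

end KRDatum

end

section

variable {I : Type*} [Fintype I] [DecidableEq I] {D : CartanDatum I}
variable {Λ : Type} [AddCommGroupWithOne Λ] {V : GradedSpace I Λ}

open Preproj

namespace KRDatum

variable {K : KRDatum D}

/-! ### Frames and points of the Grassmannian -/

namespace IsFrame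

variable {f f' : Tot V → K.KGamma}

theorem restrictScalars_span (hf : K.IsFrame f) :
    (Submodule.span (Preproj D) (Set.range f)).restrictScalars ℂ =
      Submodule.span ℂ (Set.range f) := by
  refine le_antisymm (fun u hu => ?_) (Submodule.span_le_restrictScalars ℂ _ _)
  let N : Submodule (Preproj D) K.KGamma :=
    { Submodule.span ℂ (Set.range f) with smul_mem' := fun p u hu => hf.smul_mem p u hu }
  have : Submodule.span (Preproj D) (Set.range f) ≤ N :=
    Submodule.span_le.2 fun u hu => Submodule.subset_span hu
  exact this hu

theorem span_inf_component (hf : K.IsFrame f) (j : I) (k : Λ) :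
    Submodule.span ℂ (Set.range f) ⊓ K.component j k =
      Submodule.span ℂ (Set.range fun b : {b : V.Basis j // V.deg j b = k} => f ⟨j, b⟩) := by
  refine le_antisymm ?_ (Submodule.span_le.2 ?_)
  · rintro u ⟨hu, huk⟩
    obtain ⟨h1, h2⟩ := mem_component_iff_hasDeg.1 huk
    obtain ⟨M, hM⟩ := exists_comb_eq (f := f) (u := fun _ : Unit => u) fun _ => hu
    have hdeg : Homog (totDeg V) (fun _ : Unit => k) 0 M :=
      homog_of_comb_eq hf.linearIndependent hf.hasDeg (fun _ => by rwa [add_zero]) hM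
    have hE : blk (V := V) j j 1 * M = M := by
      refine comb_injective hf.linearIndependent (funext fun b => ?_)
      rw [← smul_comb (p := gen D (.e j)) (funext fun b => comb_blk_one hf.mem j b), hM, h1]
    rw [← congrFun hM ()]
    refine Submodule.sum_mem _ fun c _ => ?_
    by_cases hc : M c () = 0
    · rw [hc, zero_smul]
      exact Submodule.zero_mem _
    · refine Submodule.smul_mem _ _ (Submodule.subset_span ?_)
      have h3 := hdeg c () hc
      rw [add_zero] at h3
      obtain ⟨i, c⟩ := c
      by_cases hi : i = j
      · subst hi
        exact ⟨⟨c, h3⟩, rfl⟩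
      · refine absurd ?_ hc
        have h4 := congrArg ((inc V i).transpose * ·) hE
        simp only [blk, Matrix.mul_one] at h4
        rw [← Matrix.mul_assoc, ← Matrix.mul_assoc, transpose_inc_mul_inc_of_ne hi,
          Matrix.zero_mul, Matrix.zero_mul, transpose_inc_mul] at h4
        exact (congrFun (congrFun h4 c) ()).symm
  · rintro _ ⟨⟨b, rfl⟩, rfl⟩
    exact ⟨Submodule.subset_span ⟨_, rfl⟩, hf.mem ⟨j, b⟩⟩

theorem span_mem_grassmannian (hf : K.IsFrame f) :
    Submodule.span (Preproj D) (Set.range f) ∈ K.grassmannian V := by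
  classical
  refine ⟨?_, fun j k => ?_⟩
  · rw [hf.restrictScalars_span]
    refine le_antisymm (Submodule.span_le.2 ?_) (iSup₂_le fun j k => inf_le_left)
    rintro _ ⟨b, rfl⟩
    exact (le_iSup₂ (f := fun j k => Submodule.span ℂ (Set.range f) ⊓ K.component j k)
      b.1 (totDeg V b)) ⟨Submodule.subset_span ⟨b, rfl⟩, hf.mem b⟩
  · rw [hf.restrictScalars_span, hf.span_inf_component, GradedSpace.dim, Nat.card_eq_fintype_card]
    exact finrank_span_eq_card (hf.linearIndependent.comp _ fun b b' h =>
      Subtype.ext (sigma_mk_injective h))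

/-- Two frames of the same submodule differ by an automorphism of `V`. -/
theorem exists_gauge (hf : K.IsFrame f) (hf' : K.IsFrame f')
    (h : Submodule.span ℂ (Set.range f) = Submodule.span ℂ (Set.range f')) :
    ∃ g : gaugeGroup V, f' = comb f (diag fun i => (g.1 i)⁻¹.val) := by
  have key : ∀ {f f' : Tot V → K.KGamma} {M : Matrix (Tot V) (Tot V) ℂ}, K.IsFrame f →
      K.IsFrame f' → comb f M = f' → ∀ i, blk (V := V) i i 1 * M = M * blk i i 1 := by
    intro f f' M hf hf' hM i
    refine comb_injective hf.linearIndependent (funext fun b => ?_)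
    rw [← smul_comb (p := gen D (.e i)) (funext fun b => comb_blk_one hf.mem i b), ← comb_comb, hM,
      comb_blk_one hf'.mem]
  have hE : ∀ i, blk i i (1 : Matrix (V.Basis i) (V.Basis i) ℂ) =
      inc V i * (inc V i).transpose := fun i => by rw [blk, Matrix.mul_one]
  have hinv : ∀ {f f' : Tot V → K.KGamma} {M N : Matrix (Tot V) (Tot V) ℂ}, K.IsFrame f →
      K.IsFrame f' → comb f M = f' → comb f' N = f → ∀ i,
      ((inc V i).transpose * M * inc V i) * ((inc V i).transpose * N * inc V i) = 1 := by
    intro f f' M N hf hf' hM hN i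
    have h1 : M * N = 1 := by
      refine comb_injective hf.linearIndependent ?_
      rw [← comb_comb, hM, hN, comb_one]
    have h2 := key hf hf' hM i
    rw [hE] at h2
    calc _ = (inc V i).transpose * (M * (inc V i * (inc V i).transpose)) * N * inc V i := by
          simp only [Matrix.mul_assoc]
      _ = (inc V i).transpose * inc V i * ((inc V i).transpose * (M * N) * inc V i) := by
          rw [← h2]
          simp only [Matrix.mul_assoc]
      _ = 1 := by rw [h1, Matrix.mul_one, transpose_inc_mul_inc, Matrix.one_mul]
  have hdeg : ∀ {f f' : Tot V → K.KGamma} {M : Matrix (Tot V) (Tot V) ℂ}, K.IsFrame f →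
      K.IsFrame f' → comb f M = f' → Homog (totDeg V) (totDeg V) 0 M := fun hf hf' hM =>
    homog_of_comb_eq hf.linearIndependent hf.hasDeg (fun b => by
      rw [add_zero]; exact hf'.hasDeg b) hM
  obtain ⟨M, hM⟩ := exists_comb_eq (f := f) (u := f') fun b => by
    rw [h]; exact Submodule.subset_span ⟨b, rfl⟩
  obtain ⟨N, hN⟩ := exists_comb_eq (f := f') (u := f) fun b => by
    rw [← h]; exact Submodule.subset_span ⟨b, rfl⟩
  let g : ∀ i, (Matrix (V.Basis i) (V.Basis i) ℂ)ˣ := fun i =>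
    ⟨(inc V i).transpose * N * inc V i, (inc V i).transpose * M * inc V i,
      hinv hf' hf hN hM i, hinv hf hf' hM hN i⟩
  refine ⟨⟨g, fun i b b' hb => ?_⟩, ?_⟩
  · by_contra h'
    refine hb ?_
    have hom : Homog (V.deg i) (V.deg i) 0 ((inc V i).transpose * N * inc V i) :=
      (((homog_inc i).transpose.mul (hdeg hf' hf hN) (by simp)).mul (homog_inc i) (add_zero _))
    rw [hom b b' h', add_zero]
  · refine hM.symm.trans (congrArg (comb f) ?_)
    have h1 : ∀ i, blk i i (1 : Matrix (V.Basis i) (V.Basis i) ℂ) * M =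
        blk i i ((inc V i).transpose * M * inc V i) := by
      intro i
      have h2 := key hf hf' hM i
      have h3 : blk i i (1 : Matrix (V.Basis i) (V.Basis i) ℂ) * blk i i 1 = blk i i 1 := by
        rw [blk_mul_blk, Matrix.one_mul]
      rw [← h3, Matrix.mul_assoc, h2, hE, blk]
      simp only [Matrix.mul_assoc]
    calc M = (∑ i, blk i i (1 : Matrix (V.Basis i) (V.Basis i) ℂ)) * M := by
          rw [show (∑ i, blk i i (1 : Matrix (V.Basis i) (V.Basis i) ℂ)) = 1 from diag_one,
            Matrix.one_mul]
      _ = diag fun i => (inc V i).transpose * M * inc V i := by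
          rw [Finset.sum_mul, diag]
          exact Finset.sum_congr rfl fun i _ => h1 i

end IsFrame

theorem span_comb_gauge (f : Tot V → K.KGamma) (g : gaugeGroup V) :
    Submodule.span ℂ (Set.range (comb f (diag fun i => (g.1 i)⁻¹.val))) =
      Submodule.span ℂ (Set.range f) := by
  refine le_antisymm (Submodule.span_le.2 ?_) (Submodule.span_le.2 ?_)
  · rintro _ ⟨b, rfl⟩
    exact comb_mem_span f (diag fun i => (g.1 i)⁻¹.val) b
  · rintro _ ⟨b, rfl⟩
    have h := comb_mem_span (comb f (diag fun i => (g.1 i)⁻¹.val)) (diag fun i => (g.1 i).val) b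
    rwa [comb_comb, diag_gauge_inv_mul, comb_one] at h

/-- Bases of the homogeneous components of a graded submodule form a frame. -/
theorem exists_isFrame {U : Submodule (Preproj D) K.KGamma} (hU : U ∈ K.grassmannian V) :
    ∃ f : Tot V → K.KGamma, K.IsFrame f ∧ Submodule.span (Preproj D) (Set.range f) = U := by
  classical
  obtain ⟨hU1, hU2⟩ := hU
  have hB : ∀ (j : I) (k : Λ), Nonempty (Module.Basis {b : V.Basis j // V.deg j b = k} ℂ
      ↥(U.restrictScalars ℂ ⊓ K.component j k)) := fun j k =>
    ⟨(Module.finBasisOfFinrankEq ℂ _ (hU2 j k)).reindex (Finite.equivFin _).symm⟩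
  let B := fun j k => (hB j k).some
  let f : Tot V → K.KGamma := fun b => B b.1 (totDeg V b) ⟨b.2, rfl⟩
  have hfB : ∀ j k (b : {b : V.Basis j // V.deg j b = k}),
      f ⟨j, b⟩ = (B j k b : K.KGamma) := by
    rintro j k ⟨b, rfl⟩
    rfl
  have hmem : ∀ b, f b ∈ U.restrictScalars ℂ ⊓ K.component b.1 (totDeg V b) := fun b =>
    (B b.1 (totDeg V b) ⟨b.2, rfl⟩).2
  have hspan : Submodule.span ℂ (Set.range f) = U.restrictScalars ℂ := by
    refine le_antisymm (Submodule.span_le.2 ?_) ?_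
    · rintro _ ⟨b, rfl⟩
      exact (hmem b).1
    · rw [hU1]
      refine iSup₂_le fun j k u hu => ?_
      have := congrArg Subtype.val ((B j k).sum_repr ⟨u, hu⟩)
      rw [← show _ = u from this, AddSubmonoidClass.coe_finsetSum]
      refine Submodule.sum_mem _ fun b _ => ?_
      rw [SetLike.val_smul, ← hfB]
      exact Submodule.smul_mem _ _ (Submodule.subset_span ⟨_, rfl⟩)
  have hli : LinearIndependent ℂ f := by
    refine Fintype.linearIndependent_iff.2 fun u hu => ?_
    rintro ⟨j, b⟩
    have h1 := HasDeg.sum_eq (φ := fun c => u c • f c) (s := totDeg V) (k := V.deg j b)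
      (fun c r w hw => by
        rw [map_smul, LinearMap.smul_apply,
          (mem_component_iff_hasDeg.1 (hmem c).2).2 r w hw, smul_zero])
      (ψ := 0) (fun r w _ => by rw [map_zero, LinearMap.zero_apply]) hu
    have h2 := congrArg (gen D (.e j) • ·) h1
    simp only [smul_zero, Finset.smul_sum] at h2
    rw [Fintype.sum_sigma, Finset.sum_eq_single j] at h2
    · have h3 : ∑ b' : {b' : V.Basis j // V.deg j b' = V.deg j b},
          u ⟨j, b'⟩ • B j (V.deg j b) b' = 0 := by
        refine Subtype.ext ?_
        rw [AddSubmonoidClass.coe_finsetSum, ZeroMemClass.coe_zero, ← h2]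
        simp only [smul_ite, smul_zero]
        rw [← Finset.sum_filter, Finset.sum_subtype (p := fun b' => V.deg j b' = V.deg j b) _
          fun b' => by rw [Finset.mem_filter]; exact and_iff_right (Finset.mem_univ b')]
        refine Finset.sum_congr rfl fun b' _ => ?_
        rw [SetLike.val_smul, ← hfB, smul_comm, (mem_component_iff_hasDeg.1 (hmem ⟨j, b'⟩).2).1]
      exact Fintype.linearIndependent_iff.1 (B j (V.deg j b)).linearIndependent _ h3 ⟨b, rfl⟩
    · intro i _ hi
      refine Finset.sum_eq_zero fun c _ => ?_
      split_ifs
      · rw [smul_comm, e_smul_of_ne (Ne.symm hi) (hmem ⟨i, c⟩).2, smul_zero]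
      · rw [smul_zero]
    · simp
  refine ⟨f, ⟨fun b => (hmem b).2, hli, fun p u hu => ?_⟩, ?_⟩
  · rw [hspan] at hu ⊢
    exact U.smul_mem p hu
  · refine le_antisymm (Submodule.span_le.2 ?_) fun u hu => ?_
    · rintro _ ⟨b, rfl⟩
      exact (hmem b).1
    · have : u ∈ Submodule.span ℂ (Set.range f) := by rwa [hspan]
      exact Submodule.span_le_restrictScalars ℂ (Preproj D) _ this

end KRDatum

end

/-! ### Maps with locally regular coordinates -/

section Regular

variable {X E E' E'' : Type*} [AddCommGroup E] [Module ℂ E] [AddCommGroup E'] [Module ℂ E']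
  [AddCommGroup E''] [Module ℂ E'']

/-- The coordinates of the map `F` are locally regular functions. -/
def RegularMap (ι : X → E) (F : X → E') : Prop :=
  ∀ φ : Module.Dual ℂ E', LocallyRegular ι fun x => φ (F x)

theorem RegularMap.of_locallyRegular {ι : X → E} {F : X → ℂ} (h : LocallyRegular ι F) :
    RegularMap ι F := by
  intro φ
  have : (fun x => φ (F x)) = fun x => φ 1 * F x := by
    funext x
    rw [mul_comm, ← smul_eq_mul, ← map_smul, smul_eq_mul, mul_one]
  rw [this]
  exact (LocallyRegular.const ι _).mul h

theorem RegularMap.prodMk {ι : X → E} {F : X → E'} {G : X → E''} (hF : RegularMap ι F)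
    (hG : RegularMap ι G) : RegularMap ι fun x => (F x, G x) := by
  intro φ
  have : (fun x => φ (F x, G x)) = fun x => φ.comp (LinearMap.inl ℂ E' E'') (F x) +
      φ.comp (LinearMap.inr ℂ E' E'') (G x) := by
    funext x
    simp [← map_add]
  rw [this]
  exact (hF _).add (hG _)

theorem RegularMap.pi {ι : X → E} {J : Type*} [Fintype J] {E' : J → Type*}
    [∀ j, AddCommGroup (E' j)] [∀ j, Module ℂ (E' j)] {F : X → ∀ j, E' j}
    (hF : ∀ j, RegularMap ι fun x => F x j) : RegularMap ι F := by
  classical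
  intro φ
  have : (fun x => φ (F x)) = fun x => ∑ j, φ.comp (LinearMap.single ℂ E' j) (F x j) := by
    funext x
    simp only [LinearMap.comp_apply, LinearMap.single_apply, ← map_sum]
    rw [Finset.univ_sum_single]
  rw [this]
  exact LocallyRegular.sum fun j _ => hF j _

theorem RegularMap.matrix {ι : X → E} {κ μ : Type*} [Fintype κ] [Fintype μ]
    {F : X → Matrix κ μ ℂ} (hF : ∀ a b, LocallyRegular ι fun x => F x a b) : RegularMap ι F :=
  RegularMap.pi (E' := fun _ : κ => μ → ℂ) fun a => RegularMap.pi fun b =>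
    .of_locallyRegular (hF a b)

theorem RegularMap.codRestrict {ι : X → E} {N : Submodule ℂ E'} {F : X → N}
    (hF : RegularMap ι fun x => (F x : E')) : RegularMap ι F := by
  intro φ
  obtain ⟨ψ, hψ⟩ := φ.exists_extend
  have : (fun x => φ (F x)) = fun x => ψ (F x) := by
    funext x
    rw [← hψ]
    rfl
  rw [this]
  exact hF ψ

theorem PolyMat.add {ι κ : Type*} {F G : E → Matrix ι κ ℂ} (hF : PolyMat F) (hG : PolyMat G) :
    PolyMat fun x => F x + G x := fun b b' => add_mem (hF b b') (hG b b')

theorem PolyMat.det_mem {ι : Type*} [Fintype ι] [DecidableEq ι] {F : E → Matrix ι ι ℂ}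
    (hF : PolyMat F) : (fun x => (F x).det) ∈ polynomialFunctions E := by
  simp only [Matrix.det_apply']
  refine sum_mem_polynomialFunctions fun σ _ => mul_mem (const_mem_polynomialFunctions _) ?_
  have := prod_mem (S := polynomialFunctions E) (t := Finset.univ) fun b _ => hF (σ b) b
  convert this using 1
  funext x
  rw [Finset.prod_apply]

theorem PolyMat.adjugate {ι : Type*} [Fintype ι] [DecidableEq ι] {F : E → Matrix ι ι ℂ}
    (hF : PolyMat F) : PolyMat fun x => (F x).adjugate := by
  intro b b'
  simp only [Matrix.adjugate_apply]
  refine PolyMat.det_mem fun c c' => ?_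
  by_cases h : c = b'
  · subst h
    simp only [Matrix.updateRow_self]
    exact const_mem_polynomialFunctions _
  · simp only [Matrix.updateRow_ne h]
    exact hF c c'

end Regular

section

variable {I : Type*} [Fintype I] [DecidableEq I] {D : CartanDatum I}
variable {Λ : Type} [AddCommGroupWithOne Λ] {V W : GradedSpace I Λ}

open Preproj

namespace KRDatum

variable {K : KRDatum D}

/-- As `Π eᵢ / Π εᵢˡ` is finite dimensional, the linear forms on its dual are the evaluations. -/
theorem _root_.TripleQuiver.DualModule.exists_eq_ev {i : I} {l : ℕ} (hl : 1 ≤ l)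
    (φ : Module.Dual ℂ (DualModule D i l)) : ∃ p, ∀ ψ, φ ψ = DualModule.ev D i l ψ p := by
  have h1 : FiniteDimensional ℂ (DualModule D i l) := DualModule.finiteDimensional hl
  have h2 : FiniteDimensional ℂ (Module.Dual ℂ (CyclicModule D i l)) := h1
  have h3 : FiniteDimensional ℂ (CyclicModule D i l) := (Module.finite_dual_iff ℂ).1 h2
  obtain ⟨n, hn⟩ := (Module.evalEquiv ℂ (CyclicModule D i l)).surjective φ
  obtain ⟨p, rfl⟩ := DualModule.exists_smul_vac n
  exact ⟨p, fun ψ => (LinearMap.congr_fun hn ψ).symm⟩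

theorem exists_polyMat_rho (p : Preproj D) :
    ∃ F : Rep D V (K.W Λ) → Matrix (Tot V) (Tot V) ℂ, PolyMat F ∧
      ∀ x (hx : K.IsPoint x), hx.rho p = F x := by
  induction p using word_induction with
  | h w => exact ⟨_, polyMat_wordMat w, fun x hx => hx.rho_word w⟩
  | h0 => exact ⟨_, .const 0, fun x hx => map_zero _⟩
  | hadd p q hp hq =>
    obtain ⟨F, hF, h⟩ := hp
    obtain ⟨G, hG, h'⟩ := hq
    exact ⟨_, hF.add hG, fun x hx => by rw [map_add, h, h']⟩
  | hsmul c p hp =>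
    obtain ⟨F, hF, h⟩ := hp
    exact ⟨fun x => c • F x, fun b b' => mul_mem (const_mem_polynomialFunctions c) (hF b b'),
      fun x hx => by rw [map_smul, h]⟩

/-- The frame of a critical point depends polynomially on it. -/
theorem regularMap_frame {X : Type*} (ι : X → Rep D V (K.W Λ)) (h : ∀ x, K.IsPoint (ι x)) :
    RegularMap ι fun x i b => (h x).frame ⟨i, b⟩ := by
  refine RegularMap.pi fun i => RegularMap.pi fun b => RegularMap.pi fun r φ => ?_
  obtain ⟨p, hp⟩ := DualModule.exists_eq_ev (K.l_pos r) φ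
  obtain ⟨F, hF, hρ⟩ := exists_polyMat_rho (K := K) (V := V) (Λ := Λ) (transp p)
  refine .of_polynomial ((((polyMat_a (K.i r)).mul (.const (inc V (K.i r)).transpose)).mul hF)
    (K.idx ⟨r, rfl⟩ (K.last r)) ⟨i, b⟩) fun x => ?_
  refine (hp _).trans (((h x).ev_frame ⟨i, b⟩ r p).trans ?_)
  rw [hρ]
  rfl

/-- The action of `Π` in a frame is obtained from a minor of the frame by Cramer's rule. -/
theorem locallyRegular_action {X : Type*} (ι : X → ∀ i, V.Basis i → K.KGamma)
    (h : ∀ x, K.IsFrame fun b : Tot V => ι x b.1 b.2) (p : Preproj D) (c b : Tot V) :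
    LocallyRegular ι fun x => (h x).action p c b := by
  intro x₀
  obtain ⟨ℓ, hℓ⟩ : ∃ ℓ : K.KGamma →ₗ[ℂ] (Tot V → ℂ), ∀ b : Tot V,
      ℓ (ι x₀ b.1 b.2) = Pi.single b 1 := by
    have hinj : LinearMap.ker (Fintype.linearCombination ℂ
        fun b : Tot V => ι x₀ b.1 b.2) = ⊥ :=
      LinearMap.ker_eq_bot.2 (linearIndependent_iff_injective_fintypeLinearCombination.1 (h x₀).linearIndependent)
    obtain ⟨ℓ, hℓ⟩ := LinearMap.exists_leftInverse_of_injective _ hinj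
    refine ⟨ℓ, fun b => ?_⟩
    have := LinearMap.congr_fun hℓ (Pi.single b 1)
    rw [LinearMap.comp_apply, Fintype.linearCombination_apply_single, one_smul] at this
    exact this
  let G : (∀ i, V.Basis i → K.KGamma) → Matrix (Tot V) (Tot V) ℂ :=
    fun f c b => ℓ (f b.1 b.2) c
  let N : (∀ i, V.Basis i → K.KGamma) → Matrix (Tot V) (Tot V) ℂ :=
    fun f c b => ℓ (p • f b.1 b.2) c
  have hG : PolyMat G := .linear
    (fun x y => by
      ext c b
      exact congrFun (map_add ℓ (x b.1 b.2) (y b.1 b.2)) c)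
    fun z x => by
      ext c b
      exact congrFun (map_smul ℓ z (x b.1 b.2)) c
  have hN : PolyMat N := .linear
    (fun x y => by
      ext c b
      exact congrFun ((congrArg ℓ (smul_add p (x b.1 b.2) (y b.1 b.2))).trans (map_add ℓ _ _)) c)
    fun z x => by
      ext c b
      exact congrFun ((congrArg ℓ (smul_comm p z (x b.1 b.2))).trans (map_smul ℓ _ _)) c
  have hGN : ∀ x, G (ι x) * (h x).action p = N (ι x) := by
    intro x
    ext c b
    have := congrArg (fun u => ℓ u c) (congrFun ((h x).comb_action p) b)
    simp only [map_comb, Finset.sum_apply, Pi.smul_apply, smul_eq_mul] at this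
    rw [Matrix.mul_apply]
    refine Eq.trans (Finset.sum_congr rfl fun d _ => mul_comm _ _) this
  refine ⟨_, (hG.adjugate.mul hN) c b, _, hG.det_mem, ?_, fun x hx => ?_⟩
  · have : G (ι x₀) = 1 := by
      ext c b
      change ℓ (ι x₀ b.1 b.2) c = _
      rw [hℓ, Pi.single_apply, Matrix.one_apply]
    rw [this, Matrix.det_one]
    exact one_ne_zero
  · rw [eq_div_iff hx]
    change _ = ((G (ι x)).adjugate * N (ι x)) c b
    rw [← hGN, ← Matrix.mul_assoc, Matrix.adjugate_mul, Matrix.smul_mul, Matrix.one_mul,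
      Matrix.smul_apply, smul_eq_mul, mul_comm]

theorem regularMap_block {X : Type*} (ι : X → ∀ i, V.Basis i → K.KGamma)
    (h : ∀ x, K.IsFrame fun b : Tot V => ι x b.1 b.2) (p : Preproj D) (i j : I) :
    RegularMap ι fun x => (inc V i).transpose * (h x).action p * inc V j := by
  refine RegularMap.matrix fun a b => ?_
  simp only [transpose_inc_mul, mul_inc]
  exact locallyRegular_action ι h p ⟨i, a⟩ ⟨j, b⟩

/-- The critical point attached to a frame depends on it in a locally regular way. -/
theorem regularMap_point {X : Type*} (ι : X → ∀ i, V.Basis i → K.KGamma)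
    (h : ∀ x, K.IsFrame fun b : Tot V => ι x b.1 b.2) :
    RegularMap ι fun x => (h x).point := by
  have hα : RegularMap ι fun x => (h x).tuple.1 := RegularMap.pi fun i => RegularMap.pi fun j =>
    regularMap_block ι h _ i j
  have hε : RegularMap ι fun x => (h x).tuple.2.1 := RegularMap.pi fun i =>
    regularMap_block ι h _ i i
  have ha : RegularMap ι fun x => (h x).tuple.2.2.1 := by
    refine RegularMap.pi (E' := fun i => Matrix ((K.W Λ).Basis i) (V.Basis i) ℂ) fun i =>
      RegularMap.matrix ?_
    rintro ⟨r, m⟩ b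
    exact (LocallyRegular.const ι (K.coef r m)⁻¹).mul (.of_polynomial
      (dual_mem_polynomialFunctions ((LinearMap.applyₗ (gen D (.ε i) ^ (m.rev : ℕ))) ∘ₗ K.ev r ∘ₗ
        LinearMap.proj b ∘ₗ LinearMap.proj i)) fun x => rfl)
  have ha' : RegularMap ι fun x => (h x).tuple.2.2.2 := fun φ =>
    .const ι (φ (0 : ∀ i, Matrix (V.Basis i) ((K.W Λ).Basis i) ℂ))
  exact RegularMap.codRestrict (hα.prodMk (hε.prodMk (ha.prodMk ha')))

/-! ### The comparison -/

theorem _root_.TripleQuiver.Stable.gaugeAct {x : Rep D V W} (hx : Stable D x) (g : gaugeGroup V) :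
    Stable D (gaugeAct g x) := by
  intro S hgr hα hε ha i
  have hx' := mem_rep_iff.1 x.2
  have hinv : ∀ {κ : Type} (i) (A : Matrix (V.Basis i) κ ℂ),
      (g.1 i)⁻¹.val * ((g.1 i).val * A) = A := fun i A => by
    rw [← Matrix.mul_assoc, Units.inv_mul, Matrix.one_mul]
  have key := hx (fun i => (S i).comap (g.1 i).val.mulVecLin) ?_ ?_ ?_ ?_ i
  · refine (Submodule.eq_bot_iff _).2 fun u hu => ?_
    have h1 : (g.1 i)⁻¹.val.mulVec u ∈ (S i).comap (g.1 i).val.mulVecLin := by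
      rw [Submodule.mem_comap, Matrix.mulVecLin_apply, Matrix.mulVec_mulVec, Units.mul_inv,
        Matrix.one_mulVec]
      exact hu
    rw [key, Submodule.mem_bot] at h1
    have h2 := congrArg (g.1 i).val.mulVec h1
    rwa [Matrix.mulVec_mulVec, Units.mul_inv, Matrix.one_mulVec, Matrix.mulVec_zero] at h2
  · intro i u hu k
    have h1 := hgr i _ hu k
    rw [Matrix.mulVecLin_apply] at h1
    have h2 := (homog_gauge g.2 i).mulVec_component k u
    rw [add_zero] at h2
    rw [Submodule.mem_comap, Matrix.mulVecLin_apply]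
    exact h2 ▸ h1
  · intro i j u hu
    have h1 := hα i j _ hu
    change ((g.1 i).val * x.1.α i j * (g.1 j)⁻¹.val).mulVec ((g.1 j).val.mulVec u) ∈ S i at h1
    rw [Matrix.mulVec_mulVec, Matrix.mul_assoc, Units.inv_mul, Matrix.mul_one] at h1
    rw [Submodule.mem_comap, Matrix.mulVecLin_apply, Matrix.mulVec_mulVec]
    exact h1
  · intro i u hu
    have h1 := hε i _ hu
    change ((g.1 i).val * x.1.ε i * (g.1 i)⁻¹.val).mulVec ((g.1 i).val.mulVec u) ∈ S i at h1
    rw [Matrix.mulVec_mulVec, Matrix.mul_assoc, Units.inv_mul, Matrix.mul_one] at h1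
    rw [Submodule.mem_comap, Matrix.mulVecLin_apply, Matrix.mulVec_mulVec]
    exact h1
  · intro i u hu
    have h1 := ha i _ hu
    change (x.1.a i * (g.1 i)⁻¹.val).mulVec ((g.1 i).val.mulVec u) = 0 at h1
    rwa [Matrix.mulVec_mulVec, Matrix.mul_assoc, Units.inv_mul, Matrix.mul_one] at h1

variable (D V W) in
/-- The quotient map to the quiver variety is open, as its fibers are the orbits of a group which
acts by linear automorphisms. -/
theorem _root_.TripleQuiver.isOpen_saturation (T : TopKind) (U : Set {x : Rep D V W // Stable D x})
    (hU : @IsOpen _ (TopologicalSpace.induced Subtype.val (T.on (Rep D V W))) U) :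
    @IsOpen _ (TopologicalSpace.induced Subtype.val (T.on (Rep D V W)))
      (Quotient.mk (orbitSetoid D V W) ⁻¹' (Quotient.mk (orbitSetoid D V W) '' U)) := by
  let := T.on (Rep D V W)
  have hset : Quotient.mk (orbitSetoid D V W) ⁻¹' (Quotient.mk (orbitSetoid D V W) '' U) =
      ⋃ g : gaugeGroup V, (fun x : {x : Rep D V W // Stable D x} =>
        (⟨gaugeAct g x.1, x.2.gaugeAct g⟩ : {x : Rep D V W // Stable D x})) ⁻¹' U := by
    ext x
    rw [Set.mem_iUnion]
    constructor
    · rintro ⟨y, hy, hyx⟩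
      have : SameOrbit D y.1 x.1 := Quotient.exact hyx
      obtain ⟨g, hg⟩ := sameOrbit_iff.1 ((sameOrbit_equivalence D V W).symm this)
      refine ⟨g, ?_⟩
      rw [Set.mem_preimage]
      convert hy
    · rintro ⟨g, hg⟩
      refine ⟨_, hg, Quotient.sound ?_⟩
      exact (sameOrbit_equivalence D V W).symm (sameOrbit_gaugeAct g x.1)
  rw [hset]
  refine isOpen_iUnion fun g => hU.preimage ?_
  exact ((continuous_linearMap T (gaugeAct g)).comp continuous_subtype_val).subtype_mk _

variable (K V) in
/-- The comparison map sends the class of a critical point to the span of its frame. -/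
theorem exists_isHomeomorph : ∃ e : K.criticalFiber V → K.grassmannian V, ∀ T : TopKind,
    @IsHomeomorph _ _ (K.criticalFiberTop T V) (K.grassmannianTop T V) e := by
  have hpt : ∀ x : {x : {x : Rep D V (K.W Λ) // Stable D x} //
      Quotient.mk (orbitSetoid D V (K.W Λ)) x ∈ K.criticalFiber V}, K.IsPoint x.1.1 :=
    fun x => mk_mem_criticalFiber_iff.1 x.2
  have hfr : ∀ f : K.frames V, K.IsFrame (fun b : Tot V => f.1 b.1 b.2) :=
    fun f => mem_frames_iff.1 f.2
  refine exists_isHomeomorph_quotient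
    (fun T : TopKind => TopologicalSpace.induced Subtype.val (T.on (Rep D V (K.W Λ))))
    (fun T : TopKind => TopologicalSpace.induced Subtype.val (T.on (∀ i, V.Basis i → K.KGamma)))
    (Quotient.mk (orbitSetoid D V (K.W Λ))) Quotient.mk_surjective
    (fun f : K.frames V => Submodule.span (Preproj D) (Set.range fun b : Tot V => f.1 b.1 b.2))
    (K.criticalFiber V) (K.grassmannian V)
    (fun x => ⟨fun i b => (hpt x).frame ⟨i, b⟩, mem_frames_iff.2 (hpt x).isFrame_frame⟩)
    (fun f => ⟨⟨(hfr f).point, (hfr f).stable_point⟩,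
      mk_mem_criticalFiber_iff.2 (hfr f).isPoint⟩) ?_ ?_ ?_ ?_ ?_
    (isOpen_saturation D V (K.W Λ))
  · intro f
    refine Subtype.ext (funext fun i => funext fun b => ?_)
    exact congrFun (hfr f).frame_isPoint ⟨i, b⟩
  · refine Set.Subset.antisymm ?_ fun U hU => ?_
    · rintro _ ⟨f, rfl⟩
      exact (hfr f).span_mem_grassmannian
    · obtain ⟨f, hf, rfl⟩ := exists_isFrame hU
      exact ⟨⟨fun i b => f ⟨i, b⟩, mem_frames_iff.2 hf⟩, rfl⟩
  · intro x y
    have h1 : (Quotient.mk (orbitSetoid D V (K.W Λ)) x.1 =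
        Quotient.mk (orbitSetoid D V (K.W Λ)) y.1) ↔ SameOrbit D x.1.1 y.1.1 := Quotient.eq
    rw [h1, sameOrbit_iff]
    change _ ↔ Submodule.span (Preproj D) (Set.range (hpt x).frame) =
      Submodule.span (Preproj D) (Set.range (hpt y).frame)
    rw [← (Submodule.restrictScalars_injective ℂ (Preproj D) K.KGamma).eq_iff,
      (hpt x).isFrame_frame.restrictScalars_span, (hpt y).isFrame_frame.restrictScalars_span]
    constructor
    · rintro ⟨g, hg⟩
      have hy : K.IsPoint (gaugeAct g x.1.1) := hg ▸ hpt y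
      have h2 : (hpt y).frame = hy.frame := by
        have : ∀ {z z' : Rep D V (K.W Λ)} (hz : K.IsPoint z) (hz' : K.IsPoint z'), z = z' →
            hz.frame = hz'.frame := by
          rintro z _ hz hz' rfl
          rfl
        exact this _ _ hg.symm
      rw [h2, (hpt x).frame_gaugeAct g hy, span_comb_gauge]
    · intro h
      obtain ⟨g, hg⟩ := (hpt x).isFrame_frame.exists_gauge (hpt y).isFrame_frame h
      have hy : K.IsPoint (gaugeAct g x.1.1) := by
        have hst : Stable D (gaugeAct g x.1.1) := x.1.2.gaugeAct g
        have hm : Quotient.mk (orbitSetoid D V (K.W Λ)) x.1 =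
            Quotient.mk (orbitSetoid D V (K.W Λ)) ⟨_, hst⟩ :=
          Quotient.sound (sameOrbit_gaugeAct g x.1.1)
        have hmem := x.2
        rw [hm] at hmem
        exact mk_mem_criticalFiber_iff.1 hmem
      refine ⟨g, hy.eq_of_frame_eq (hpt y) ?_⟩
      rw [(hpt x).frame_gaugeAct g hy, hg]
  · intro T
    refine continuous_induced_rng.2 ?_
    rw [induced_compose]
    have := regularMap_frame (fun x : {x : {x : Rep D V (K.W Λ) // Stable D x} //
      Quotient.mk (orbitSetoid D V (K.W Λ)) x ∈ K.criticalFiber V} => x.1.1) hpt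
    exact continuous_of_locallyRegular T this
  · intro T
    refine continuous_induced_rng.2 (continuous_induced_rng.2 ?_)
    have := regularMap_point (fun f : K.frames V => f.1) hfr
    exact continuous_of_locallyRegular T this

end KRDatum

end

end TripleQuiver

end

open TripleQuiver in
theorem proposition5p1 {I : Type*} [Fintype I] [DecidableEq I] (D : CartanDatum I)
    (K : KRDatum D) :
    (∀ v : I → ℕ,
      ∃ e : K.criticalFiber (GradedSpace.ofDim v) → K.grassmannian (GradedSpace.ofDim v),
        ∀ T : TopKind,
          @IsHomeomorph _ _ (K.criticalFiberTop T _) (K.grassmannianTop T _) e) ∧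
    (∀ v : I × ℤ →₀ ℕ,
      ∃ e : K.criticalFiber (GradedSpace.ofGradedDim v) →
          K.grassmannian (GradedSpace.ofGradedDim v),
        ∀ T : TopKind,
          @IsHomeomorph _ _ (K.criticalFiberTop T _) (K.grassmannianTop T _) e) := by 
  exact ⟨fun v => K.exists_isHomeomorph (GradedSpace.ofDim v),
    fun v => K.exists_isHomeomorph (GradedSpace.ofGradedDim v)⟩
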